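/- **Setting.** Let $(X,\|\cdot\|)$ be a separable Banach space and $K\colon X\to X$ a compact linear operator with dense range and $\|Kx\|\le\|x\|$ for all $x\in X$. Let ${\rm Lip}$ be the set of all $u\colon X\to\mathbb R$ for which there is $L\ge0$ with $|u(x_1)-u(x_2)|\le L\|K(x_1-x_2)\|$ for all $x_1,x_2\in X$; $\|u\|_{\rm Lip}$ is the smallest such $L$, and ${\rm Lip}_{\rm b}$ is the set of bounded $u\in{\rm Lip}$. For functions on $X$, $u_n\to u$ means $\sup_n\|u_n\|_\infty<\infty$ and $\sup_{\|x\|\le r}|u_n(x)-u(x)|\to0$ for all $r\ge0$ (for $u_h\to u$ as $h\downarrow0$ the bound is required for small $h>0$). Let ${\rm C}_{\rm b}={\rm C}_{\rm b}^K(X)$ be the set of all limits, in this sense, of sequences in ${\rm Lip}_{\rm b}$, and let ${\rm C}^1_{\rm b}$ be the set of all Fréchet differentiable $u\in{\rm Lip}_{\rm b}$ such that $x\mapsto\|u'(x)\|$ belongs to ${\rm C}_{\rm b}$, where $\|u'(x)\|$ is the operator norm. Let $p\in(1,\infty)$, let $\mathcal P_p(X)$ be the set of Borel probability measures on $X$ with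 finite $p$-th moment, and let $\mathcal W_p$ be the $p$-Wasserstein distance on it. Let $(\mu_t)_{t\ge0}\subset\mathcal P_p(X)$ and $\psi_t\colon X\to X$, $t\ge0$, satisfy the Chapman–Kolmogorov equations $$\int_X u(\psi_{t+s}(x)+y)\,\mu_{t+s}(dy)=\int_X\int_X u\big(\psi_s(\psi_t(x)+y)+z\big)\,\mu_s(dz)\,\mu_t(dy)$$ for all $s,t\ge0$, $u\in{\rm C}_{\rm b}$, $x\in X$, and the following conditions. * (A1) There is $c\ge0$ with $\|\psi_t(x_1)-\psi_t(x_2)\|\le e^{ct}\|x_1-x_2\|$ for all $t\ge0$ and $x_1,x_2\in X$. * (A2) $K\psi_t(x)=\psi_t(Kx)$ and $\psi_0(x)=x$ for all $t\ge0$, $x\in X$, and $\lim_{h\downarrow0}\sup_{\|x\|\le r}\|\psi_h(Kx)-Kx\|=0$ for all $r\ge0$. * (A3) $\lim_{h\downarrow0}\int_X\|y\|^p\,\mu_h(dy)=0$. Let $\varphi\colon[0,\infty)\to[0,\infty]$ be convex and lower semicontinuous with $\varphi(0)=0$, $\varphi(v)\ne0$ for some $v>0$, and $v\mapsto\varphi(v^{1/p})$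 convex. Put $\varphi^*(w):=\sup_{v\ge0}(vw-\varphi(v))$ for $w\ge0$, $\varphi_t(v):=t\,\varphi(e^{-ct}v/t)$ for $t>0$, and $\varphi_0:=\infty\cdot 1_{(0,\infty)}$. For $t\ge0$, $u\in{\rm C}_{\rm b}$, $x\in X$ define $$(T(t)u)(x):=\int_X u(\psi_t(x)+y)\,\mu_t(dy),\qquad (I(t)u)(x):=\sup_{\nu\in\mathcal P_p(X)}\Big(\int_X u(\psi_t(x)+z)\,\nu(dz)-\varphi_t\big(\mathcal W_p(\mu_t,\nu)\big)\Big),$$ $$I^n(t)u:=I(2^{-n})^kI(t-k2^{-n})u\ \ \text{with } k=\lfloor 2^nt\rfloor,\ n\in\mathbb N_0,\qquad S(t)u:=\inf_{n\in\mathbb N_0}I^n(t)u .$$ For a family $R=(R(t))_{t\ge0}$ of operators on ${\rm C}_{\rm b}$, the generator has domain the set of all $u\in{\rm C}_{\rm b}$ for which $\frac{R(h)u-u}{h}\to g$ as $h\downarrow0$ for some $g\in{\rm C}_{\rm b}$, and maps $u$ to $g$. Let $B$, with domain $D(B)$, be the generator of $T=(T(t))_{t\ge0}$. **Theorem.** For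 all $t\ge0$ and $u\in{\rm C}_{\rm b}$, the sequence $(I^n(t)u)_{n\in\mathbb N_0}$ is pointwise nonincreasing and converges pointwise to $S(t)u$. The family $S=(S(t))_{t\ge0}$ is a strongly continuous convex transition semigroup on ${\rm C}_{\rm b}$ in the following sense: 1. for all $t\ge0$, $S(t)$ maps ${\rm C}_{\rm b}$ into ${\rm C}_{\rm b}$, is convex and monotone, $S(t)m=m$ for every constant $m\in\mathbb R$, and for every $u\in{\rm Lip}_{\rm b}$ one has $S(t)u\in{\rm Lip}_{\rm b}$ and $\|S(t)u\|_{\rm Lip}\le e^{ct}\|u\|_{\rm Lip}$; 2. $S(t)S(s)u=S(t+s)u$ for all $s,t\ge0$ and $u\in{\rm C}_{\rm b}$; 3. if $u_n,u\in{\rm C}_{\rm b}$ and $u_n\to u$, then $S(t)u_n\to S(t)u$ uniformly in $t\in[0,s]$ for every $s\ge0$, i.e. $\sup_n\sup_{t\in[0,s]}\|S(t)u_n\|_\infty<\infty$ and $\sup_{t\in[0,s]}\sup_{\|x\|\le r}|(S(t)u_n)(x)-(S(t)u)(x)|\to0$ as $n\to\infty$ for all $r\ge0$; 4. $S(t)u\to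 u$ as $t\downarrow0$ for all $u\in{\rm C}_{\rm b}$. Let $A$, with domain $D(A)$, be the generator of $S$. Then $D(B)\cap{\rm C}^1_{\rm b}\subset D(A)$ and $$(Au)(x)=(Bu)(x)+\varphi^*\big(\|u'(x)\|\big)\qquad\text{for all }u\in D(B)\cap{\rm C}^1_{\rm b}\text{ and }x\in X.$$ -/

import Mathlib

open MeasureTheory Filter Topology
open scoped NNReal ENNReal

noncomputable section

namespace WassersteinSemigroup

/-! ### Function spaces attached to the operator `K` -/

section FunctionSpaces

variable {X : Type*} [NormedAddCommGroup X]

/-- Convergence `v i → u` along `l`: uniform boundedness together with uniform convergence on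
bounded sets. The bound is asked for eventually; for sequences of bounded functions this is the
same as a bound for all indices. -/
def LocConv {ι : Type*} (l : Filter ι) (v : ι → X → ℝ) (u : X → ℝ) : Prop :=
  (∃ C : ℝ, ∀ᶠ i in l, ∀ x : X, |v i x| ≤ C) ∧
    ∀ r : ℝ, TendstoUniformlyOn v u l (Metric.closedBall 0 r)

theorem LocConv.unique {ι : Type*} {l : Filter ι} [l.NeBot] {v : ι → X → ℝ} {u₁ u₂ : X → ℝ}
    (h₁ : LocConv l v u₁) (h₂ : LocConv l v u₂) : u₁ = u₂ := by
  funext x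
  have hx : x ∈ Metric.closedBall (0 : X) ‖x‖ := by simp
  exact tendsto_nhds_unique ((h₁.2 ‖x‖).tendsto_at hx) ((h₂.2 ‖x‖).tendsto_at hx)

variable [NormedSpace ℝ X]

/-- `u` is Lipschitz with constant `L` with respect to the seminorm `x ↦ ‖K x‖`. -/
def LipWith (K : X →L[ℝ] X) (L : ℝ) (u : X → ℝ) : Prop :=
  0 ≤ L ∧ ∀ x₁ x₂ : X, |u x₁ - u x₂| ≤ L * ‖K (x₁ - x₂)‖

/-- The smallest Lipschitz constant of `u` with respect to `x ↦ ‖K x‖`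
(meaningful only if there is one). -/
def lipNorm (K : X →L[ℝ] X) (u : X → ℝ) : ℝ :=
  sInf {L : ℝ | LipWith K L u}

/-- The space of bounded functions that are Lipschitz with respect to `x ↦ ‖K x‖`. -/
def Lipb (K : X →L[ℝ] X) : Set (X → ℝ) :=
  {u | (∃ L : ℝ, LipWith K L u) ∧ ∃ C : ℝ, ∀ x : X, |u x| ≤ C}

/-- The space of limits of sequences in `Lipb K`. -/
def Cb (K : X →L[ℝ] X) : Set (X → ℝ) :=
  {u | ∃ v : ℕ → X → ℝ, (∀ n, v n ∈ Lipb K) ∧ LocConv atTop v u}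

/-- Fréchet differentiable functions in `Lipb K` such that the norm of the derivative belongs
to `Cb K`. -/
def C1b (K : X →L[ℝ] X) : Set (X → ℝ) :=
  {u | u ∈ Lipb K ∧ Differentiable ℝ u ∧ (fun x : X => ‖fderiv ℝ u x‖) ∈ Cb K}

/-- Strongly continuous convex transition semigroups on `Cb K` whose Lipschitz constants grow at
most at the exponential rate `c`. -/
structure IsConvexTransitionSemigroup (K : X →L[ℝ] X) (c : ℝ≥0)
    (S : ℝ≥0 → (X → ℝ) → (X → ℝ)) : Prop where
  mapsTo : ∀ t : ℝ≥0, Set.MapsTo (S t) (Cb K) (Cb K)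
  convex : ∀ t : ℝ≥0, ConvexOn ℝ (Cb K) (S t)
  monotone : ∀ t : ℝ≥0, MonotoneOn (S t) (Cb K)
  const : ∀ (t : ℝ≥0) (m : ℝ), S t (fun _ => m) = fun _ => m
  lip : ∀ t : ℝ≥0, ∀ u ∈ Lipb K,
    S t u ∈ Lipb K ∧ lipNorm K (S t u) ≤ Real.exp (c * t) * lipNorm K u
  semigroup : ∀ s t : ℝ≥0, ∀ u ∈ Cb K, S t (S s u) = S (t + s) u
  continuous : ∀ (s : ℝ≥0) (v : ℕ → X → ℝ) (u : X → ℝ), (∀ n, v n ∈ Cb K) → u ∈ Cb K →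
    LocConv atTop v u →
      (∃ C : ℝ, ∀ n : ℕ, ∀ t ≤ s, ∀ x : X, |S t (v n) x| ≤ C) ∧
      ∀ r : ℝ, ∀ ε > 0, ∃ N : ℕ, ∀ n ≥ N, ∀ t ≤ s, ∀ x : X, ‖x‖ ≤ r →
        |S t (v n) x - S t u x| ≤ ε
  strongly_continuous : ∀ u ∈ Cb K, LocConv (𝓝[>] (0 : ℝ≥0)) (fun t => S t u) u

/-- `u` is in the domain of the generator of `S`, and the generator maps `u` to `g`. -/
def HasGenerator (K : X →L[ℝ] X) (S : ℝ≥0 → (X → ℝ) → (X → ℝ)) (u g : X → ℝ) : Prop :=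
  u ∈ Cb K ∧ g ∈ Cb K ∧
    LocConv (𝓝[>] (0 : ℝ≥0)) (fun (h : ℝ≥0) (x : X) => (S h u x - u x) / (h : ℝ)) g

/-- The domain of the generator of `S`. -/
def genDomain (K : X →L[ℝ] X) (S : ℝ≥0 → (X → ℝ) → (X → ℝ)) : Set (X → ℝ) :=
  {u | ∃ g : X → ℝ, HasGenerator K S u g}

open Classical in
/-- The generator of `S` (with value `0` outside of its domain). -/
def generator (K : X →L[ℝ] X) (S : ℝ≥0 → (X → ℝ) → (X → ℝ)) (u : X → ℝ) : X → ℝ :=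
  if h : ∃ g : X → ℝ, HasGenerator K S u g then h.choose else 0

/-- The generator is single-valued, so that the choice in its definition is immaterial. -/
theorem HasGenerator.generator_eq {K : X →L[ℝ] X} {S : ℝ≥0 → (X → ℝ) → (X → ℝ)} {u g : X → ℝ}
    (h : HasGenerator K S u g) : generator K S u = g := by
  have he : ∃ g : X → ℝ, HasGenerator K S u g := ⟨g, h⟩
  unfold generator
  rw [dif_pos he]
  exact he.choose_spec.2.2.unique h.2.2

end FunctionSpaces

/-! ### The penalisation function -/

/-- The scaled penalisation: `φ_t(v) = t φ(e^{-ct} v / t)` for `t > 0`, and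
`φ_0 = ∞ · 1_{(0,∞)}`. -/
def scaledPenalty (c : ℝ≥0) (φ : ℝ≥0 → ℝ≥0∞) (t v : ℝ≥0) : ℝ≥0∞ :=
  if t = 0 then (if v = 0 then 0 else ∞)
  else (t : ℝ≥0∞) * φ ((Real.exp (-(c * t : ℝ))).toNNReal * (v / t))

/-- The convex conjugate `φ*(w) = sup_{v ≥ 0} (v w - φ(v))`. Points `v` with `φ(v) = ∞`
do not contribute to the supremum and are left out. -/
def conjugate (φ : ℝ≥0 → ℝ≥0∞) (w : ℝ) : ℝ :=
  sSup {r : ℝ | ∃ v : ℝ≥0, φ v ≠ ∞ ∧ r = v * w - (φ v).toReal}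

/-! ### Wasserstein distance and the operators -/

section Operators

variable {X : Type*} [NormedAddCommGroup X] [MeasurableSpace X]

/-- Probability measures with finite `p`-th moment. -/
def Pp (p : ℝ) : Set (Measure X) :=
  {μ | IsProbabilityMeasure μ ∧ ∫⁻ y, ‖y‖ₑ ^ p ∂μ < ∞}

/-- Couplings of `μ` and `ν`. -/
def Cpl (μ ν : Measure X) : Set (Measure (X × X)) :=
  {π | IsProbabilityMeasure π ∧ π.map Prod.fst = μ ∧ π.map Prod.snd = ν}

/-- The `p`-Wasserstein distance of `μ, ν ∈ Pp p` (where the infimum is finite). -/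
def wasserstein (p : ℝ) (μ ν : Measure X) : ℝ≥0 :=
  ((⨅ π ∈ Cpl μ ν, ∫⁻ yz, ‖yz.1 - yz.2‖ₑ ^ p ∂π) ^ (1 / p)).toNNReal

/-- The transition semigroup of the reference process `ψ_t(x) + Y_t`, `Y_t ∼ μ_t`. -/
def refOp (ψ : ℝ≥0 → X → X) (μ : ℝ≥0 → Measure X) (t : ℝ≥0) (u : X → ℝ) (x : X) : ℝ :=
  ∫ y, u (ψ t x + y) ∂(μ t)

/-- The one-step worst-case operator `I(t)`. Measures with infinite penalty do not contribute to
the supremum and are left out. -/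
def worstCase (p : ℝ) (c : ℝ≥0) (φ : ℝ≥0 → ℝ≥0∞) (ψ : ℝ≥0 → X → X) (μ : ℝ≥0 → Measure X)
    (t : ℝ≥0) (u : X → ℝ) (x : X) : ℝ :=
  sSup {r : ℝ | ∃ ν ∈ Pp p, scaledPenalty c φ t (wasserstein p (μ t) ν) ≠ ∞ ∧
    r = (∫ z, u (ψ t x + z) ∂ν) - (scaledPenalty c φ t (wasserstein p (μ t) ν)).toReal}

/-- The composition `I^n(t) = I(2⁻ⁿ)^k I(t - k 2⁻ⁿ)`, with `k` the largest natural number such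
that `k 2⁻ⁿ ≤ t`. -/
def dyadicOp (p : ℝ) (c : ℝ≥0) (φ : ℝ≥0 → ℝ≥0∞) (ψ : ℝ≥0 → X → X) (μ : ℝ≥0 → Measure X)
    (n : ℕ) (t : ℝ≥0) (u : X → ℝ) : X → ℝ :=
  (worstCase p c φ ψ μ ((2 : ℝ≥0) ^ n)⁻¹)^[⌊t * 2 ^ n⌋₊]
    (worstCase p c φ ψ μ (t - ⌊t * 2 ^ n⌋₊ * ((2 : ℝ≥0) ^ n)⁻¹) u)

/-- The operator `S(t) = inf_n I^n(t)`. -/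
def robustOp (p : ℝ) (c : ℝ≥0) (φ : ℝ≥0 → ℝ≥0∞) (ψ : ℝ≥0 → X → X) (μ : ℝ≥0 → Measure X)
    (t : ℝ≥0) (u : X → ℝ) (x : X) : ℝ :=
  ⨅ n : ℕ, dyadicOp p c φ ψ μ n t u x

end Operators

end WassersteinSemigroup

end

/-!
The worst-case operator `I(t)` is handled through its dual. For a line `m v ^ p` lying below
`a + φ(v)`, every `ν` and every coupling of `μ_t` and `ν` give
`I(t)u ≤ T(t)(supConv u) + t a`, where `supConv` is the sup-convolution with a multiple of
`‖d‖ ^ p` (`worstCase_le_refOp_supConv`). Conversely, on Lipschitz functions the infimum of the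
right-hand side over `(m, a)` is `I(t)u` (`exists_refOp_supConv_le`): the pairs of the cost
`E‖D‖ ^ p` and the gain of random displacements `D` of `Y ∼ μ_t` form a convex set, and since
`v ↦ φ(v ^ (1 / p))` is convex this set is separated from `φ` by a line.
Two sup-convolutions separated by a reference step combine into one by convexity of
`v ↦ v ^ p`, at the exponential rate built into `φ_t`
(`supConv_refOp_supConv_le`). With duality this gives `I(t) I(s) ≤ I(t + s)`
(`worstCase_add_le`), hence the monotonicity of the dyadic compositions.

The passage from `I` to `S` is abstract (`IsGeneratingFamily`). All compositions of the operators
`I` with total time `t` lie between `T(t)` and `I(t)`. Hence they inherit the tail estimate of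
`I(t)`, which convexity turns into a common modulus of continuity for the convergence on bounded
sets (`exists_modulus_of_tail`), and they preserve Lipschitz constants with respect to `‖K ·‖`
up to an exponential factor. As `K` is compact, pointwise convergence of functions with a common
Lipschitz constant is uniform on bounded sets (`eventually_abs_sub_le_of_lipWith`); this yields the
semigroup property first at dyadic times and then at all times. The generator of `S` is the
derivative of `I` at time zero: `S ≤ I` is one half, and telescoping along the dyadic partition the
other (`hasGenerator_dyadicInf`).

Finally, the derivative of `I` at zero is computed by duality (`locConv_worstCase`). The increment
of the sup-convolution of `u` over a short time is estimated from above by the mean value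
inequality, and from below by a point at distance `v t` where `u` has increased by almost
`v t ‖u'‖`. Closed balls are not compact, and such a point is provided by Ekeland's
variational principle (`exists_add_mul_le_of_lt_norm_fderiv`).
-/

namespace WassersteinSemigroup

/-! ### Calculus in `Lipb K` and `Cb K` -/

section Calculus

variable {X : Type*} [NormedAddCommGroup X] [NormedSpace ℝ X] {K : X →L[ℝ] X}

theorem locConv_iff {X : Type*} [NormedAddCommGroup X] {ι : Type*} {l : Filter ι}
    {v : ι → X → ℝ} {u : X → ℝ} :
    LocConv l v u ↔ (∃ C : ℝ, ∀ᶠ i in l, ∀ x : X, |v i x| ≤ C) ∧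
      ∀ r : ℝ, ∀ ε > 0, ∀ᶠ i in l, ∀ x : X, ‖x‖ ≤ r → |v i x - u x| ≤ ε := by
  refine and_congr Iff.rfl (forall_congr' fun r => ?_)
  rw [Metric.tendstoUniformlyOn_iff]
  constructor
  · intro h ε hε
    filter_upwards [h ε hε] with i hi x hx
    have := hi x (by simpa using hx)
    rw [dist_comm, Real.dist_eq] at this
    exact this.le
  · intro h ε hε
    filter_upwards [h (ε / 2) (half_pos hε)] with i hi x hx
    rw [dist_comm, Real.dist_eq]
    exact (hi x (by simpa using hx)).trans_lt (half_lt_self hε)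

theorem LipWith.lipschitz {L : ℝ} {u : X → ℝ} (h : LipWith K L u)
    (hK : ∀ x : X, ‖K x‖ ≤ ‖x‖) (x y : X) : |u x - u y| ≤ L * ‖x - y‖ :=
  (h.2 x y).trans (mul_le_mul_of_nonneg_left (hK _) h.1)

theorem LipWith.continuous {L : ℝ} {u : X → ℝ} (h : LipWith K L u) : Continuous u := by
  have : LipschitzWith (L * ‖K‖).toNNReal u := by
    refine LipschitzWith.of_dist_le_mul fun x y => ?_
    rw [Real.coe_toNNReal _ (mul_nonneg h.1 (norm_nonneg _)), Real.dist_eq, dist_eq_norm,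
      mul_assoc]
    exact (h.2 x y).trans (mul_le_mul_of_nonneg_left (K.le_opNorm _) h.1)
  exact this.continuous

theorem LipWith.of_sub_le {L : ℝ} {u : X → ℝ} (hL : 0 ≤ L)
    (h : ∀ x y : X, u x - u y ≤ L * ‖K (x - y)‖) : LipWith K L u := by
  refine ⟨hL, fun x y => abs_le.2 ⟨?_, h x y⟩⟩
  have := h y x
  rw [← neg_sub x y, map_neg, norm_neg] at this
  linarith

theorem LipWith.comp {L A : ℝ} {u : X → ℝ} (h : LipWith K L u) {f : ℝ → ℝ} (hA : 0 ≤ A)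
    (hf : ∀ a b, |f a - f b| ≤ A * |a - b|) : LipWith K (A * L) (fun x => f (u x)) :=
  ⟨mul_nonneg hA h.1, fun x y => (hf _ _).trans (by
    rw [mul_assoc]; exact mul_le_mul_of_nonneg_left (h.2 x y) hA)⟩

theorem LipWith.add {L₁ L₂ : ℝ} {u v : X → ℝ} (hu : LipWith K L₁ u) (hv : LipWith K L₂ v) :
    LipWith K (L₁ + L₂) (fun x => u x + v x) := by
  refine ⟨add_nonneg hu.1 hv.1, fun x y => ?_⟩
  have h1 := hu.2 x y
  have h2 := hv.2 x y
  calc |u x + v x - (u y + v y)| = |(u x - u y) + (v x - v y)| := by ring_nf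
    _ ≤ |u x - u y| + |v x - v y| := abs_add_le _ _
    _ ≤ _ := by rw [add_mul]; linarith

theorem abs_clip_le {C : ℝ} (hC : 0 ≤ C) (a : ℝ) : |max (-C) (min C a)| ≤ C :=
  abs_le.2 ⟨le_max_left _ _, max_le (by linarith) (min_le_left _ _)⟩

theorem clip_eq_self {C a : ℝ} (ha : |a| ≤ C) : max (-C) (min C a) = a := by
  rw [abs_le] at ha
  rw [min_eq_right ha.2, max_eq_right ha.1]

theorem abs_clip_sub_clip_le (C a b : ℝ) :
    |max (-C) (min C a) - max (-C) (min C b)| ≤ |a - b| := by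
  refine (abs_max_sub_max_le_abs _ _ _).trans ?_
  rw [min_comm C a, min_comm C b]
  exact abs_min_sub_min_le_abs _ _ _
where
  abs_max_sub_max_le_abs (a b c : ℝ) : |max a b - max a c| ≤ |b - c| := by
    rw [max_comm a b, max_comm a c]
    exact _root_.abs_max_sub_max_le_abs _ _ _
  abs_min_sub_min_le_abs (a b c : ℝ) : |min a c - min b c| ≤ |a - b| := by
    have := abs_min_sub_min_le_max a c b c
    simpa using this

theorem Cb.bounded {u : X → ℝ} (hu : u ∈ Cb K) : ∃ C : ℝ, 0 ≤ C ∧ ∀ x, |u x| ≤ C := by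
  obtain ⟨v, -, ⟨C, hC⟩, hv⟩ := hu
  have key : ∀ x, |u x| ≤ C := fun x => by
    have hx : x ∈ Metric.closedBall (0 : X) ‖x‖ := by simp
    exact le_of_tendsto ((hv ‖x‖).tendsto_at hx).abs (hC.mono fun n hn => hn x)
  exact ⟨C, (abs_nonneg _).trans (key 0), key⟩

theorem Lipb.bounded {u : X → ℝ} (hu : u ∈ Lipb K) : ∃ C : ℝ, 0 ≤ C ∧ ∀ x, |u x| ≤ C := by
  obtain ⟨-, C, hC⟩ := hu
  exact ⟨C, (abs_nonneg _).trans (hC 0), hC⟩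

theorem lipb_subset_cb : Lipb K ⊆ Cb K := fun u hu => by
  refine ⟨fun _ => u, fun _ => hu, locConv_iff.2 ⟨?_, fun r ε hε => ?_⟩⟩
  · obtain ⟨C, -, hC⟩ := Lipb.bounded hu
    exact ⟨C, Eventually.of_forall fun _ => hC⟩
  · exact Eventually.of_forall fun _ x _ => by simpa using hε.le

/-- Clipping shows that the approximating Lipschitz functions may be taken with the same bound. -/
theorem Cb.exists_approx {u : X → ℝ} (hu : u ∈ Cb K) {C : ℝ} (hC : ∀ x, |u x| ≤ C) (r : ℝ)
    {ε : ℝ} (hε : 0 < ε) :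
    ∃ v ∈ Lipb K, (∀ x, |v x| ≤ C) ∧ ∀ x, ‖x‖ ≤ r → |u x - v x| ≤ ε := by
  have hC0 : 0 ≤ C := (abs_nonneg _).trans (hC 0)
  obtain ⟨v, hv, hconv⟩ := hu
  obtain ⟨n, hn⟩ := ((locConv_iff.1 hconv).2 r ε hε).exists
  obtain ⟨⟨L, hL⟩, -⟩ := hv n
  refine ⟨fun x => max (-C) (min C (v n x)), ⟨⟨1 * L, ?_⟩, C, fun x => abs_clip_le hC0 _⟩,
    fun x => abs_clip_le hC0 _, fun x hx => ?_⟩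
  · exact hL.comp (f := fun a => max (-C) (min C a)) zero_le_one
      fun a b => by simpa using abs_clip_sub_clip_le C a b
  · rw [← clip_eq_self (hC x), abs_sub_comm]
    exact (abs_clip_sub_clip_le _ _ _).trans (hn x hx)

/-- A bounded function that can be approximated by elements of `Cb K` uniformly on bounded sets
belongs to `Cb K`. -/
theorem Cb.of_approx {u : X → ℝ} {C : ℝ} (hC : ∀ x, |u x| ≤ C)
    (h : ∀ r : ℝ, ∀ ε > 0, ∃ v ∈ Cb K, ∀ x, ‖x‖ ≤ r → |u x - v x| ≤ ε) : u ∈ Cb K := by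
  have hC0 : 0 ≤ C := (abs_nonneg _).trans (hC 0)
  have key : ∀ n : ℕ, ∃ w ∈ Lipb K, (∀ x, |w x| ≤ C) ∧
      ∀ x, ‖x‖ ≤ n → |w x - u x| ≤ 1 / ((n : ℝ) + 1) := fun n => by
    have hn : 0 < 1 / ((n : ℝ) + 1) := by positivity
    obtain ⟨v, hv, hvu⟩ := h n _ (half_pos hn)
    obtain ⟨D, -, hD⟩ := Cb.bounded hv
    obtain ⟨w, ⟨⟨L, hL⟩, -⟩, -, hw⟩ := Cb.exists_approx hv hD n (half_pos hn)
    refine ⟨fun x => max (-C) (min C (w x)), ⟨⟨1 * L, ?_⟩, C, fun x => abs_clip_le hC0 _⟩,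
      fun x => abs_clip_le hC0 _, fun x hx => ?_⟩
    · exact hL.comp (f := fun a => max (-C) (min C a)) zero_le_one
        fun a b => by simpa using abs_clip_sub_clip_le C a b
    · rw [← clip_eq_self (hC x)]
      refine (abs_clip_sub_clip_le _ _ _).trans ?_
      have h1 := abs_le.1 (hvu x hx)
      have h2 := abs_le.1 (hw x hx)
      rw [abs_le]
      constructor <;> linarith
  choose w hw hwC hwu using key
  refine ⟨w, hw, locConv_iff.2 ⟨⟨C, Eventually.of_forall hwC⟩, fun r ε hε => ?_⟩⟩
  obtain ⟨N, hN⟩ := exists_nat_ge r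
  filter_upwards [eventually_ge_atTop N,
    (tendsto_one_div_add_atTop_nhds_zero_nat (𝕜 := ℝ)).eventually (ge_mem_nhds hε)]
    with n hn hnε x hx
  exact (hwu n x (hx.trans (hN.trans (by exact_mod_cast hn)))).trans hnε

theorem Cb.continuous {u : X → ℝ} (hu : u ∈ Cb K) : Continuous u := by
  obtain ⟨v, hv, -, hconv⟩ := hu
  rw [continuous_iff_continuousAt]
  intro x
  have h1 : ContinuousOn u (Metric.closedBall 0 (‖x‖ + 1)) :=
    (hconv _).continuousOn (Eventually.of_forall fun n => by
      obtain ⟨⟨L, hL⟩, -⟩ := hv n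
      exact hL.continuous.continuousOn).frequently
  exact h1.continuousAt (mem_of_superset
    (Metric.ball_mem_nhds x one_pos) fun y hy => by
      have := norm_sub_norm_le y x
      rw [Metric.mem_ball, dist_eq_norm] at hy
      simp only [Metric.mem_closedBall, dist_zero_right]
      linarith)

theorem Cb.const (m : ℝ) : (fun _ : X => m) ∈ Cb K :=
  lipb_subset_cb ⟨⟨0, le_rfl, fun x y => by simp⟩, |m|, fun _ => le_rfl⟩

theorem Lipb.add {u v : X → ℝ} (hu : u ∈ Lipb K) (hv : v ∈ Lipb K) :
    (fun x => u x + v x) ∈ Lipb K := by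
  obtain ⟨⟨L, hL⟩, C, hC⟩ := hu
  obtain ⟨⟨L', hL'⟩, C', hC'⟩ := hv
  exact ⟨⟨L + L', hL.add hL'⟩, C + C', fun x =>
    (abs_add_le _ _).trans (add_le_add (hC x) (hC' x))⟩

theorem Cb.add {u v : X → ℝ} (hu : u ∈ Cb K) (hv : v ∈ Cb K) :
    (fun x => u x + v x) ∈ Cb K := by
  obtain ⟨C, -, hC⟩ := Cb.bounded hu
  obtain ⟨C', -, hC'⟩ := Cb.bounded hv
  refine Cb.of_approx (C := C + C')
    (fun x => (abs_add_le _ _).trans (add_le_add (hC x) (hC' x))) fun r ε hε => ?_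
  obtain ⟨u', hu', -, hu''⟩ := Cb.exists_approx hu hC r (half_pos hε)
  obtain ⟨v', hv', -, hv''⟩ := Cb.exists_approx hv hC' r (half_pos hε)
  refine ⟨fun x => u' x + v' x, lipb_subset_cb (Lipb.add hu' hv'), fun x hx => ?_⟩
  have h1 := abs_le.1 (hu'' x hx)
  have h2 := abs_le.1 (hv'' x hx)
  rw [abs_le]
  constructor <;> linarith

theorem Cb.comp {u : X → ℝ} (hu : u ∈ Cb K) {f : ℝ → ℝ} {A : ℝ} (hA : 0 ≤ A)
    (hf : ∀ a b, |f a - f b| ≤ A * |a - b|) : (fun x => f (u x)) ∈ Cb K := by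
  obtain ⟨C, hC0, hC⟩ := Cb.bounded hu
  have hb : ∀ w : X → ℝ, (∀ x, |w x| ≤ C) → ∀ x, |f (w x)| ≤ |f 0| + A * C := fun w hw x => by
    have h1 := hf (w x) 0
    have h2 := abs_sub_abs_le_abs_sub (f (w x)) (f 0)
    have h3 : A * |w x - 0| ≤ A * C := by rw [sub_zero]; gcongr; exact hw x
    linarith
  refine Cb.of_approx (C := |f 0| + A * C) (hb u hC) fun r ε hε => ?_
  obtain ⟨v, ⟨⟨L, hL⟩, -⟩, hvC, hv⟩ := Cb.exists_approx hu hC r (ε := ε / (A + 1)) (by positivity)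
  refine ⟨fun x => f (v x), lipb_subset_cb ⟨⟨A * L, hL.comp hA hf⟩, _, hb v hvC⟩, fun x hx => ?_⟩
  refine (hf _ _).trans ?_
  calc A * |u x - v x| ≤ A * (ε / (A + 1)) := by gcongr; exact hv x hx
    _ ≤ (A + 1) * (ε / (A + 1)) := by gcongr; linarith
    _ = ε := by field_simp

theorem Cb.const_mul {u : X → ℝ} (hu : u ∈ Cb K) (a : ℝ) : (fun x => a * u x) ∈ Cb K :=
  Cb.comp hu (f := fun b => a * b) (abs_nonneg a) fun b c => by rw [← mul_sub, abs_mul]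

theorem Cb.sub {u v : X → ℝ} (hu : u ∈ Cb K) (hv : v ∈ Cb K) :
    (fun x => u x - v x) ∈ Cb K := by
  have := Cb.add hu (Cb.const_mul hv (-1))
  simpa [sub_eq_add_neg] using this

theorem Cb.add_const {u : X → ℝ} (hu : u ∈ Cb K) (a : ℝ) : (fun x => u x + a) ∈ Cb K :=
  Cb.add hu (Cb.const a)

theorem Cb.sub_const {u : X → ℝ} (hu : u ∈ Cb K) (a : ℝ) : (fun x => u x - a) ∈ Cb K :=
  Cb.sub hu (Cb.const a)

end Calculus


/-! ### Abstract generating families and their dyadic infima -/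

section GeneratingFamily

variable {X : Type*} [NormedAddCommGroup X] [NormedSpace ℝ X]

/-- A semigroup `T` of monotone operators together with a family `I` of convex monotone operators
above it that satisfies `I t ∘ I s ≤ I (t + s)`, has a tail estimate uniform in time, and is
continuous at time zero uniformly over functions with the same Lipschitz constant. In `tail`,
the error `B` does not depend on the bound `C` of the function: this is what makes the convexity
argument in `modulus` work. -/
structure IsGeneratingFamily (K : X →L[ℝ] X) (c : ℝ≥0)
    (T I : ℝ≥0 → (X → ℝ) → (X → ℝ)) : Prop where
  T_mapsTo : ∀ t, ∀ u ∈ Cb K, T t u ∈ Cb K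
  T_mono : ∀ t, ∀ u ∈ Cb K, ∀ v ∈ Cb K, (∀ x, u x ≤ v x) → ∀ x, T t u x ≤ T t v x
  T_add : ∀ t s, ∀ u ∈ Cb K, T t (T s u) = T (t + s) u
  mapsTo : ∀ t, ∀ u ∈ Cb K, I t u ∈ Cb K
  mono : ∀ t, ∀ u ∈ Cb K, ∀ v ∈ Cb K, (∀ x, u x ≤ v x) → ∀ x, I t u x ≤ I t v x
  convex : ∀ t, ∀ u ∈ Cb K, ∀ v ∈ Cb K, ∀ θ : ℝ, 0 ≤ θ → θ ≤ 1 → ∀ x,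
    I t (fun y => (1 - θ) * u y + θ * v y) x ≤ (1 - θ) * I t u x + θ * I t v x
  const : ∀ t (m : ℝ), I t (fun _ => m) = fun _ => m
  lip : ∀ (t : ℝ≥0) (L : ℝ), ∀ u ∈ Lipb K, LipWith K L u →
    LipWith K (Real.exp (c * t) * L) (I t u)
  I_zero : ∀ u ∈ Cb K, I 0 u = u
  I_add_le : ∀ t s, ∀ u ∈ Cb K, ∀ x, I t (I s u) x ≤ I (t + s) u x
  T_le : ∀ t, ∀ u ∈ Cb K, ∀ x, T t u x ≤ I t u x
  tail : ∀ (s : ℝ≥0) (r : ℝ), ∃ B : ℝ, 0 ≤ B ∧ ∀ C : ℝ, ∃ R : ℝ, ∀ t ≤ s, ∀ w ∈ Cb K, ∀ a : ℝ,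
    |a| ≤ C → (∀ x, w x ≤ C) → (∀ x, ‖x‖ ≤ R → w x ≤ a) → ∀ x, ‖x‖ ≤ r → I t w x ≤ a + B
  start : ∀ L r : ℝ, ∀ ε > 0, ∃ δ : ℝ≥0, 0 < δ ∧ ∀ t ≤ δ, ∀ u ∈ Lipb K, LipWith K L u →
    ∀ x, ‖x‖ ≤ r → I t u x ≤ u x + ε ∧ u x - ε ≤ T t u x

/-- Convex monotone operators that lie between `T t` and `I t`. All compositions of the operators
`I s` with total time `t`, and their limits, are of this kind. -/
structure Sandwiched (K : X →L[ℝ] X) (c : ℝ≥0) (T I : ℝ≥0 → (X → ℝ) → (X → ℝ)) (t : ℝ≥0)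
    (F : (X → ℝ) → (X → ℝ)) : Prop where
  mapsTo : ∀ u ∈ Cb K, F u ∈ Cb K
  mono : ∀ u ∈ Cb K, ∀ v ∈ Cb K, (∀ x, u x ≤ v x) → ∀ x, F u x ≤ F v x
  convex : ∀ u ∈ Cb K, ∀ v ∈ Cb K, ∀ θ : ℝ, 0 ≤ θ → θ ≤ 1 → ∀ x,
    F (fun y => (1 - θ) * u y + θ * v y) x ≤ (1 - θ) * F u x + θ * F v x
  const : ∀ m : ℝ, F (fun _ => m) = fun _ => m
  lip : ∀ (L : ℝ), ∀ u ∈ Lipb K, LipWith K L u → LipWith K (Real.exp (c * t) * L) (F u)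
  T_le : ∀ u ∈ Cb K, ∀ x, T t u x ≤ F u x
  le_I : ∀ u ∈ Cb K, ∀ x, F u x ≤ I t u x

variable {K : X →L[ℝ] X} {c : ℝ≥0} {T I : ℝ≥0 → (X → ℝ) → (X → ℝ)}

theorem abs_le_of_mono_of_const {F : (X → ℝ) → (X → ℝ)}
    (mono : ∀ u ∈ Cb K, ∀ v ∈ Cb K, (∀ x, u x ≤ v x) → ∀ x, F u x ≤ F v x)
    (const : ∀ m : ℝ, F (fun _ => m) = fun _ => m) {u : X → ℝ} (hu : u ∈ Cb K) {C : ℝ}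
    (hC : ∀ x, |u x| ≤ C) (x : X) : |F u x| ≤ C := by
  have h1 := mono u hu _ (Cb.const C) (fun y => (abs_le.1 (hC y)).2) x
  have h2 := mono _ (Cb.const (-C)) u hu (fun y => (abs_le.1 (hC y)).1) x
  rw [const] at h1 h2
  exact abs_le.2 ⟨h2, h1⟩

/-- Convex monotone operators that satisfy a common tail estimate have a common modulus of
continuity on bounded subsets of `Cb K`. Write `u = (1 - θ) v + θ w` with `w = v + (u - v) / θ`:
where `u` and `v` are close, `w` is bounded by a constant independent of `θ`, so that
`F u - F v ≤ θ (F w - F v)` is of order `θ`. -/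
theorem exists_modulus_of_tail {𝓕 : Set ((X → ℝ) → (X → ℝ))}
    (mono : ∀ F ∈ 𝓕, ∀ u ∈ Cb K, ∀ v ∈ Cb K, (∀ x, u x ≤ v x) → ∀ x, F u x ≤ F v x)
    (convex : ∀ F ∈ 𝓕, ∀ u ∈ Cb K, ∀ v ∈ Cb K, ∀ θ : ℝ, 0 ≤ θ → θ ≤ 1 → ∀ x,
      F (fun y => (1 - θ) * u y + θ * v y) x ≤ (1 - θ) * F u x + θ * F v x)
    (const : ∀ F ∈ 𝓕, ∀ m : ℝ, F (fun _ => m) = fun _ => m) {B r : ℝ} (hB : 0 ≤ B)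
    (tail : ∀ C : ℝ, ∃ R : ℝ, ∀ F ∈ 𝓕, ∀ w ∈ Cb K, ∀ a : ℝ, |a| ≤ C → (∀ x, w x ≤ C) →
      (∀ x, ‖x‖ ≤ R → w x ≤ a) → ∀ x, ‖x‖ ≤ r → F w x ≤ a + B)
    (C : ℝ) {ε : ℝ} (hε : 0 < ε) :
    ∃ R : ℝ, ∃ δ > 0, ∀ F ∈ 𝓕, ∀ u ∈ Cb K, ∀ v ∈ Cb K,
      (∀ x, |u x| ≤ C) → (∀ x, |v x| ≤ C) → (∀ x, ‖x‖ ≤ R → |u x - v x| ≤ δ) →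
      ∀ x, ‖x‖ ≤ r → |F u x - F v x| ≤ ε := by
  rcases lt_or_ge C 0 with hC | hC
  · refine ⟨0, 1, one_pos, fun F _ u _ v _ hu => ?_⟩
    exact absurd ((abs_nonneg _).trans (hu 0)) (not_le.2 hC)
  set D : ℝ := 2 * C + 1 + B with hD
  have hDpos : 0 < D := by positivity
  set θ : ℝ := min 1 (ε / D) with hθ
  have hθ0 : 0 < θ := lt_min one_pos (by positivity)
  have hθ1 : θ ≤ 1 := min_le_left _ _
  have hθD : θ * D ≤ ε := by
    calc θ * D ≤ ε / D * D := by gcongr; exact min_le_right _ _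
      _ = ε := by field_simp
  obtain ⟨R, hR⟩ := tail (C + 1 + 2 * C / θ)
  have key : ∀ F ∈ 𝓕, ∀ u ∈ Cb K, ∀ v ∈ Cb K,
      (∀ x, |u x| ≤ C) → (∀ x, |v x| ≤ C) → (∀ x, ‖x‖ ≤ R → |u x - v x| ≤ θ) →
      ∀ x, ‖x‖ ≤ r → F u x - F v x ≤ ε := by
    intro F hF u hu v hv huC hvC huv x hx
    set w : X → ℝ := fun y => v y + θ⁻¹ * (u y - v y) with hw
    have hwCb : w ∈ Cb K := Cb.add hv (Cb.const_mul (Cb.sub hu hv) _)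
    have hu_eq : u = fun y => (1 - θ) * v y + θ * w y := by
      funext y
      simp only [hw]
      field_simp
      ring
    have h1 := convex F hF v hv w hwCb θ hθ0.le hθ1 x
    rw [← hu_eq] at h1
    have h2 : F w x ≤ (C + 1) + B := by
      refine hR F hF w hwCb (C + 1) ?_ ?_ ?_ x hx
      · rw [abs_of_nonneg (by positivity)]
        have : 0 ≤ 2 * C / θ := by positivity
        linarith
      · intro y
        have e1 := abs_le.1 (huC y)
        have e2 := abs_le.1 (hvC y)
        have e3 : θ⁻¹ * (u y - v y) ≤ θ⁻¹ * (2 * C) := by gcongr; linarith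
        have e4 : θ⁻¹ * (2 * C) = 2 * C / θ := by field_simp
        simp only [hw]
        linarith
      · intro y hy
        have e1 := (abs_le.1 (huv y hy)).2
        have e2 := abs_le.1 (hvC y)
        have e3 : θ⁻¹ * (u y - v y) ≤ θ⁻¹ * θ := by gcongr
        rw [inv_mul_cancel₀ hθ0.ne'] at e3
        simp only [hw]
        linarith
    have h3 := (abs_le.1 (abs_le_of_mono_of_const (mono F hF) (const F hF) hv hvC x)).1
    have h4 : θ * F w x ≤ θ * (C + 1 + B) := by gcongr
    have h5 : θ * (-C) ≤ θ * F v x := by gcongr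
    nlinarith
  refine ⟨R, θ, hθ0, fun F hF u hu v hv huC hvC huv x hx => abs_le.2 ⟨?_, ?_⟩⟩
  · have := key F hF v hv u hu hvC huC (fun y hy => by rw [abs_sub_comm]; exact huv y hy) x hx
    linarith
  · exact key F hF u hu v hv huC hvC huv x hx

namespace Sandwiched

theorem abs_le {t : ℝ≥0} {F : (X → ℝ) → (X → ℝ)} (hF : Sandwiched K c T I t F) {u : X → ℝ}
    (hu : u ∈ Cb K) {C : ℝ} (hC : ∀ x, |u x| ≤ C) (x : X) : |F u x| ≤ C :=
  abs_le_of_mono_of_const hF.mono hF.const hu hC x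

theorem lipb {t : ℝ≥0} {F : (X → ℝ) → (X → ℝ)} (hF : Sandwiched K c T I t F) {u : X → ℝ}
    (hu : u ∈ Lipb K) : F u ∈ Lipb K := by
  obtain ⟨C, -, hC⟩ := Lipb.bounded hu
  obtain ⟨L, hL⟩ := hu.1
  exact ⟨⟨_, hF.lip L u hu hL⟩, C, hF.abs_le (lipb_subset_cb hu) hC⟩

end Sandwiched

namespace IsGeneratingFamily

variable (h : IsGeneratingFamily K c T I)
include h

theorem sandwiched_self (t : ℝ≥0) : Sandwiched K c T I t (I t) where
  mapsTo := h.mapsTo t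
  mono := h.mono t
  convex := h.convex t
  const := h.const t
  lip := h.lip t
  T_le := h.T_le t
  le_I := fun _ _ _ => le_rfl

theorem sandwiched_id : Sandwiched K c T I 0 id where
  mapsTo := fun _ hu => hu
  mono := fun _ _ _ _ huv => huv
  convex := fun _ _ _ _ _ _ _ _ => le_rfl
  const := fun _ => rfl
  lip := fun L u _ hL => by simpa using hL
  T_le := fun u hu x => by simpa [h.I_zero u hu] using h.T_le 0 u hu x
  le_I := fun u hu x => by simp [h.I_zero u hu]

theorem sandwiched_comp {t s : ℝ≥0} {F G : (X → ℝ) → (X → ℝ)} (hF : Sandwiched K c T I t F)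
    (hG : Sandwiched K c T I s G) : Sandwiched K c T I (t + s) (F ∘ G) where
  mapsTo := fun u hu => hF.mapsTo _ (hG.mapsTo u hu)
  mono := fun u hu v hv huv => hF.mono _ (hG.mapsTo u hu) _ (hG.mapsTo v hv) (hG.mono u hu v hv huv)
  convex := fun u hu v hv θ h0 h1 x => by
    refine (hF.mono _ (hG.mapsTo _ ?_) _ ?_ (hG.convex u hu v hv θ h0 h1) x).trans
      (hF.convex _ (hG.mapsTo u hu) _ (hG.mapsTo v hv) θ h0 h1 x)
    · exact Cb.add (Cb.const_mul hu _) (Cb.const_mul hv _)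
    · exact Cb.add (Cb.const_mul (hG.mapsTo u hu) _) (Cb.const_mul (hG.mapsTo v hv) _)
  const := fun m => by simp [hG.const, hF.const]
  lip := fun L u hu hL => by
    have := hF.lip _ _ (hG.lipb hu) (hG.lip L u hu hL)
    rw [← mul_assoc, ← Real.exp_add] at this
    rwa [← mul_add, ← NNReal.coe_add] at this
  T_le := fun u hu x => by
    rw [← h.T_add t s u hu]
    exact (h.T_mono t _ (h.T_mapsTo s u hu) _ (hG.mapsTo u hu) (hG.T_le u hu) x).trans
      (hF.T_le _ (hG.mapsTo u hu) x)
  le_I := fun u hu x =>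
    (hF.mono _ (hG.mapsTo u hu) _ (h.mapsTo s u hu) (hG.le_I u hu) x).trans
      ((hF.le_I _ (h.mapsTo s u hu) x).trans (h.I_add_le t s u hu x))

theorem sandwiched_iterate (δ : ℝ≥0) (k : ℕ) :
    Sandwiched K c T I (k * δ) ((I δ)^[k]) := by
  induction k with
  | zero => simpa using h.sandwiched_id
  | succ k ih =>
    rw [Function.iterate_succ']
    convert h.sandwiched_comp (h.sandwiched_self δ) ih using 1
    push_cast
    ring

/-- All sandwiched operators have a common modulus of continuity on bounded subsets of `Cb K`. -/
theorem modulus (s : ℝ≥0) (r C : ℝ) {ε : ℝ} (hε : 0 < ε) :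
    ∃ R : ℝ, ∃ δ > 0, ∀ t ≤ s, ∀ F, Sandwiched K c T I t F → ∀ u ∈ Cb K, ∀ v ∈ Cb K,
      (∀ x, |u x| ≤ C) → (∀ x, |v x| ≤ C) → (∀ x, ‖x‖ ≤ R → |u x - v x| ≤ δ) →
      ∀ x, ‖x‖ ≤ r → |F u x - F v x| ≤ ε := by
  obtain ⟨B, hB, htail⟩ := h.tail s r
  obtain ⟨R, δ, hδ, H⟩ := exists_modulus_of_tail (K := K)
    (𝓕 := {F | ∃ t ≤ s, Sandwiched K c T I t F}) (fun F ⟨t, _, hF⟩ => hF.mono)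
    (fun F ⟨t, _, hF⟩ => hF.convex) (fun F ⟨t, _, hF⟩ => hF.const) hB
    (fun C' => by
      obtain ⟨R, hR⟩ := htail C'
      exact ⟨R, fun F ⟨t, ht, hF⟩ w hw a ha hwC hwR x hx =>
        (hF.le_I w hw x).trans (hR t ht w hw a ha hwC hwR x hx)⟩) C hε
  exact ⟨R, δ, hδ, fun t ht F hF => H F ⟨t, ht, hF⟩⟩

theorem start_lipschitz (L r : ℝ) {ε : ℝ} (hε : 0 < ε) :
    ∃ δ : ℝ≥0, 0 < δ ∧ ∀ t ≤ δ, ∀ F, Sandwiched K c T I t F → ∀ u ∈ Lipb K, LipWith K L u →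
      ∀ x, ‖x‖ ≤ r → |F u x - u x| ≤ ε := by
  obtain ⟨δ, hδ, H⟩ := h.start L r ε hε
  refine ⟨δ, hδ, fun t ht F hF u hu hL x hx => ?_⟩
  obtain ⟨h1, h2⟩ := H t ht u hu hL x hx
  have h3 := hF.le_I u (lipb_subset_cb hu) x
  have h4 := hF.T_le u (lipb_subset_cb hu) x
  rw [abs_le]
  constructor <;> linarith

/-- Sandwiched operators for small times are close to the identity at every `u` in `Cb K`. -/
theorem start_cb {u : X → ℝ} (hu : u ∈ Cb K) (r : ℝ) {ε : ℝ} (hε : 0 < ε) :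
    ∃ δ : ℝ≥0, 0 < δ ∧ ∀ t ≤ δ, ∀ F, Sandwiched K c T I t F →
      ∀ x, ‖x‖ ≤ r → |F u x - u x| ≤ ε := by
  obtain ⟨C, -, hC⟩ := Cb.bounded hu
  have hε3 : 0 < ε / 3 := by positivity
  obtain ⟨R, d, hd, hmod⟩ := h.modulus 1 r C hε3
  obtain ⟨v, hv, hvC, huv⟩ := Cb.exists_approx hu hC (max R r) (lt_min hd hε3)
  obtain ⟨L, hL⟩ := hv.1
  obtain ⟨δ, hδ, hst⟩ := h.start_lipschitz L r hε3
  refine ⟨min δ 1, lt_min hδ one_pos, fun t ht F hF x hx => ?_⟩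
  have h1 := abs_le.1 (hmod t (ht.trans (min_le_right _ _)) F hF u hu v (lipb_subset_cb hv) hC hvC
    (fun y hy => (huv y (hy.trans (le_max_left _ _))).trans (min_le_left _ _)) x hx)
  have h2 := abs_le.1 (hst t (ht.trans (min_le_left _ _)) F hF v hv hL x hx)
  have h3 := abs_le.1 ((huv x (hx.trans (le_max_right _ _))).trans (min_le_right _ _))
  rw [abs_le]
  constructor <;> linarith

/-- A decreasing pointwise limit of sandwiched operators is sandwiched. -/
theorem sandwiched_iInf {t : ℝ≥0} {F : ℕ → (X → ℝ) → (X → ℝ)}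
    (hF : ∀ n, Sandwiched K c T I t (F n)) {G : (X → ℝ) → (X → ℝ)}
    (hG : ∀ u ∈ Cb K, ∀ x, Tendsto (fun n => F n u x) atTop (𝓝 (G u x))) :
    Sandwiched K c T I t G := by
  have hlip : ∀ (L : ℝ), ∀ u ∈ Lipb K, LipWith K L u → LipWith K (Real.exp (c * t) * L) (G u) :=
    fun L u hu hL => ⟨mul_nonneg (Real.exp_pos _).le hL.1, fun x y => by
      have hu' := lipb_subset_cb hu
      exact le_of_tendsto' ((hG u hu' x).sub (hG u hu' y)).abs
        fun n => ((hF n).lip L u hu hL).2 x y⟩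
  have habs : ∀ u ∈ Cb K, ∀ C, (∀ x, |u x| ≤ C) → ∀ x, |G u x| ≤ C := fun u hu C hC x =>
    le_of_tendsto' (hG u hu x).abs fun n => (hF n).abs_le hu hC x
  refine
  { mapsTo := fun u hu => ?_
    mono := fun u hu v hv huv x => le_of_tendsto_of_tendsto' (hG u hu x) (hG v hv x)
      fun n => (hF n).mono u hu v hv huv x
    convex := fun u hu v hv θ h0 h1 x => le_of_tendsto_of_tendsto'
      (hG _ (Cb.add (Cb.const_mul hu _) (Cb.const_mul hv _)) x)
      (((hG u hu x).const_mul _).add ((hG v hv x).const_mul _))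
      fun n => (hF n).convex u hu v hv θ h0 h1 x
    const := fun m => funext fun x => tendsto_nhds_unique (hG _ (Cb.const m) x) (by
      simp only [(hF _).const]
      exact tendsto_const_nhds)
    lip := hlip
    T_le := fun u hu x => ge_of_tendsto' (hG u hu x) fun n => (hF n).T_le u hu x
    le_I := fun u hu x => le_of_tendsto' (hG u hu x) fun n => (hF n).le_I u hu x }
  obtain ⟨C, -, hC⟩ := Cb.bounded hu
  refine Cb.of_approx (habs u hu C hC) fun r ε hε => ?_
  obtain ⟨R, δ, hδ, hmod⟩ := h.modulus t r C hε
  obtain ⟨v, hv, hvC, huv⟩ := Cb.exists_approx hu hC R hδ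
  have hv' := lipb_subset_cb hv
  obtain ⟨L, hL⟩ := hv.1
  exact ⟨G v, lipb_subset_cb ⟨⟨_, hlip L v hv hL⟩, C, habs v hv' C hvC⟩, fun x hx =>
    le_of_tendsto' ((hG u hu x).sub (hG v hv' x)).abs
      fun n => hmod t le_rfl (F n) (hF n) u hu v hv' hC hvC huv x hx⟩

end IsGeneratingFamily

/-- The composition of `I` along the dyadic partition of level `n` of `[0, t]`. -/
noncomputable def dyadicComp (I : ℝ≥0 → (X → ℝ) → (X → ℝ)) (n : ℕ) (t : ℝ≥0) (u : X → ℝ) :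
    X → ℝ :=
  (I ((2 : ℝ≥0) ^ n)⁻¹)^[⌊t * 2 ^ n⌋₊] (I (t - ⌊t * 2 ^ n⌋₊ * ((2 : ℝ≥0) ^ n)⁻¹) u)

/-- The infimum of the dyadic compositions of `I`. -/
noncomputable def dyadicInf (I : ℝ≥0 → (X → ℝ) → (X → ℝ)) (t : ℝ≥0) (u : X → ℝ) (x : X) : ℝ :=
  ⨅ n : ℕ, dyadicComp I n t u x

theorem floor_mul_inv_le (n : ℕ) (t : ℝ≥0) : (⌊t * 2 ^ n⌋₊ : ℝ≥0) * ((2 : ℝ≥0) ^ n)⁻¹ ≤ t := by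
  rw [← div_eq_mul_inv, div_le_iff₀ (by positivity)]
  exact Nat.floor_le (zero_le)

theorem sub_floor_mul_inv_le (n : ℕ) (t : ℝ≥0) :
    t - (⌊t * 2 ^ n⌋₊ : ℝ≥0) * ((2 : ℝ≥0) ^ n)⁻¹ ≤ ((2 : ℝ≥0) ^ n)⁻¹ := by
  rw [tsub_le_iff_left, ← add_one_mul, ← div_eq_mul_inv, le_div_iff₀ (by positivity)]
  exact (Nat.lt_floor_add_one _).le

theorem inv_two_pow_succ (n : ℕ) :
    ((2 : ℝ≥0) ^ n)⁻¹ = ((2 : ℝ≥0) ^ (n + 1))⁻¹ + ((2 : ℝ≥0) ^ (n + 1))⁻¹ := by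
  rw [pow_succ, mul_inv, ← mul_add, ← two_mul, mul_inv_cancel₀ two_ne_zero, mul_one]

theorem tendsto_inv_two_pow : Tendsto (fun n : ℕ => ((2 : ℝ≥0) ^ n)⁻¹) atTop (𝓝 0) := by
  simp_rw [← inv_pow]
  exact NNReal.tendsto_pow_atTop_nhds_zero_of_lt_one (inv_lt_one_of_one_lt₀ one_lt_two)

theorem eventually_inv_two_pow_le {d : ℝ≥0} (hd : 0 < d) :
    ∀ᶠ n : ℕ in atTop, ((2 : ℝ≥0) ^ n)⁻¹ ≤ d :=
  tendsto_inv_two_pow.eventually (ge_mem_nhds hd)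

namespace IsGeneratingFamily

variable (h : IsGeneratingFamily K c T I)
include h

theorem sandwiched_dyadicComp (n : ℕ) (t : ℝ≥0) :
    Sandwiched K c T I t (dyadicComp I n t) := by
  have := h.sandwiched_comp (h.sandwiched_iterate ((2 : ℝ≥0) ^ n)⁻¹ ⌊t * 2 ^ n⌋₊)
    (h.sandwiched_self (t - ⌊t * 2 ^ n⌋₊ * ((2 : ℝ≥0) ^ n)⁻¹))
  rwa [add_tsub_cancel_of_le (floor_mul_inv_le n t)] at this

theorem iterate_two_mul_le (δ : ℝ≥0) (k : ℕ) {v : X → ℝ} (hv : v ∈ Cb K) (x : X) :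
    (I δ)^[2 * k] v x ≤ (I (δ + δ))^[k] v x := by
  induction k generalizing x with
  | zero => simp
  | succ k ih =>
    rw [show 2 * (k + 1) = 2 * k + 1 + 1 by ring]
    simp only [Function.iterate_succ_apply']
    have h1 := (h.sandwiched_iterate δ (2 * k)).mapsTo v hv
    have h2 := (h.sandwiched_iterate (δ + δ) k).mapsTo v hv
    exact (h.I_add_le δ δ _ h1 x).trans (h.mono _ _ h1 _ h2 ih x)

/-- Every full step is split into two halves, and the last, incomplete step of length less than
`2⁻ⁿ` is split if it contains the midpoint. -/
theorem dyadicComp_succ_le (n : ℕ) (t : ℝ≥0) {u : X → ℝ} (hu : u ∈ Cb K) (x : X) :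
    dyadicComp I (n + 1) t u x ≤ dyadicComp I n t u x := by
  unfold dyadicComp
  set k := ⌊t * 2 ^ n⌋₊ with hk
  set δ := ((2 : ℝ≥0) ^ (n + 1))⁻¹ with hδ
  have hk1 : 2 * k ≤ ⌊t * 2 ^ (n + 1)⌋₊ := by
    refine Nat.le_floor ?_
    have : (k : ℝ≥0) ≤ t * 2 ^ n := Nat.floor_le (zero_le)
    push_cast
    calc (2 : ℝ≥0) * k ≤ 2 * (t * 2 ^ n) := by gcongr
      _ = _ := by ring
  have hk2 : ⌊t * 2 ^ (n + 1)⌋₊ < 2 * k + 2 := by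
    rw [Nat.floor_lt (zero_le)]
    have : t * 2 ^ n < (k : ℝ≥0) + 1 := Nat.lt_floor_add_one _
    push_cast
    calc t * 2 ^ (n + 1) = 2 * (t * 2 ^ n) := by ring
      _ < 2 * (k + 1) := by gcongr
      _ = _ := by ring
  rw [inv_two_pow_succ n, ← hδ]
  have hcase : ⌊t * 2 ^ (n + 1)⌋₊ = 2 * k ∨ ⌊t * 2 ^ (n + 1)⌋₊ = 2 * k + 1 := by omega
  have hle := floor_mul_inv_le (n + 1) t
  rw [← hδ] at hle
  rcases hcase with he | he
  · rw [he]
    have e : t - ((2 * k : ℕ) : ℝ≥0) * δ = t - k * (δ + δ) := by push_cast; ring_nf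
    rw [e]
    exact h.iterate_two_mul_le δ k (h.mapsTo _ u hu) x
  · rw [he] at hle ⊢
    have e0 : ((2 * k + 1 : ℕ) : ℝ≥0) * δ = k * (δ + δ) + δ := by push_cast; ring
    rw [e0] at hle ⊢
    have e : δ + (t - (k * (δ + δ) + δ)) = t - k * (δ + δ) := by
      rw [tsub_add_eq_tsub_tsub, add_tsub_cancel_of_le (le_tsub_of_add_le_left hle)]
    rw [Function.iterate_succ_apply]
    have hm := h.mapsTo (t - (k * (δ + δ) + δ)) u hu
    refine ((h.sandwiched_iterate δ (2 * k)).mono _ (h.mapsTo _ _ hm) _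
      (h.mapsTo (t - k * (δ + δ)) u hu) (fun y => ?_) x).trans
      (h.iterate_two_mul_le δ k (h.mapsTo _ u hu) x)
    have := h.I_add_le δ (t - (k * (δ + δ) + δ)) u hu y
    rwa [e] at this

theorem antitone_dyadicComp (t : ℝ≥0) {u : X → ℝ} (hu : u ∈ Cb K) :
    Antitone (fun n => dyadicComp I n t u) :=
  antitone_nat_of_succ_le fun n x => h.dyadicComp_succ_le n t hu x

theorem tendsto_dyadicComp (t : ℝ≥0) {u : X → ℝ} (hu : u ∈ Cb K) (x : X) :
    Tendsto (fun n => dyadicComp I n t u x) atTop (𝓝 (dyadicInf I t u x)) := by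
  obtain ⟨C, -, hC⟩ := Cb.bounded hu
  refine tendsto_atTop_ciInf (fun m n hmn => h.antitone_dyadicComp t hu hmn x) ⟨-C, ?_⟩
  rintro _ ⟨n, rfl⟩
  exact (abs_le.1 ((h.sandwiched_dyadicComp n t).abs_le hu hC x)).1

theorem sandwiched_dyadicInf (t : ℝ≥0) : Sandwiched K c T I t (dyadicInf I t) :=
  h.sandwiched_iInf (fun n => h.sandwiched_dyadicComp n t) fun _ hu x =>
    h.tendsto_dyadicComp t hu x

end IsGeneratingFamily

/-- Pointwise convergence of functions with a common Lipschitz constant with respect to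
`x ↦ ‖K x‖` is uniform on bounded sets, because these are totally bounded for this seminorm. -/
theorem eventually_abs_sub_le_of_lipWith (hK : IsCompactOperator K) {L : ℝ} {v : ℕ → X → ℝ}
    {u : X → ℝ} (hv : ∀ n, LipWith K L (v n)) (hu : LipWith K L u)
    (hvu : ∀ x, Tendsto (fun n => v n x) atTop (𝓝 (u x))) (r : ℝ) {ε : ℝ} (hε : 0 < ε) :
    ∀ᶠ n in atTop, ∀ x, ‖x‖ ≤ r → |v n x - u x| ≤ ε := by
  have hL := hu.1
  set η : ℝ := ε / (2 * L + 1) with hη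
  have hη0 : 0 < η := by positivity
  have htb : TotallyBounded (K '' Metric.closedBall 0 r) :=
    (IsCompactOperator.isCompact_closure_image_closedBall (f := K.toLinearMap) (𝕜₁ := ℝ) hK
      r).totallyBounded.subset subset_closure
  obtain ⟨t, hts, htf, hcov⟩ := Metric.finite_approx_of_totallyBounded htb _ hη0
  obtain ⟨F, -, hFfin, rfl⟩ := htf.exists_subset_finite_image_eq hts
  have hfin : ∀ᶠ n in atTop, ∀ z ∈ F, |v n z - u z| ≤ η := by
    rw [eventually_all_finite hFfin]
    intro z _
    have := (hvu z).sub_const (u z)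
    rw [sub_self] at this
    have h0 := this.abs
    rw [abs_zero] at h0
    exact h0.eventually (ge_mem_nhds hη0)
  filter_upwards [hfin] with n hn x hx
  have hmem := hcov ⟨x, by simpa using hx, rfl⟩
  simp only [Set.mem_iUnion, Set.mem_image, exists_prop] at hmem
  obtain ⟨_, ⟨z, hz, rfl⟩, hxz⟩ := hmem
  have hxz' : ‖K (x - z)‖ ≤ η := by
    rw [map_sub, ← dist_eq_norm]
    exact (Metric.mem_ball.1 hxz).le
  have h1 := abs_le.1 (((hv n).2 x z).trans (mul_le_mul_of_nonneg_left hxz' hL))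
  have h2 := abs_le.1 ((hu.2 x z).trans (mul_le_mul_of_nonneg_left hxz' hL))
  have h3 := abs_le.1 (hn z hz)
  have h4 : (2 * L + 1) * η = ε := by rw [hη]; field_simp
  rw [abs_le]
  constructor <;> linarith

end GeneratingFamily


/-! ### The semigroup generated by a generating family -/

section Semigroup

variable {X : Type*} [NormedAddCommGroup X] [NormedSpace ℝ X]
variable {K : X →L[ℝ] X} {c : ℝ≥0} {T I : ℝ≥0 → (X → ℝ) → (X → ℝ)}

namespace IsGeneratingFamily

variable (h : IsGeneratingFamily K c T I)
include h

theorem dyadicComp_dyadic_add {m n : ℕ} (hmn : m ≤ n) (j : ℕ) (s : ℝ≥0) {u : X → ℝ}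
    (hu : u ∈ Cb K) :
    dyadicComp I n (j * ((2 : ℝ≥0) ^ m)⁻¹ + s) u =
      dyadicComp I n (j * ((2 : ℝ≥0) ^ m)⁻¹) (dyadicComp I n s u) := by
  obtain ⟨i, rfl⟩ := Nat.exists_eq_add_of_le hmn
  have h2 : ((2 : ℝ≥0) ^ m)⁻¹ * 2 ^ (m + i) = 2 ^ i := by
    rw [pow_add, ← mul_assoc, inv_mul_cancel₀ (by positivity), one_mul]
  have e1 : (j * ((2 : ℝ≥0) ^ m)⁻¹) * 2 ^ (m + i) = ((j * 2 ^ i : ℕ) : ℝ≥0) := by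
    push_cast
    rw [mul_assoc, h2]
  have e2 : ((j * 2 ^ i : ℕ) : ℝ≥0) * ((2 : ℝ≥0) ^ (m + i))⁻¹ = j * ((2 : ℝ≥0) ^ m)⁻¹ := by
    rw [← e1, mul_assoc, mul_inv_cancel₀ (by positivity), mul_one]
  unfold dyadicComp
  rw [add_mul, e1, Nat.floor_natCast, add_comm (((j * 2 ^ i : ℕ)) : ℝ≥0),
    Nat.floor_add_natCast (zero_le), add_comm ⌊s * 2 ^ (m + i)⌋₊, e2, tsub_self, Nat.cast_add,
    add_mul, e2, add_tsub_add_eq_tsub_left, Function.iterate_add_apply, h.I_zero]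
  exact (h.sandwiched_dyadicComp (m + i) s).mapsTo u hu

/-- The semigroup property for dyadic first times. At fine levels the dyadic compositions have it
exactly, and the limit in the inner factor may be taken since its convergence is uniform on bounded
sets. -/
theorem dyadicInf_dyadic_add (hK : IsCompactOperator K) (m j : ℕ) (s : ℝ≥0) {u : X → ℝ}
    (hu : u ∈ Lipb K) :
    dyadicInf I (j * ((2 : ℝ≥0) ^ m)⁻¹) (dyadicInf I s u) =
      dyadicInf I (j * ((2 : ℝ≥0) ^ m)⁻¹ + s) u := by
  set q := j * ((2 : ℝ≥0) ^ m)⁻¹ with hq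
  have hu' := lipb_subset_cb hu
  obtain ⟨C, -, hC⟩ := Lipb.bounded hu
  obtain ⟨L, hL⟩ := hu.1
  have hS := h.sandwiched_dyadicInf s
  funext x
  refine tendsto_nhds_unique (h.tendsto_dyadicComp q (hS.mapsTo u hu') x) ?_
  have hlim := h.tendsto_dyadicComp (q + s) hu' x
  refine hlim.congr_dist ?_
  rw [Metric.tendsto_atTop']
  intro ε hε
  obtain ⟨R, δ, hδ, hmod⟩ := h.modulus q ‖x‖ C (half_pos hε)
  have hunif := eventually_abs_sub_le_of_lipWith hK
    (fun n => (h.sandwiched_dyadicComp n s).lip L u hu hL) (hS.lip L u hu hL)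
    (h.tendsto_dyadicComp s hu') R hδ
  obtain ⟨N, hN⟩ := eventually_atTop.1 (hunif.and (eventually_ge_atTop m))
  refine ⟨N, fun n hn => ?_⟩
  obtain ⟨h1, h2⟩ := hN n hn.le
  have hD := h.sandwiched_dyadicComp n s
  rw [h.dyadicComp_dyadic_add h2 j s hu', Real.dist_0_eq_abs, Real.dist_eq, abs_abs]
  exact (hmod q le_rfl _ (h.sandwiched_dyadicComp n q) _ (hD.mapsTo u hu') _ (hS.mapsTo u hu')
    (hD.abs_le hu' hC) (hS.abs_le hu' hC) h1 x le_rfl).trans_lt (half_lt_self hε)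

/-- The semigroup property on `Lipb K`. Split `t = q + a` and `s = q' + b` with `q, q'` dyadic and
`a, b` small: the factors for the times `a` and `b` are close to the identity, uniformly over
functions with a common Lipschitz constant. -/
theorem dyadicInf_add_of_lipb (hK : IsCompactOperator K) (t s : ℝ≥0) {u : X → ℝ}
    (hu : u ∈ Lipb K) :
    dyadicInf I t (dyadicInf I s u) = dyadicInf I (t + s) u := by
  have hu' := lipb_subset_cb hu
  obtain ⟨C, -, hC⟩ := Lipb.bounded hu
  obtain ⟨L, hL⟩ := hu.1
  have hS := h.sandwiched_dyadicInf
  funext x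
  refine eq_of_abs_sub_le_all fun ε hε => ?_
  obtain ⟨R₁, δ₁, hδ₁, hmod₁⟩ := h.modulus (t + s) ‖x‖ C hε
  have hδ3 : 0 < δ₁ / 3 := by positivity
  obtain ⟨R₂, δ₂, hδ₂, hmod₂⟩ := h.modulus (t + s) R₁ C hδ3
  obtain ⟨d₁, hd₁, hst₁⟩ := h.start_lipschitz (Real.exp (c * s) * L) R₁ hδ3
  obtain ⟨d₂, hd₂, hst₂⟩ := h.start_lipschitz L R₂ hδ₂
  obtain ⟨n, hn⟩ := (eventually_inv_two_pow_le (d := min d₁ (d₂ / 2))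
    (lt_min hd₁ (by positivity))).exists
  have hn₁ := hn.trans (min_le_left _ _)
  have hn₂ := hn.trans (min_le_right _ _)
  set δ := ((2 : ℝ≥0) ^ n)⁻¹ with hδ
  obtain ⟨j, a, ha, hta⟩ : ∃ (j : ℕ) (a : ℝ≥0), a ≤ δ ∧ t = j * δ + a :=
    ⟨_, _, sub_floor_mul_inv_le n t, (add_tsub_cancel_of_le (floor_mul_inv_le n t)).symm⟩
  obtain ⟨i, b, hb, hsb⟩ : ∃ (j : ℕ) (a : ℝ≥0), a ≤ δ ∧ s = j * δ + a :=
    ⟨_, _, sub_floor_mul_inv_le n s, (add_tsub_cancel_of_le (floor_mul_inv_le n s)).symm⟩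
  have hbu := (hS b).lipb hu
  have e1 : dyadicInf I s u = dyadicInf I (i * δ) (dyadicInf I b u) := by
    rw [h.dyadicInf_dyadic_add hK n i b hu, hsb]
  have e2 : dyadicInf I t (dyadicInf I s u) =
      dyadicInf I (j * δ) (dyadicInf I a (dyadicInf I s u)) := by
    rw [h.dyadicInf_dyadic_add hK n j a ((hS s).lipb hu), ← hta]
  have e3 : dyadicInf I (t + s) u =
      dyadicInf I (j * δ) (dyadicInf I (i * δ) (dyadicInf I (a + b) u)) := by
    rw [h.dyadicInf_dyadic_add hK n i (a + b) hu,
      h.dyadicInf_dyadic_add hK n j (i * δ + (a + b)) hu, ← hδ, hta, hsb]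
    congr 1
    ring
  have hjt : j * δ ≤ t + s := by rw [hta, add_assoc]; exact le_self_add
  have his : i * δ ≤ t + s := by rw [hsb]; exact le_add_left le_self_add
  have hab : a + b ≤ d₂ := (add_le_add (ha.trans hn₂) (hb.trans hn₂)).trans_eq (add_halves _)
  have hb2 : b ≤ d₂ := le_add_self.trans hab
  rw [e2, e3]
  have hsu := (hS s).lipb hu
  have habu := (hS (a + b)).lipb hu
  have mC : ∀ {w : X → ℝ}, w ∈ Lipb K → (∀ y, |w y| ≤ C) → ∀ r y, |dyadicInf I r w y| ≤ C :=
    fun hw hwC r y => (hS r).abs_le (lipb_subset_cb hw) hwC y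
  refine hmod₁ _ hjt _ (hS _) _ ((hS a).mapsTo _ (lipb_subset_cb hsu)) _
    ((hS (i * δ)).mapsTo _ (lipb_subset_cb habu)) (mC hsu (mC hu hC s) a)
    (mC habu (mC hu hC (a + b)) _) (fun y hy => ?_) x le_rfl
  have k1 := abs_le.1 (hst₁ a (ha.trans hn₁) _ (hS a) _ hsu ((hS s).lip L u hu hL) y hy)
  have k2 := abs_le.1 (hmod₂ _ his _ (hS (i * δ)) _ (lipb_subset_cb hbu) u hu'
    (mC hu hC b) hC (hst₂ b hb2 _ (hS b) u hu hL) y hy)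
  have k3 := abs_le.1 (hmod₂ _ his _ (hS (i * δ)) _ (lipb_subset_cb habu) u hu'
    (mC hu hC (a + b)) hC (hst₂ (a + b) hab _ (hS (a + b)) u hu hL) y hy)
  rw [← e1] at k2
  rw [abs_le]
  constructor <;> linarith

theorem dyadicInf_add (hK : IsCompactOperator K) (t s : ℝ≥0) {u : X → ℝ} (hu : u ∈ Cb K) :
    dyadicInf I t (dyadicInf I s u) = dyadicInf I (t + s) u := by
  obtain ⟨C, -, hC⟩ := Cb.bounded hu
  have hS := h.sandwiched_dyadicInf
  funext x
  refine eq_of_abs_sub_le_all fun ε hε => ?_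
  obtain ⟨R, δ, hδ, hmod⟩ := h.modulus (t + s) ‖x‖ C (half_pos hε)
  obtain ⟨v, hv, hvC, huv⟩ := Cb.exists_approx hu hC R hδ
  have h1 := abs_le.1 (hmod _ le_rfl _ (h.sandwiched_comp (hS t) (hS s)) u hu v
    (lipb_subset_cb hv) hC hvC huv x le_rfl)
  have h2 := abs_le.1 (hmod _ le_rfl _ (hS (t + s)) u hu v
    (lipb_subset_cb hv) hC hvC huv x le_rfl)
  have h3 := congrFun (h.dyadicInf_add_of_lipb hK t s hv) x
  simp only [Function.comp_apply] at h1
  rw [abs_le]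
  constructor <;> linarith

end IsGeneratingFamily

theorem eventually_nhdsGT_zero {P : ℝ≥0 → Prop} :
    (∀ᶠ t in 𝓝[>] (0 : ℝ≥0), P t) ↔ ∃ δ : ℝ≥0, 0 < δ ∧ ∀ t, 0 < t → t ≤ δ → P t := by
  rw [Filter.Eventually, mem_nhdsGT_iff_exists_Ioc_subset]
  exact ⟨fun ⟨δ, hδ, H⟩ => ⟨δ, hδ, fun t h0 h1 => H ⟨h0, h1⟩⟩,
    fun ⟨δ, hδ, H⟩ => ⟨δ, hδ, fun t ht => H t ht.1 ht.2⟩⟩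

theorem LipWith.lipNorm {u : X → ℝ} {L : ℝ} (hu : LipWith K L u) : lipNorm K u ≤ L :=
  csInf_le ⟨0, fun _ hL => hL.1⟩ hu

theorem IsGeneratingFamily.isConvexTransitionSemigroup (h : IsGeneratingFamily K c T I)
    (hK : IsCompactOperator K) : IsConvexTransitionSemigroup K c (dyadicInf I) where
  mapsTo := fun t u hu => (h.sandwiched_dyadicInf t).mapsTo u hu
  convex := fun t => by
    refine ⟨fun u hu v hv a b _ _ _ => ?_, fun u hu v hv a b ha hb hab x => ?_⟩
    · exact Cb.add (Cb.const_mul hu a) (Cb.const_mul hv b)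
    · obtain rfl : a = 1 - b := by linarith
      exact (h.sandwiched_dyadicInf t).convex u hu v hv b hb (by linarith) x
  monotone := fun t u hu v hv huv x => (h.sandwiched_dyadicInf t).mono u hu v hv huv x
  const := fun t => (h.sandwiched_dyadicInf t).const
  lip := fun t u hu => by
    have hS := h.sandwiched_dyadicInf t
    refine ⟨hS.lipb hu, ?_⟩
    have hpos := Real.exp_pos (c * t)
    rw [← div_le_iff₀' hpos]
    refine le_csInf hu.1 fun L hL => ?_
    rw [div_le_iff₀' hpos]
    exact (hS.lip L u hu hL).lipNorm
  semigroup := fun s t u hu => h.dyadicInf_add hK t s hu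
  continuous := fun s v u hv hu hvu => by
    have hS := h.sandwiched_dyadicInf
    rw [locConv_iff] at hvu
    obtain ⟨⟨C₀, hC₀⟩, hconv⟩ := hvu
    obtain ⟨N, hN⟩ := eventually_atTop.1 hC₀
    choose D hD0 hD using fun n => Cb.bounded (hv n)
    obtain ⟨C', hC'0, hC'⟩ := Cb.bounded hu
    -- finitely many of the functions are not covered by the eventual bound
    set C := |C₀| + C' + ∑ n ∈ Finset.range N, D n with hC
    have hsum : 0 ≤ ∑ n ∈ Finset.range N, D n := Finset.sum_nonneg fun n _ => hD0 n
    have huC : ∀ x, |u x| ≤ C := fun x => by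
      have := hC' x
      have := abs_nonneg C₀
      linarith
    have hvC : ∀ n x, |v n x| ≤ C := fun n x => by
      rcases lt_or_ge n N with hn | hn
      · have h1 := Finset.single_le_sum (fun n _ => hD0 n) (Finset.mem_range.2 hn)
        have h2 := hD n x
        have := abs_nonneg C₀
        linarith
      · have := (hN n hn x).trans (le_abs_self C₀)
        linarith
    refine ⟨⟨C, fun n t _ x => (hS t).abs_le (hv n) (hvC n) x⟩, fun r ε hε => ?_⟩
    obtain ⟨R, δ, hδ, hmod⟩ := h.modulus s r C hε
    obtain ⟨M, hM⟩ := eventually_atTop.1 (hconv R δ hδ)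
    exact ⟨M, fun n hn t ht x hx => hmod t ht _ (hS t) _ (hv n) u hu (hvC n) huC (hM n hn) x hx⟩
  strongly_continuous := fun u hu => by
    have hS := h.sandwiched_dyadicInf
    obtain ⟨C, -, hC⟩ := Cb.bounded hu
    refine locConv_iff.2 ⟨⟨C, Eventually.of_forall fun t => (hS t).abs_le hu hC⟩,
      fun r ε hε => ?_⟩
    obtain ⟨δ, hδ, H⟩ := h.start_cb hu r hε
    exact eventually_nhdsGT_zero.2 ⟨δ, hδ, fun t _ ht x hx => H t ht _ (hS t) x hx⟩

/-! ### The generator of the semigroup -/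

namespace IsGeneratingFamily

variable (h : IsGeneratingFamily K c T I)
include h

/-- If the difference quotients of `I` at `u` converge to `g`, then applying a sandwiched operator
`F` for a small time to `I η u` instead of `u` gains at least `η (g - ε)`. With
`f = (I η u - u) / η`, convexity gives
`F (u + η f) - F u ≥ F u - F (u - η f) ≥ η (F u - F (u - f))`, which is close to `η f`. -/
theorem exists_forall_le_sub {u g : X → ℝ} (hu : u ∈ Cb K) (hg : g ∈ Cb K)
    (hI : LocConv (𝓝[>] (0 : ℝ≥0)) (fun (η : ℝ≥0) x => (I η u x - u x) / (η : ℝ)) g)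
    (r : ℝ) {ε : ℝ} (hε : 0 < ε) :
    ∃ τ : ℝ≥0, 0 < τ ∧ ∀ η ≤ τ, ∀ t ≤ τ, ∀ F, Sandwiched K c T I t F →
      ∀ x, ‖x‖ ≤ r → (η : ℝ) * (g x - ε) ≤ F (I η u) x - F u x := by
  rw [locConv_iff] at hI
  obtain ⟨⟨C₁, hC₁⟩, hconv⟩ := hI
  obtain ⟨Cu, hCu0, hCu⟩ := Cb.bounded hu
  obtain ⟨Cg, hCg0, hCg⟩ := Cb.bounded hg
  have hε4 : 0 < ε / 4 := by positivity
  obtain ⟨R, δ, hδ, hmod⟩ := h.modulus 1 r (Cu + max C₁ Cg) hε4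
  obtain ⟨τ₁, hτ₁, H₁⟩ := h.start_cb hu r hε4
  obtain ⟨τ₂, hτ₂, H₂⟩ := h.start_cb (Cb.sub hu hg) r hε4
  obtain ⟨τ₃, hτ₃, H₃⟩ := eventually_nhdsGT_zero.1 (hC₁.and (hconv R δ hδ))
  refine ⟨min (min τ₁ τ₂) (min τ₃ 1), by positivity, fun η hη t ht F hF x hx => ?_⟩
  simp only [le_min_iff] at hη ht
  rcases eq_zero_or_pos η with rfl | hη0
  · simp [h.I_zero u hu]
  obtain ⟨hfC, hfg⟩ := H₃ η hη0 hη.2.1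
  have hη0' : (0 : ℝ) < η := hη0
  have hη1 : (η : ℝ) ≤ 1 := by exact_mod_cast hη.2.2
  set f : X → ℝ := fun y => (I η u y - u y) / (η : ℝ) with hf
  have hIu := h.mapsTo η u hu
  have hfCb : f ∈ Cb K := by
    have := Cb.const_mul (Cb.sub hIu hu) (η : ℝ)⁻¹
    simpa only [hf, div_eq_inv_mul] using this
  have hIf : ∀ y, I η u y = u y + η * f y := fun y => by
    simp only [hf]
    field_simp
    ring
  have huf := Cb.sub hu hfCb
  have hw : (fun y => u y - η * f y) ∈ Cb K := Cb.sub hu (Cb.const_mul hfCb _)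
  have s1 := hF.convex (I η u) hIu _ hw (1 / 2) (by norm_num) (by norm_num) x
  rw [show (fun y => (1 - 1 / 2) * I η u y + 1 / 2 * (u y - η * f y)) = u from
    funext fun y => by rw [hIf]; ring] at s1
  have s2 := hF.convex u hu _ huf η hη0'.le hη1 x
  rw [show (fun y => (1 - (η : ℝ)) * u y + η * (u y - f y)) = fun y => u y - η * f y from
    funext fun y => by ring] at s2
  have s3 := abs_le.1 (H₁ t ht.1.1 F hF x hx)
  have s4 := abs_le.1 (H₂ t ht.1.2 F hF x hx)
  have s5 := abs_le.1 (hmod t ht.2.2 F hF _ huf _ (Cb.sub hu hg)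
    (fun y => (abs_sub _ _).trans (add_le_add (hCu y) ((hfC y).trans (le_max_left _ _))))
    (fun y => (abs_sub _ _).trans (add_le_add (hCu y) ((hCg y).trans (le_max_right _ _))))
    (fun y hy => by
      rw [show u y - f y - (u y - g y) = -(f y - g y) by ring, abs_neg]
      exact hfg y hy) x hx)
  have s6 : (η : ℝ) * (g x - ε) ≤ η * (F u x - F (fun y => u y - f y) x) :=
    mul_le_mul_of_nonneg_left (by linarith) hη0'.le
  nlinarith

/-- Summing the gains of the single steps along the dyadic partition bounds the growth of the
semigroup from below. -/
theorem le_dyadicInf_sub {u g : X → ℝ} (hu : u ∈ Cb K) (hg : g ∈ Cb K)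
    (hI : LocConv (𝓝[>] (0 : ℝ≥0)) (fun (η : ℝ≥0) x => (I η u x - u x) / (η : ℝ)) g)
    (r : ℝ) {ε : ℝ} (hε : 0 < ε) :
    ∃ τ : ℝ≥0, 0 < τ ∧ ∀ t ≤ τ, ∀ x, ‖x‖ ≤ r →
      (t : ℝ) * (g x - ε) ≤ dyadicInf I t u x - u x := by
  obtain ⟨τ, hτ, H⟩ := h.exists_forall_le_sub hu hg hI r hε
  refine ⟨τ, hτ, fun t ht x hx => ?_⟩
  refine ge_of_tendsto ((h.tendsto_dyadicComp t hu x).sub_const (u x)) ?_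
  filter_upwards [eventually_inv_two_pow_le hτ] with n hn
  set δ := ((2 : ℝ≥0) ^ n)⁻¹ with hδ
  have hiter : ∀ k : ℕ, k * δ ≤ τ → ((k * δ : ℝ≥0) : ℝ) * (g x - ε) ≤ (I δ)^[k] u x - u x := by
    intro k
    induction k with
    | zero => simp
    | succ k ih =>
      intro hk
      have hk' : k * δ ≤ τ := le_trans (by gcongr; simp) hk
      have h1 := ih hk'
      have h2 := H δ hn (k * δ) hk' _ (h.sandwiched_iterate δ k) x hx
      rw [Function.iterate_succ_apply]
      push_cast at h1 ⊢
      linarith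
  have hk := (floor_mul_inv_le n t).trans ht
  have h1 := hiter _ hk
  have h2 := H _ ((sub_floor_mul_inv_le n t).trans hn) _ hk _ (h.sandwiched_iterate δ _) x hx
  have h3 : ((t - ⌊t * 2 ^ n⌋₊ * δ : ℝ≥0) : ℝ) = t - ((⌊t * 2 ^ n⌋₊ * δ : ℝ≥0) : ℝ) :=
    NNReal.coe_sub (floor_mul_inv_le n t)
  rw [h3] at h2
  unfold dyadicComp
  linarith

/-- The generator of the semigroup agrees with the right derivative of `I` at time zero. -/
theorem hasGenerator_dyadicInf {u g : X → ℝ} (hu : u ∈ Cb K) (hg : g ∈ Cb K)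
    (hI : LocConv (𝓝[>] (0 : ℝ≥0)) (fun (η : ℝ≥0) x => (I η u x - u x) / (η : ℝ)) g)
    {b : X → ℝ} (hT : LocConv (𝓝[>] (0 : ℝ≥0)) (fun (η : ℝ≥0) x => (T η u x - u x) / (η : ℝ)) b) :
    HasGenerator K (dyadicInf I) u g := by
  have hS := h.sandwiched_dyadicInf
  refine ⟨hu, hg, ?_⟩
  rw [locConv_iff]
  obtain ⟨⟨C₁, hC₁⟩, hconv⟩ := locConv_iff.1 hI
  obtain ⟨⟨C₂, hC₂⟩, -⟩ := locConv_iff.1 hT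
  constructor
  · refine ⟨max C₁ C₂, ?_⟩
    filter_upwards [hC₁, hC₂, self_mem_nhdsWithin] with t h1 h2 ht x
    have ht' : (0 : ℝ) < t := ht
    have k1 := (abs_le.1 (h1 x)).2
    have k2 := (abs_le.1 (h2 x)).1
    have k3 : (dyadicInf I t u x - u x) / t ≤ (I t u x - u x) / t := by
      gcongr
      exact (hS t).le_I u hu x
    have k4 : (T t u x - u x) / t ≤ (dyadicInf I t u x - u x) / t := by
      gcongr
      exact (hS t).T_le u hu x
    rw [abs_le]
    constructor
    · linarith [le_max_right C₁ C₂]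
    · linarith [le_max_left C₁ C₂]
  · intro r ε hε
    obtain ⟨τ, hτ, H⟩ := h.le_dyadicInf_sub hu hg hI r hε
    filter_upwards [hconv r ε hε, eventually_nhdsGT_zero.2 ⟨τ, hτ, fun t _ ht => ht⟩,
      self_mem_nhdsWithin] with t h1 ht ht0 x hx
    have ht' : (0 : ℝ) < t := ht0
    have k1 := (abs_le.1 (h1 x hx)).2
    have k2 : (dyadicInf I t u x - u x) / t ≤ (I t u x - u x) / t := by
      gcongr
      exact (hS t).le_I u hu x
    have k3 : g x - ε ≤ (dyadicInf I t u x - u x) / t := by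
      rw [le_div_iff₀ ht', mul_comm]
      exact H t ht x hx
    rw [abs_le]
    constructor <;> linarith

end IsGeneratingFamily

end Semigroup


/-! ### The reference semigroup -/

/-- Sublinear against superlinear growth: `L s` is at most `ε` plus a multiple of `s ^ p`. -/
theorem exists_mul_le_add_mul_rpow {p : ℝ} (hp : 1 < p) {L ε : ℝ} (hL : 0 ≤ L) (hε : 0 < ε) :
    ∃ A : ℝ, 0 < A ∧ ∀ s : ℝ, 0 ≤ s → L * s ≤ ε + A * s ^ p := by
  set σ : ℝ := ε / (L + 1) with hσ
  have hσ0 : 0 < σ := by positivity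
  have hσp : 0 < σ ^ (p - 1) := by positivity
  refine ⟨(L + 1) / σ ^ (p - 1), by positivity, fun s hs => ?_⟩
  rcases le_total s σ with h | h
  · have h1 : L * s ≤ (L + 1) * σ := by gcongr; linarith
    have h2 : (L + 1) * σ = ε := by rw [hσ]; field_simp
    have : 0 ≤ (L + 1) / σ ^ (p - 1) * s ^ p := by positivity
    linarith
  · have hs0 : 0 < s := hσ0.trans_le h
    have h1 : σ ^ (p - 1) ≤ s ^ (p - 1) := Real.rpow_le_rpow hσ0.le h (by linarith)
    have h2 : s ^ p = s ^ (p - 1) * s := by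
      rw [← Real.rpow_add_one hs0.ne']; ring_nf
    have h3 : (L + 1) / σ ^ (p - 1) * s ^ p ≥ (L + 1) / σ ^ (p - 1) * (σ ^ (p - 1) * s) := by
      rw [h2]; gcongr
    have h4 : (L + 1) / σ ^ (p - 1) * (σ ^ (p - 1) * s) = (L + 1) * s := by field_simp
    nlinarith

section Integrals

variable {X : Type*} [NormedAddCommGroup X] [MeasurableSpace X] [BorelSpace X]

theorem integral_le_integral_add_const {Ω : Type*} [MeasurableSpace Ω] {ν : Measure Ω}
    [IsProbabilityMeasure ν] {f g : Ω → ℝ} (hf : Integrable f ν) (hg : Integrable g ν) {a : ℝ}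
    (h : ∀ y, f y ≤ g y + a) : ∫ y, f y ∂ν ≤ ∫ y, g y ∂ν + a := by
  have h1 := integral_mono hf (hg.add (integrable_const a)) h
  have h2 : ∫ y, (g + fun _ => a : Ω → ℝ) y ∂ν = ∫ y, g y ∂ν + a := by
    simp only [Pi.add_apply]
    rw [integral_add hg (integrable_const a)]
    simp
  rwa [h2] at h1

omit [MeasurableSpace X] [BorelSpace X] in
theorem lintegral_enorm_rpow_eq {Ω : Type*} [MeasurableSpace Ω] (ν : Measure Ω) (f : Ω → X) {p : ℝ}
    (hp : 0 ≤ p) : ∫⁻ y, ‖f y‖ₑ ^ p ∂ν = ∫⁻ y, ENNReal.ofReal (‖f y‖ ^ p) ∂ν := by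
  refine lintegral_congr fun y => ?_
  rw [← ENNReal.ofReal_rpow_of_nonneg (norm_nonneg _) hp, ofReal_norm]

theorem integrable_norm_rpow_comp {Ω : Type*} [MeasurableSpace Ω] {ν : Measure Ω} {f : Ω → X}
    (hf : Measurable f) {p : ℝ} (hp : 0 ≤ p) (h : ∫⁻ y, ‖f y‖ₑ ^ p ∂ν ≠ ∞) :
    Integrable (fun y => ‖f y‖ ^ p) ν := by
  refine ⟨(hf.norm.pow_const p).aestronglyMeasurable, ?_⟩
  rw [hasFiniteIntegral_iff_ofReal (Eventually.of_forall fun y => by positivity),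
    ← lintegral_enorm_rpow_eq ν f hp]
  exact h.lt_top

theorem integral_norm_rpow_comp {Ω : Type*} [MeasurableSpace Ω] (ν : Measure Ω) {f : Ω → X}
    (hf : Measurable f) {p : ℝ} (hp : 0 ≤ p) :
    ∫ y, ‖f y‖ ^ p ∂ν = (∫⁻ y, ‖f y‖ₑ ^ p ∂ν).toReal := by
  rw [integral_eq_lintegral_of_nonneg_ae (Eventually.of_forall fun y => by positivity)
    (hf.norm.pow_const p).aestronglyMeasurable, lintegral_enorm_rpow_eq ν f hp]

theorem integrable_norm_rpow {p : ℝ} {ν : Measure X} (hν : ν ∈ Pp p) (hp : 0 ≤ p) :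
    Integrable (fun y => ‖y‖ ^ p) ν :=
  integrable_norm_rpow_comp measurable_id hp hν.2.ne

theorem integral_norm_rpow {p : ℝ} (ν : Measure X) (hp : 0 ≤ p) :
    ∫ y, ‖y‖ ^ p ∂ν = (∫⁻ y, ‖y‖ₑ ^ p ∂ν).toReal :=
  integral_norm_rpow_comp ν measurable_id hp

end Integrals

section Reference

variable {X : Type*} [NormedAddCommGroup X] [NormedSpace ℝ X] [MeasurableSpace X]

/-- The hypotheses on the reference process `ψ_t(x) + Y_t` with `Y_t ∼ μ_t`. -/
structure IsReferenceProcess (K : X →L[ℝ] X) (p : ℝ) (c : ℝ≥0) (μ : ℝ≥0 → Measure X)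
    (ψ : ℝ≥0 → X → X) : Prop where
  norm_le : ∀ x : X, ‖K x‖ ≤ ‖x‖
  one_lt : 1 < p
  mem_Pp : ∀ t : ℝ≥0, μ t ∈ Pp p
  chapman : ∀ s t : ℝ≥0, ∀ u ∈ Cb K, ∀ x : X,
    ∫ y, u (ψ (t + s) x + y) ∂(μ (t + s)) = ∫ y, ∫ z, u (ψ s (ψ t x + y) + z) ∂(μ s) ∂(μ t)
  lipschitz : ∀ (t : ℝ≥0) (x₁ x₂ : X), ‖ψ t x₁ - ψ t x₂‖ ≤ Real.exp (c * t) * ‖x₁ - x₂‖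
  comm : ∀ (t : ℝ≥0) (x : X), K (ψ t x) = ψ t (K x)
  zero : ∀ x : X, ψ 0 x = x
  lim : ∀ r : ℝ, TendstoUniformlyOn (fun (h : ℝ≥0) (x : X) => ψ h (K x))
    (fun x : X => K x) (𝓝[>] 0) (Metric.closedBall 0 r)
  moment : Tendsto (fun h : ℝ≥0 => ∫⁻ y, ‖y‖ₑ ^ p ∂(μ h)) (𝓝[>] 0) (𝓝 0)

variable [BorelSpace X]

theorem integrable_of_mem_cb {K : X →L[ℝ] X} {Ω : Type*} [MeasurableSpace Ω] {ν : Measure Ω}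
    [IsFiniteMeasure ν] {u : X → ℝ} (hu : u ∈ Cb K) {f : Ω → X} (hf : Measurable f) :
    Integrable (fun y => u (f y)) ν := by
  obtain ⟨C, -, hC⟩ := Cb.bounded hu
  refine Integrable.of_bound (C := C) ?_ (Eventually.of_forall fun y => hC (f y))
  exact ((Cb.continuous hu).measurable.comp hf).aestronglyMeasurable

theorem Cb.measurable_comp_const_add {K : X →L[ℝ] X} {u : X → ℝ} (hu : u ∈ Cb K) (q : X) :
    Measurable fun z => u (q + z) :=
  (Cb.continuous hu).measurable.comp (measurable_const_add q)

namespace IsReferenceProcess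

variable {K : X →L[ℝ] X} {p : ℝ} {c : ℝ≥0} {μ : ℝ≥0 → Measure X} {ψ : ℝ≥0 → X → X}
  (h : IsReferenceProcess K p c μ ψ)
include h

omit [BorelSpace X] in
theorem pos : 0 < p := zero_lt_one.trans h.one_lt

omit [BorelSpace X] in
theorem isProbabilityMeasure (t : ℝ≥0) : IsProbabilityMeasure (μ t) := (h.mem_Pp t).1

theorem integrable (t : ℝ≥0) {u : X → ℝ} (hu : u ∈ Cb K) (z : X) :
    Integrable (fun y => u (z + y)) (μ t) :=
  have := h.isProbabilityMeasure t
  integrable_of_mem_cb hu (measurable_const_add z)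

omit [BorelSpace X] in
theorem refOp_const (t : ℝ≥0) (a : ℝ) : refOp ψ μ t (fun _ : X => a) = fun _ => a := by
  have := h.isProbabilityMeasure t
  funext x
  simp [refOp]

theorem refOp_mono (t : ℝ≥0) {u v : X → ℝ} (hu : u ∈ Cb K) (hv : v ∈ Cb K)
    (huv : ∀ x, u x ≤ v x) (x : X) : refOp ψ μ t u x ≤ refOp ψ μ t v x :=
  integral_mono (h.integrable t hu _) (h.integrable t hv _) fun _ => huv _

theorem refOp_sub (t : ℝ≥0) {u v : X → ℝ} (hu : u ∈ Cb K) (hv : v ∈ Cb K) (x : X) :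
    refOp ψ μ t (fun y => u y - v y) x = refOp ψ μ t u x - refOp ψ μ t v x :=
  integral_sub (h.integrable t hu _) (h.integrable t hv _)

theorem refOp_abs_le (t : ℝ≥0) {u : X → ℝ} (hu : u ∈ Cb K) {C : ℝ} (hC : ∀ x, |u x| ≤ C) (x : X) :
    |refOp ψ μ t u x| ≤ C := by
  have h1 := h.refOp_mono t hu (Cb.const C) (fun y => (abs_le.1 (hC y)).2) x
  have h2 := h.refOp_mono t (Cb.const (-C)) hu (fun y => (abs_le.1 (hC y)).1) x
  rw [h.refOp_const] at h1 h2
  exact abs_le.2 ⟨h2, h1⟩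

omit [BorelSpace X] in
/-- The flow `ψ` is Lipschitz for the seminorm `x ↦ ‖K x‖`, too, since it commutes with `K`. -/
theorem norm_map_flow_sub_le (t : ℝ≥0) (x₁ x₂ : X) :
    ‖K (ψ t x₁ - ψ t x₂)‖ ≤ Real.exp (c * t) * ‖K (x₁ - x₂)‖ := by
  rw [map_sub, map_sub, h.comm, h.comm]
  exact h.lipschitz t _ _

theorem refOp_lipWith (t : ℝ≥0) {u : X → ℝ} (hu : u ∈ Lipb K) {L : ℝ} (hL : LipWith K L u) :
    LipWith K (Real.exp (c * t) * L) (refOp ψ μ t u) := by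
  have := h.isProbabilityMeasure t
  have hu' := lipb_subset_cb hu
  refine LipWith.of_sub_le (mul_nonneg (Real.exp_pos _).le hL.1) fun x y => ?_
  rw [sub_le_iff_le_add']
  refine integral_le_integral_add_const (h.integrable t hu' _) (h.integrable t hu' _) fun z => ?_
  have h1 := (abs_le.1 (hL.2 (ψ t x + z) (ψ t y + z))).2
  rw [add_sub_add_right_eq_sub] at h1
  have h2 := mul_le_mul_of_nonneg_left (h.norm_map_flow_sub_le t x y) hL.1
  linarith

theorem refOp_lipb (t : ℝ≥0) {u : X → ℝ} (hu : u ∈ Lipb K) : refOp ψ μ t u ∈ Lipb K := by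
  obtain ⟨C, -, hC⟩ := Lipb.bounded hu
  obtain ⟨L, hL⟩ := hu.1
  exact ⟨⟨_, h.refOp_lipWith t hu hL⟩, C, h.refOp_abs_le t (lipb_subset_cb hu) hC⟩

omit h [BorelSpace X] in
/-- Uniform tightness of the reference process over a set of times, in functional form. -/
def _root_.WassersteinSemigroup.TailBound (K : X →L[ℝ] X) (ψ : ℝ≥0 → X → X) (μ : ℝ≥0 → Measure X)
    (A : Set ℝ≥0) : Prop :=
  ∀ r C : ℝ, ∀ ε > 0, ∃ R : ℝ, ∀ t ∈ A, ∀ w ∈ Cb K, (∀ x, w x ≤ C) → (∀ x, ‖x‖ ≤ R → w x ≤ 0) →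
    ∀ x, ‖x‖ ≤ r → refOp ψ μ t w x ≤ ε

/-- Markov's inequality for the `p`-th moments. -/
theorem tailBound_of_bounds {A : Set ℝ≥0} {M ρ s : ℝ≥0} (hA : ∀ t ∈ A, t ≤ s)
    (hM : ∀ t ∈ A, ∫ y, ‖y‖ ^ p ∂(μ t) ≤ M) (hρ : ∀ t ∈ A, ‖ψ t 0‖ ≤ ρ) :
    TailBound K ψ μ A := by
  intro r C ε hε
  have hp := h.pos
  obtain ⟨σ, hσ0, hσ⟩ : ∃ σ : ℝ, 0 < σ ∧ |C| * σ ^ (-p) * M ≤ ε := by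
    have h1 : Tendsto (fun σ : ℝ => |C| * σ ^ (-p) * M) atTop (𝓝 (|C| * 0 * M)) :=
      ((tendsto_rpow_neg_atTop hp).const_mul _).mul_const _
    rw [mul_zero, zero_mul] at h1
    exact ((eventually_gt_atTop 0).and (h1.eventually (ge_mem_nhds hε))).exists
  refine ⟨ρ + Real.exp (c * s) * |r| + σ, fun t ht w hw hwC hwR x hx => ?_⟩
  have := h.isProbabilityMeasure t
  have hflow : ‖ψ t x‖ ≤ ρ + Real.exp (c * s) * |r| := by
    have h1 := h.lipschitz t x 0
    have h2 : ‖ψ t x‖ ≤ ‖ψ t 0‖ + ‖ψ t x - ψ t 0‖ := by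
      have := norm_add_le (ψ t 0) (ψ t x - ψ t 0)
      rwa [add_sub_cancel] at this
    have h3 : Real.exp (c * t) * ‖x - 0‖ ≤ Real.exp (c * s) * |r| := by
      rw [sub_zero]
      gcongr
      · exact hA t ht
      · exact hx.trans (le_abs_self r)
    linarith [hρ t ht]
  have hpt : ∀ y, w (ψ t x + y) ≤ |C| * σ ^ (-p) * ‖y‖ ^ p := by
    intro y
    rcases le_total ‖y‖ σ with hy | hy
    · refine (hwR _ ((norm_add_le _ _).trans (by linarith))).trans (by positivity)
    · have h1 : 1 ≤ σ ^ (-p) * ‖y‖ ^ p := by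
        rw [Real.rpow_neg hσ0.le, inv_mul_eq_div, one_le_div (by positivity)]
        exact Real.rpow_le_rpow hσ0.le hy hp.le
      calc w (ψ t x + y) ≤ |C| * 1 := by rw [mul_one]; exact (hwC _).trans (le_abs_self C)
        _ ≤ |C| * (σ ^ (-p) * ‖y‖ ^ p) := by gcongr
        _ = _ := by ring
  have h1 := integral_mono (h.integrable t hw (ψ t x))
    ((integrable_norm_rpow (h.mem_Pp t) hp.le).const_mul (|C| * σ ^ (-p))) hpt
  rw [integral_const_mul] at h1
  refine h1.trans (le_trans ?_ hσ)
  gcongr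
  exact hM t ht

theorem tailBound_singleton (t : ℝ≥0) : TailBound K ψ μ {t} := by
  refine h.tailBound_of_bounds (M := (∫ y, ‖y‖ ^ p ∂(μ t)).toNNReal) (ρ := ‖ψ t 0‖₊) (s := t)
    ?_ ?_ ?_
  · rintro _ rfl
    exact le_rfl
  · rintro _ rfl
    exact Real.le_coe_toNNReal _
  · rintro _ rfl
    exact le_rfl

theorem abs_refOp_sub_le {A : Set ℝ≥0} (hA : TailBound K ψ μ A) (r C : ℝ) {ε : ℝ} (hε : 0 < ε) :
    ∃ R : ℝ, ∀ t ∈ A, ∀ u ∈ Cb K, ∀ v ∈ Cb K, (∀ x, |u x| ≤ C) → (∀ x, |v x| ≤ C) →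
      ∀ δ : ℝ, 0 ≤ δ → (∀ x, ‖x‖ ≤ R → |u x - v x| ≤ δ) →
        ∀ x, ‖x‖ ≤ r → |refOp ψ μ t u x - refOp ψ μ t v x| ≤ δ + ε := by
  obtain ⟨R, hR⟩ := hA r (2 * C) ε hε
  have key : ∀ t ∈ A, ∀ u ∈ Cb K, ∀ v ∈ Cb K, (∀ x, |u x| ≤ C) → (∀ x, |v x| ≤ C) →
      ∀ δ : ℝ, 0 ≤ δ → (∀ x, ‖x‖ ≤ R → |u x - v x| ≤ δ) →
        ∀ x, ‖x‖ ≤ r → refOp ψ μ t u x - refOp ψ μ t v x ≤ δ + ε := by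
    intro t ht u hu v hv huC hvC δ hδ huv x hx
    have huv' := Cb.sub hu hv
    have h1 := hR t ht _ (Cb.sub_const huv' δ) (fun y => ?_) (fun y hy => ?_) x hx
    · rw [h.refOp_sub t huv' (Cb.const δ), h.refOp_sub t hu hv, h.refOp_const] at h1
      linarith
    · linarith [abs_le.1 (huC y), abs_le.1 (hvC y)]
    · linarith [abs_le.1 (huv y hy)]
  refine ⟨R, fun t ht u hu v hv huC hvC δ hδ huv x hx => abs_le.2 ⟨?_, ?_⟩⟩
  · have := key t ht v hv u hu hvC huC δ hδ (fun y hy => by rw [abs_sub_comm]; exact huv y hy) x hx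
    linarith
  · exact key t ht u hu v hv huC hvC δ hδ huv x hx

theorem refOp_mapsTo (t : ℝ≥0) {u : X → ℝ} (hu : u ∈ Cb K) : refOp ψ μ t u ∈ Cb K := by
  obtain ⟨C, -, hC⟩ := Cb.bounded hu
  refine Cb.of_approx (h.refOp_abs_le t hu hC) fun r ε hε => ?_
  obtain ⟨R, hR⟩ := h.abs_refOp_sub_le (h.tailBound_singleton t) r C (half_pos hε)
  obtain ⟨v, hv, hvC, huv⟩ := Cb.exists_approx hu hC R (half_pos hε)
  refine ⟨refOp ψ μ t v, lipb_subset_cb (h.refOp_lipb t hv), fun x hx => ?_⟩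
  have := hR t rfl u hu v (lipb_subset_cb hv) hC hvC _ (half_pos hε).le huv x hx
  linarith

omit [BorelSpace X] in
theorem refOp_refOp (t s : ℝ≥0) {u : X → ℝ} (hu : u ∈ Cb K) :
    refOp ψ μ t (refOp ψ μ s u) = refOp ψ μ (t + s) u := by
  funext x
  exact (h.chapman s t u hu x).symm

/-- Tightness over all bounded time intervals: it holds for small times by the moment condition,
and doubling the length of the time interval is possible by the semigroup property. A bound for the
moments of `μ t` over bounded time intervals is not available: the Chapman–Kolmogorov equations hold
only for functions in `Cb K`, which cannot separate points whose difference is in the kernel of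
`K`. -/
theorem tailBound (s : ℝ≥0) : TailBound K ψ μ (Set.Iic s) := by
  obtain ⟨δ, hδ, hsmall⟩ : ∃ δ : ℝ≥0, 0 < δ ∧ TailBound K ψ μ (Set.Iic δ) := by
    have h1 : ∀ᶠ t in 𝓝[>] (0 : ℝ≥0), ∫⁻ y, ‖y‖ₑ ^ p ∂(μ t) ≤ 1 :=
      h.moment.eventually (ge_mem_nhds one_pos)
    have h2 : ∀ᶠ t in 𝓝[>] (0 : ℝ≥0), ‖ψ t 0‖ ≤ 1 := by
      filter_upwards [Metric.tendstoUniformlyOn_iff.1 (h.lim 0) 1 one_pos] with t ht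
      have := ht 0 (by simp)
      rw [map_zero, dist_zero_left] at this
      exact this.le
    obtain ⟨δ, hδ, H⟩ := eventually_nhdsGT_zero.1 (h1.and h2)
    refine ⟨δ, hδ, h.tailBound_of_bounds (M := 1 + (∫ y, ‖y‖ ^ p ∂(μ 0)).toNNReal) (ρ := 1)
      (s := δ) (fun t ht => ht) (fun t ht => ?_) fun t ht => ?_⟩
    · rcases eq_zero_or_pos t with rfl | ht0
      · have := Real.le_coe_toNNReal (∫ y, ‖y‖ ^ p ∂(μ 0))
        push_cast
        linarith
      · rw [integral_norm_rpow _ h.pos.le]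
        have := ENNReal.toReal_mono ENNReal.one_ne_top (H t ht0 ht).1
        rw [ENNReal.toReal_one] at this
        exact this.trans (by push_cast; simp)
    · rcases eq_zero_or_pos t with rfl | ht0
      · simp [h.zero]
      · simpa using (H t ht0 ht).2
  have hdouble : ∀ s : ℝ≥0, TailBound K ψ μ (Set.Iic s) → TailBound K ψ μ (Set.Iic (2 * s)) := by
    intro s hs r C ε hε
    obtain ⟨R, hR⟩ := hs r C (ε / 2) (half_pos hε)
    obtain ⟨R', hR'⟩ := hs R C (ε / 2) (half_pos hε)
    refine ⟨R', fun t ht w hw hwC hwR x hx => ?_⟩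
    have ht2 : t / 2 ∈ Set.Iic s := by
      rw [Set.mem_Iic, div_le_iff₀ two_pos, mul_comm]
      exact ht
    have := h.isProbabilityMeasure (t / 2)
    have hw2 := h.refOp_mapsTo (t / 2) hw
    have h1 := hR _ ht2 _ (Cb.sub_const hw2 (ε / 2)) (fun y => ?_)
      (fun y hy => by linarith [hR' _ ht2 w hw hwC hwR y hy]) x hx
    · rw [h.refOp_sub _ hw2 (Cb.const _), h.refOp_const, h.refOp_refOp _ _ hw, add_halves] at h1
      linarith
    · have := h.refOp_mono (t / 2) hw (Cb.const C) hwC y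
      rw [h.refOp_const] at this
      linarith
  have hpow : ∀ n : ℕ, TailBound K ψ μ (Set.Iic (2 ^ n * δ)) := fun n => by
    induction n with
    | zero => simpa using hsmall
    | succ n ih => rw [pow_succ', mul_assoc]; exact hdouble _ ih
  obtain ⟨n, hn⟩ := pow_unbounded_of_one_lt (s / δ) (one_lt_two (α := ℝ≥0))
  have hs : s ≤ 2 ^ n * δ := by
    rw [← div_le_iff₀ hδ]
    exact hn.le
  intro r C ε hε
  obtain ⟨R, hR⟩ := hpow n r C ε hε
  exact ⟨R, fun t ht => hR t (le_trans ht hs)⟩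

/-- As the flow commutes with `K`, its continuity on the range of `K` suffices for functions that
are Lipschitz with respect to `x ↦ ‖K x‖`. -/
theorem exists_abs_refOp_sub_self_le_of_pos (L r : ℝ) {ε : ℝ} (hε : 0 < ε) :
    ∃ δ : ℝ≥0, 0 < δ ∧ ∀ t, 0 < t → t ≤ δ → ∀ u ∈ Lipb K, LipWith K L u →
      ∀ x, ‖x‖ ≤ r → |refOp ψ μ t u x - u x| ≤ ε := by
  rcases lt_or_ge L 0 with hL | hL
  · exact ⟨1, one_pos, fun t _ _ u _ hu => absurd hu.1 (not_le.2 hL)⟩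
  have hp := h.pos
  have hε3 : 0 < ε / 3 := by positivity
  obtain ⟨A, hA, hAs⟩ := exists_mul_le_add_mul_rpow h.one_lt hL hε3
  have h1 : ∀ᶠ t in 𝓝[>] (0 : ℝ≥0), A * ∫ y, ‖y‖ ^ p ∂(μ t) ≤ ε / 3 := by
    have := ((ENNReal.tendsto_toReal ENNReal.zero_ne_top).comp h.moment).const_mul A
    simp only [ENNReal.toReal_zero, mul_zero] at this
    filter_upwards [this.eventually (ge_mem_nhds hε3)] with t ht
    rw [integral_norm_rpow _ hp.le]
    exact ht
  have h2 := Metric.tendstoUniformlyOn_iff.1 (h.lim r) (ε / 3 / (L + 1)) (by positivity)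
  obtain ⟨δ, hδ, H⟩ := eventually_nhdsGT_zero.1 (h1.and h2)
  refine ⟨δ, hδ, fun t ht0 ht u hu huL x hx => ?_⟩
  obtain ⟨k1, k2⟩ := H t ht0 ht
  have k3 : L * ‖K (ψ t x - x)‖ ≤ ε / 3 := by
    have := (k2 x (by simpa using hx)).le
    rw [dist_comm, dist_eq_norm] at this
    rw [map_sub, h.comm]
    calc L * ‖ψ t (K x) - K x‖ ≤ (L + 1) * (ε / 3 / (L + 1)) := by gcongr; linarith
      _ = ε / 3 := by field_simp
  have := h.isProbabilityMeasure t
  have hu' := lipb_subset_cb hu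
  have hpt : ∀ y, |u (ψ t x + y) - u x| ≤ 2 * ε / 3 + A * ‖y‖ ^ p := fun y => by
    have e1 := huL.2 (ψ t x + y) x
    have e2 : ‖K (ψ t x + y - x)‖ ≤ ‖K (ψ t x - x)‖ + ‖y‖ := by
      rw [show ψ t x + y - x = (ψ t x - x) + y by abel, map_add]
      exact (norm_add_le _ _).trans (by gcongr; exact h.norm_le y)
    have e3 := mul_le_mul_of_nonneg_left e2 hL
    have e4 := hAs ‖y‖ (norm_nonneg _)
    rw [mul_add] at e3
    linarith
  have hint := h.integrable t hu' (ψ t x)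
  have hmom := (integrable_norm_rpow (h.mem_Pp t) hp.le).const_mul A
  have hsub : refOp ψ μ t u x - u x = ∫ y, (u (ψ t x + y) - u x) ∂(μ t) := by
    rw [integral_sub hint (integrable_const _)]
    simp [refOp]
  rw [hsub]
  refine abs_integral_le_integral_abs.trans ?_
  have := integral_le_integral_add_const (a := 2 * ε / 3) (hint.sub (integrable_const (u x))).abs
    hmom (fun y => by have := hpt y; simp only [Pi.sub_apply]; linarith)
  rw [integral_const_mul] at this
  simp only [Pi.sub_apply] at this
  linarith

/-- The measure `μ 0` is not assumed to be a Dirac measure, so that this is deduced from the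
semigroup property and the continuity at time zero along positive times. -/
theorem refOp_zero {u : X → ℝ} (hu : u ∈ Cb K) : refOp ψ μ 0 u = u := by
  obtain ⟨C, -, hC⟩ := Cb.bounded hu
  funext x
  refine eq_of_abs_sub_le_all fun ε hε => ?_
  -- it suffices to treat Lipschitz functions, since `refOp ψ μ 0` is continuous
  obtain ⟨R₀, hR₀⟩ := h.abs_refOp_sub_le (h.tailBound_singleton 0) ‖x‖ C (ε := ε / 8)
    (by positivity)
  obtain ⟨v, hv, hvC, huv⟩ := Cb.exists_approx hu hC (max R₀ ‖x‖) (ε := ε / 8) (by positivity)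
  obtain ⟨L, hL⟩ := hv.1
  have hv' := lipb_subset_cb hv
  obtain ⟨δ, hδ, H⟩ := h.exists_abs_refOp_sub_self_le_of_pos L (max R₀ ‖x‖) (ε := ε / 8)
    (by positivity)
  have hT := H δ hδ le_rfl v hv hL
  have hTv := h.refOp_mapsTo δ hv'
  -- `T 0 (T δ v) = T δ v`, where `T δ v` is close to `v`
  have h1 := hR₀ 0 rfl _ hTv v hv' (h.refOp_abs_le δ hv' hvC) hvC (ε / 8) (by positivity)
    (fun y hy => hT y (hy.trans (le_max_left _ _))) x le_rfl
  rw [h.refOp_refOp 0 δ hv', zero_add] at h1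
  have h2 := hT x (le_max_right _ _)
  have h3 := hR₀ 0 rfl u hu v hv' hC hvC (ε / 8) (by positivity)
    (fun y hy => huv y (hy.trans (le_max_left _ _))) x le_rfl
  have h4 := huv x (le_max_right _ _)
  rw [abs_le] at h1 h2 h3 h4 ⊢
  constructor <;> linarith

theorem exists_abs_refOp_sub_self_le (L r : ℝ) {ε : ℝ} (hε : 0 < ε) :
    ∃ δ : ℝ≥0, 0 < δ ∧ ∀ t ≤ δ, ∀ u ∈ Lipb K, LipWith K L u →
      ∀ x, ‖x‖ ≤ r → |refOp ψ μ t u x - u x| ≤ ε := by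
  obtain ⟨δ, hδ, H⟩ := h.exists_abs_refOp_sub_self_le_of_pos L r hε
  refine ⟨δ, hδ, fun t ht u hu hL x hx => ?_⟩
  rcases eq_zero_or_pos t with rfl | ht0
  · rw [h.refOp_zero (lipb_subset_cb hu)]
    simpa using hε.le
  · exact H t ht0 ht u hu hL x hx

theorem exists_abs_refOp_sub_self_le_of_cb {u : X → ℝ} (hu : u ∈ Cb K) (r : ℝ) {ε : ℝ}
    (hε : 0 < ε) :
    ∃ δ : ℝ≥0, 0 < δ ∧ ∀ t ≤ δ, ∀ x, ‖x‖ ≤ r → |refOp ψ μ t u x - u x| ≤ ε := by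
  obtain ⟨C, -, hC⟩ := Cb.bounded hu
  have hε4 : 0 < ε / 4 := by positivity
  obtain ⟨R, hR⟩ := h.abs_refOp_sub_le (h.tailBound 1) r C hε4
  obtain ⟨v, hv, hvC, huv⟩ := Cb.exists_approx hu hC (max R r) hε4
  obtain ⟨L, hL⟩ := hv.1
  obtain ⟨δ, hδ, H⟩ := h.exists_abs_refOp_sub_self_le L r hε4
  refine ⟨min δ 1, lt_min hδ one_pos, fun t ht x hx => ?_⟩
  rw [le_min_iff] at ht
  have h1 := hR t ht.2 u hu v (lipb_subset_cb hv) hC hvC _ hε4.le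
    (fun y hy => huv y (hy.trans (le_max_left _ _))) x hx
  have h2 := H t ht.1 v hv hL x hx
  have h3 := huv x (hx.trans (le_max_right _ _))
  rw [abs_le] at h1 h2 h3 ⊢
  constructor <;> linarith

end IsReferenceProcess

end Reference


/-! ### The penalty function and one-dimensional duality -/

/-- The hypotheses on the penalty function `φ` that are used. -/
structure IsPenalty (p : ℝ) (φ : ℝ≥0 → ℝ≥0∞) : Prop where
  zero : φ 0 = 0
  ne : ∃ v : ℝ≥0, 0 < v ∧ φ v ≠ 0
  convex : ConvexOn ℝ≥0 Set.univ (fun v : ℝ≥0 => φ (v ^ (1 / p)))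

/-- The number `a` is an upper bound for the conjugate at `m` of `b ↦ φ (b ^ (1 / p))`. -/
def IsConjBound (p : ℝ) (φ : ℝ≥0 → ℝ≥0∞) (m a : ℝ) : Prop :=
  ∀ v : ℝ≥0, φ v ≠ ∞ → m * (v : ℝ) ^ p ≤ a + (φ v).toReal

/-- A convex set above a convex set in the plane, with first coordinates in `[0, ∞)`, can be
separated from it by a non-vertical line of nonnegative slope. The slope is the infimum of the
slopes of the segments that join a point of the lower set to a point of the upper set on its
right. -/
theorem exists_affine_between {G E : Set (ℝ × ℝ)} (hG : Convex ℝ G) (hE : Convex ℝ E) {M : ℝ}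
    (hGup : ∀ b e, (b, e) ∈ G → ∀ b', b ≤ b' → (b', e) ∈ G)
    (hGE : ∀ b e r, (b, e) ∈ G → (b, r) ∈ E → e ≤ M + r)
    (hG0 : ∃ e, (0, e) ∈ G) (hE1 : ∃ b r, 0 < b ∧ (b, r) ∈ E) :
    ∃ m a : ℝ, 0 ≤ m ∧ (∀ b e, (b, e) ∈ G → e ≤ a + m * b) ∧
      ∀ b r, (b, r) ∈ E → a + m * b ≤ M + r := by
  obtain ⟨e₀, he₀⟩ := hG0
  obtain ⟨b₁, r₁, hb₁, hr₁⟩ := hE1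
  set U : Set ℝ := {s | ∃ b e b' r, (b, e) ∈ G ∧ (b', r) ∈ E ∧ b < b' ∧
    s = (M + r - e) / (b' - b)} with hU
  have hUne : U.Nonempty := ⟨_, 0, e₀, b₁, r₁, he₀, hr₁, hb₁, rfl⟩
  have hU0 : ∀ s ∈ U, 0 ≤ s := by
    rintro s ⟨b, e, b', r, hbe, hbr, hlt, rfl⟩
    have := hGE b' e r (hGup b e hbe b' hlt.le) hbr
    exact div_nonneg (by linarith) (by linarith)
  have hUbdd : BddBelow U := ⟨0, hU0⟩
  set m := sInf U with hm
  have hm0 : 0 ≤ m := le_csInf hUne hU0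
  have key : ∀ b e b' r, (b, e) ∈ G → (b', r) ∈ E → e - m * b ≤ M + r - m * b' := by
    intro b e b' r hbe hbr
    rcases lt_trichotomy b b' with hlt | rfl | hgt
    · have h1 : m ≤ (M + r - e) / (b' - b) := csInf_le hUbdd ⟨b, e, b', r, hbe, hbr, hlt, rfl⟩
      rw [le_div_iff₀ (by linarith)] at h1
      linarith
    · linarith [hGE b e r hbe hbr]
    · have h1 : (e - M - r) / (b - b') ≤ m := by
        refine le_csInf hUne ?_
        rintro s ⟨b₂, e₂, b₂', r₂, hbe₂, hbr₂, hlt₂, rfl⟩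
        have w1 : 0 < b₂' - b₂ := by linarith
        have w2 : 0 < b - b' := by linarith
        rw [div_le_div_iff₀ w2 w1]
        -- the two segments have a common barycentre with these weights
        have hsum : 0 < (b₂' - b₂) + (b - b') := by linarith
        set α := (b₂' - b₂) / ((b₂' - b₂) + (b - b')) with hα
        set β := (b - b') / ((b₂' - b₂) + (b - b')) with hβ
        have hα0 : 0 ≤ α := by positivity
        have hβ0 : 0 ≤ β := by positivity
        have hαβ : α + β = 1 := by rw [hα, hβ, ← add_div, div_self hsum.ne']
        have g := hG hbe hbe₂ hα0 hβ0 hαβ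
        have f := hE hbr hbr₂ hα0 hβ0 hαβ
        simp only [Prod.smul_mk, Prod.mk_add_mk, smul_eq_mul] at g f
        have hbary : α * b + β * b₂ = α * b' + β * b₂' := by
          rw [hα, hβ]
          field_simp
          ring
        rw [hbary] at g
        have hle := hGE _ _ _ g f
        have hMα : M = α * M + β * M := by rw [← add_mul, hαβ, one_mul]
        have hle' : α * (e - M - r) ≤ β * (M + r₂ - e₂) := by linarith
        rw [hα, hβ, div_mul_eq_mul_div, div_mul_eq_mul_div, div_le_div_iff_of_pos_right hsum]
          at hle'
        linarith
      rw [div_le_iff₀ (by linarith)] at h1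
      linarith
  set A : Set ℝ := {s | ∃ b r, (b, r) ∈ E ∧ s = M + r - m * b} with hA
  have hAbdd : BddBelow A := ⟨e₀ - m * 0, by
    rintro s ⟨b, r, hbr, rfl⟩
    exact key 0 e₀ b r he₀ hbr⟩
  refine ⟨m, sInf A, hm0, fun b e hbe => ?_, fun b r hbr => ?_⟩
  · have : e - m * b ≤ sInf A := by
      refine le_csInf ⟨_, b₁, r₁, hr₁, rfl⟩ ?_
      rintro s ⟨b', r, hbr, rfl⟩
      exact key b e b' r hbe hbr
    linarith
  · have : sInf A ≤ M + r - m * b := csInf_le hAbdd ⟨b, r, hbr, rfl⟩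
    linarith

theorem exists_mul_le_const_add {p : ℝ} (hp : 1 < p) {L m : ℝ} (hL : 0 ≤ L) (hm : 0 < m) :
    ∃ a : ℝ, 0 ≤ a ∧ ∀ s : ℝ, 0 ≤ s → L * s ≤ a + m * s ^ p := by
  obtain ⟨A, hA, h⟩ := exists_mul_le_add_mul_rpow hp hL one_pos
  -- rescale `s` so that the coefficient of `s ^ p` becomes `m`
  set k : ℝ := (A / m) ^ (1 / (p - 1)) with hk
  have hk0 : 0 < k := by positivity
  have hkp : k ^ (p - 1) = A / m := by
    rw [hk, ← Real.rpow_mul (by positivity), one_div, inv_mul_cancel₀ (by linarith), Real.rpow_one]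
  refine ⟨k, hk0.le, fun s hs => ?_⟩
  have h1 := h (s / k) (by positivity)
  have h2 : k * (A * (s / k) ^ p) = m * s ^ p := by
    rw [Real.div_rpow hs hk0.le, show k ^ p = k ^ (p - 1) * k by
      rw [← Real.rpow_add_one hk0.ne']; ring_nf, hkp]
    field_simp
  have h3 : k * (L * (s / k)) = L * s := by field_simp
  have h4 := mul_le_mul_of_nonneg_left h1 hk0.le
  rw [mul_add, h2, h3] at h4
  linarith

namespace IsPenalty

variable {p : ℝ} {φ : ℝ≥0 → ℝ≥0∞} (hφ : IsPenalty p φ)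
include hφ

/-- Convexity along the segment from `0` to `w ^ p`. -/
theorem le_mul (hp : 0 < p) {a v w : ℝ≥0} (ha : a ≤ 1) (hv : v ^ p = a * w ^ p) :
    φ v ≤ a * φ w := by
  have h1 := hφ.convex.2 (Set.mem_univ (w ^ p)) (Set.mem_univ 0) (zero_le (a := a))
    (zero_le (a := 1 - a)) (add_tsub_cancel_of_le ha)
  have hr : ∀ z : ℝ≥0, (z ^ p) ^ (1 / p) = z := fun z => by
    rw [← NNReal.rpow_mul, mul_one_div_cancel hp.ne', NNReal.rpow_one]
  simp only [smul_eq_mul, mul_zero, add_zero, hr] at h1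
  rw [NNReal.zero_rpow (by positivity), hφ.zero, smul_zero, add_zero, ← hv, hr] at h1
  exact h1

theorem mono (hp : 0 < p) {v w : ℝ≥0} (hvw : v ≤ w) : φ v ≤ φ w := by
  rcases eq_zero_or_pos w with rfl | hw
  · rw [nonpos_iff_eq_zero.1 hvw]
  have ha : (v / w) ^ p ≤ 1 := by
    rw [← NNReal.one_rpow p]
    gcongr
    exact div_le_one_of_le₀ hvw zero_le
  have h1 := hφ.le_mul hp ha (v := v) (w := w) (by
    rw [NNReal.div_rpow, div_mul_cancel₀]
    positivity)
  refine h1.trans ?_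
  calc _ ≤ 1 * φ w := by gcongr; exact_mod_cast ha
    _ = φ w := one_mul _

theorem exists_conjBound (hp : 0 < p) : ∃ m a : ℝ, 0 < m ∧ 0 ≤ a ∧ IsConjBound p φ m a := by
  obtain ⟨v₀, hv₀, hne⟩ := hφ.ne
  obtain ⟨δ, hδ, hδφ⟩ : ∃ δ : ℝ≥0, 0 < δ ∧ (δ : ℝ≥0∞) ≤ φ v₀ := by
    obtain ⟨δ, h0, h1⟩ := ENNReal.lt_iff_exists_nnreal_btwn.1 (pos_iff_ne_zero.2 hne)
    exact ⟨δ, by exact_mod_cast h0, h1.le⟩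
  have hv₀' : (0 : ℝ) < (v₀ : ℝ) ^ p := by positivity
  refine ⟨δ / (v₀ : ℝ) ^ p, δ, by positivity, δ.2, fun v hv => ?_⟩
  rcases le_total v v₀ with hle | hle
  · have h1 : (v : ℝ) ^ p ≤ (v₀ : ℝ) ^ p := by gcongr
    have h2 : δ / (v₀ : ℝ) ^ p * (v : ℝ) ^ p ≤ δ / (v₀ : ℝ) ^ p * (v₀ : ℝ) ^ p := by gcongr
    rw [div_mul_cancel₀ _ hv₀'.ne'] at h2
    linarith [ENNReal.toReal_nonneg (a := φ v)]
  · have hvpos : 0 < v := hv₀.trans_le hle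
    have ha : (v₀ / v) ^ p ≤ 1 := by
      rw [← NNReal.one_rpow p]
      gcongr
      exact div_le_one_of_le₀ hle zero_le
    have h1 := hδφ.trans (hφ.le_mul hp ha (v := v₀) (w := v) (by
      rw [NNReal.div_rpow, div_mul_cancel₀]
      positivity))
    have h2 := ENNReal.toReal_mono (ENNReal.mul_ne_top ENNReal.coe_ne_top hv) h1
    rw [ENNReal.toReal_mul, ENNReal.coe_toReal, ENNReal.coe_toReal, NNReal.coe_rpow,
      NNReal.coe_div, Real.div_rpow v₀.coe_nonneg v.coe_nonneg] at h2
    have h3 : δ / (v₀ : ℝ) ^ p * (v : ℝ) ^ p ≤ (φ v).toReal := by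
      have hvp : (0 : ℝ) < (v : ℝ) ^ p := by positivity
      rw [div_mul_eq_mul_div, le_div_iff₀ hvp] at *
      rw [div_le_iff₀ hv₀']
      linarith
    linarith [δ.2]

/-- Fenchel duality for the difference of a concave function, given by its hypograph `G`, and of
`b ↦ φ (b ^ (1 / p))`. If `φ` is infinite on `(0, ∞)` there is no separating line in general,
and the growth condition on `G` replaces it. -/
theorem exists_conjBound_of_hypograph (hp : 0 < p) {G : Set (ℝ × ℝ)} (hG : Convex ℝ G) {M : ℝ}
    (hGup : ∀ b e, (b, e) ∈ G → ∀ b', b ≤ b' → (b', e) ∈ G)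
    (hG0 : ∃ e, (0, e) ∈ G)
    (hGM : ∀ (v : ℝ≥0) (e : ℝ), ((v : ℝ) ^ p, e) ∈ G → φ v ≠ ∞ → e ≤ M + (φ v).toReal)
    {ε : ℝ} (hε : 0 < ε) (hgrow : ∃ A : ℝ, 0 ≤ A ∧ ∀ b e, (b, e) ∈ G → e ≤ M + ε + A * b) :
    ∃ m a : ℝ, 0 ≤ m ∧ IsConjBound p φ m a ∧ ∀ b e, (b, e) ∈ G → e ≤ M + ε - a + m * b := by
  by_cases hdeg : ∃ v : ℝ≥0, 0 < v ∧ φ v ≠ ∞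
  · obtain ⟨v₁, hv₁, hfin₁⟩ := hdeg
    set E : Set (ℝ × ℝ) := {x | ∃ v : ℝ≥0, x.1 = (v : ℝ) ^ p ∧ φ v ≠ ∞ ∧ (φ v).toReal ≤ x.2}
      with hE
    have hEc : Convex ℝ E := by
      rintro ⟨b₁, r₁⟩ ⟨v₁, h1, h1f, h1r⟩ ⟨b₂, r₂⟩ ⟨v₂, h2, h2f, h2r⟩ α β hα hβ hαβ
      simp only at h1 h2 h1r h2r
      lift α to ℝ≥0 using hα
      lift β to ℝ≥0 using hβ
      have hαβ' : α + β = 1 := by exact_mod_cast hαβ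
      have hr : ∀ z : ℝ≥0, (z ^ p) ^ (1 / p) = z := fun z => by
        rw [← NNReal.rpow_mul, mul_one_div_cancel hp.ne', NNReal.rpow_one]
      have hc := hφ.convex.2 (Set.mem_univ (v₁ ^ p)) (Set.mem_univ (v₂ ^ p))
        (zero_le (a := α)) (zero_le (a := β)) hαβ'
      simp only [hr, smul_eq_mul, ENNReal.smul_def] at hc
      have hfin : (α : ℝ≥0∞) * φ v₁ + β * φ v₂ ≠ ∞ :=
        ENNReal.add_ne_top.2 ⟨ENNReal.mul_ne_top ENNReal.coe_ne_top h1f,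
          ENNReal.mul_ne_top ENNReal.coe_ne_top h2f⟩
      refine ⟨(α * v₁ ^ p + β * v₂ ^ p) ^ (1 / p), ?_, ne_top_of_le_ne_top hfin hc, ?_⟩
      · simp only [Prod.smul_mk, Prod.mk_add_mk, smul_eq_mul, h1, h2]
        have e : ((α * v₁ ^ p + β * v₂ ^ p) ^ (1 / p)) ^ p = α * v₁ ^ p + β * v₂ ^ p := by
          rw [← NNReal.rpow_mul, one_div_mul_cancel hp.ne', NNReal.rpow_one]
        exact_mod_cast e.symm
      · refine (ENNReal.toReal_mono hfin hc).trans ?_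
        rw [ENNReal.toReal_add (ENNReal.mul_ne_top ENNReal.coe_ne_top h1f)
          (ENNReal.mul_ne_top ENNReal.coe_ne_top h2f), ENNReal.toReal_mul, ENNReal.toReal_mul]
        simp only [Prod.smul_mk, Prod.mk_add_mk, smul_eq_mul, ENNReal.coe_toReal]
        gcongr
    obtain ⟨m, a, hm, hGa, hEa⟩ := exists_affine_between hG hEc (M := M) hGup
      (fun b e r hbe hbr => by
        obtain ⟨v, hv, hfin, hr⟩ := hbr
        simp only at hv hr
        subst hv
        exact (hGM v e hbe hfin).trans (by linarith))
      hG0 ⟨_, _, by positivity, v₁, rfl, hfin₁, le_rfl⟩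
    refine ⟨m, M - a, hm, fun v hv => ?_, fun b e hbe => ?_⟩
    · have := hEa ((v : ℝ) ^ p) (φ v).toReal ⟨v, rfl, hv, le_rfl⟩
      linarith
    · linarith [hGa b e hbe]
  · push Not at hdeg
    obtain ⟨A, hA, h⟩ := hgrow
    refine ⟨A, 0, hA, fun v hv => ?_, fun b e hbe => by linarith [h b e hbe]⟩
    rcases eq_zero_or_pos v with rfl | hv0
    · simp [hφ.zero, Real.zero_rpow hp.ne']
    · exact absurd (hdeg v hv0) hv

end IsPenalty

/-! ### The sup-convolution -/

/-- The coefficient of `‖d‖ ^ p` in the penalty `m t (e^{-ct} ‖d‖ / t) ^ p` of the displacement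
`d` in time `t`. -/
noncomputable def rate (p : ℝ) (c : ℝ≥0) (t : ℝ≥0) (m : ℝ) : ℝ :=
  m * (t * (Real.exp (-(c * t)) / t) ^ p)

theorem rate_nonneg (p : ℝ) (c t : ℝ≥0) {m : ℝ} (hm : 0 ≤ m) : 0 ≤ rate p c t m := by
  unfold rate
  positivity

theorem rate_pos (p : ℝ) (c : ℝ≥0) {t : ℝ≥0} (ht : 0 < t) {m : ℝ} (hm : 0 < m) :
    0 < rate p c t m := by
  unfold rate
  positivity

theorem rate_mul_rpow (p : ℝ) (c t : ℝ≥0) (m : ℝ) {s : ℝ} (hs : 0 ≤ s) :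
    rate p c t m * s ^ p = t * (m * (Real.exp (-(c * t)) * (s / t)) ^ p) := by
  rw [rate, show Real.exp (-(c * t)) * (s / t) = Real.exp (-(c * t)) / t * s by ring,
    Real.mul_rpow (by positivity) hs]
  ring

/-- A displacement by `a` in time `t`, transported by the flow for time `s`, followed by a
displacement by `b` in time `s`, costs at least as much as the total displacement in time
`t + s`. -/
theorem rate_add_le {p : ℝ} (hp : 1 ≤ p) (c : ℝ≥0) {t s : ℝ≥0} (ht : 0 < t) (hs : 0 < s) {m : ℝ}
    (hm : 0 ≤ m) {a b : ℝ} (ha : 0 ≤ a) (hb : 0 ≤ b) :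
    rate p c (t + s) m * (Real.exp (c * s) * a + b) ^ p ≤
      rate p c t m * a ^ p + rate p c s m * b ^ p := by
  have ht' : (0 : ℝ) < t := ht
  have hs' : (0 : ℝ) < s := hs
  rw [rate_mul_rpow _ _ _ _ (by positivity), rate_mul_rpow _ _ _ _ ha, rate_mul_rpow _ _ _ _ hb]
  push_cast
  set α := Real.exp (-(c * t)) * (a / t) with hα
  set β := Real.exp (-(c * s)) * (b / s) with hβ
  have hα0 : 0 ≤ α := by positivity
  have hβ0 : 0 ≤ β := by positivity
  have hconv := (convexOn_rpow hp).2 (Set.mem_Ici.2 hα0) (Set.mem_Ici.2 hβ0)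
    (show (0 : ℝ) ≤ t / (t + s) by positivity) (show (0 : ℝ) ≤ s / (t + s) by positivity)
    (by rw [← add_div, div_self (by positivity)])
  simp only [smul_eq_mul] at hconv
  have hle : Real.exp (-(c * (t + s))) * ((Real.exp (c * s) * a + b) / (t + s)) ≤
      (t : ℝ) / (t + s) * α + s / (t + s) * β := by
    have e1 : (t : ℝ) / (t + s) * α + s / (t + s) * β =
        (Real.exp (-(c * t)) * a + Real.exp (-(c * s)) * b) / (t + s) := by
      rw [hα, hβ]
      field_simp
    have e2 : Real.exp (-((c : ℝ) * (t + s))) * Real.exp (c * s) = Real.exp (-(c * t)) := by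
      rw [← Real.exp_add]
      ring_nf
    have e3 : Real.exp (-((c : ℝ) * (t + s))) ≤ Real.exp (-(c * s)) := by
      rw [Real.exp_le_exp]
      have : 0 ≤ (c : ℝ) * t := by positivity
      linarith
    rw [e1, ← mul_div_assoc]
    gcongr
    calc Real.exp (-((c : ℝ) * (t + s))) * (Real.exp (c * s) * a + b)
        = Real.exp (-(c * t)) * a + Real.exp (-((c : ℝ) * (t + s))) * b := by
          rw [mul_add, ← mul_assoc, e2]
      _ ≤ _ := by gcongr
  have h1 : (Real.exp (-(c * (t + s))) * ((Real.exp (c * s) * a + b) / (t + s))) ^ p ≤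
      (t : ℝ) / (t + s) * α ^ p + s / (t + s) * β ^ p :=
    (Real.rpow_le_rpow (by positivity) hle (by linarith)).trans hconv
  calc ((t : ℝ) + s) * (m * (Real.exp (-(c * (t + s))) *
        ((Real.exp (c * s) * a + b) / (t + s))) ^ p)
      ≤ (t + s) * (m * ((t : ℝ) / (t + s) * α ^ p + s / (t + s) * β ^ p)) := by gcongr
    _ = _ := by field_simp

theorem rate_antitone {p : ℝ} (hp : 1 ≤ p) (c : ℝ≥0) {t s : ℝ≥0} (ht : 0 < t) (hts : t ≤ s) {m : ℝ}
    (hm : 0 ≤ m) : rate p c s m ≤ rate p c t m := by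
  rcases hts.eq_or_lt with rfl | hlt
  · exact le_rfl
  have := rate_add_le hp c (tsub_pos_of_lt hlt) ht hm (le_refl (0 : ℝ)) zero_le_one
  rwa [tsub_add_cancel_of_le hts, mul_zero, zero_add, Real.one_rpow, mul_one, mul_one,
    Real.zero_rpow (by linarith), mul_zero, zero_add] at this

section SupConv

variable {X : Type*} [NormedAddCommGroup X]

/-- The sup-convolution of `u` with `d ↦ -l ‖d‖ ^ p`. -/
noncomputable def supConv (p l : ℝ) (u : X → ℝ) (x : X) : ℝ :=
  ⨆ d : X, (u (x + d) - l * ‖d‖ ^ p)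

variable {p l : ℝ} {u : X → ℝ}

theorem le_supConv (hl : 0 ≤ l) {C : ℝ} (hu : ∀ x, u x ≤ C) (x d : X) :
    u (x + d) - l * ‖d‖ ^ p ≤ supConv p l u x := by
  refine le_ciSup (f := fun d : X => u (x + d) - l * ‖d‖ ^ p) ⟨C, ?_⟩ d
  rintro _ ⟨d, rfl⟩
  have : 0 ≤ l * ‖d‖ ^ p := by positivity
  simp only
  linarith [hu (x + d)]

theorem supConv_le {a : ℝ} {x : X} (h : ∀ d, u (x + d) ≤ a + l * ‖d‖ ^ p) :
    supConv p l u x ≤ a :=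
  ciSup_le fun d => by linarith [h d]

theorem le_supConv_self (hp : 0 < p) (hl : 0 ≤ l) {C : ℝ} (hu : ∀ x, u x ≤ C) (x : X) :
    u x ≤ supConv p l u x := by
  have := le_supConv (p := p) hl hu x 0
  simpa [Real.zero_rpow hp.ne'] using this

theorem supConv_le_bound (hl : 0 ≤ l) {C : ℝ} (hu : ∀ x, u x ≤ C) (x : X) :
    supConv p l u x ≤ C :=
  supConv_le fun d => by
    have : 0 ≤ l * ‖d‖ ^ p := by positivity
    linarith [hu (x + d)]

theorem abs_supConv_le (hp : 0 < p) (hl : 0 ≤ l) {C : ℝ} (hu : ∀ x, |u x| ≤ C) (x : X) :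
    |supConv p l u x| ≤ C :=
  abs_le.2 ⟨(abs_le.1 (hu x)).1.trans (le_supConv_self hp hl (fun y => (abs_le.1 (hu y)).2) x),
    supConv_le_bound hl (fun y => (abs_le.1 (hu y)).2) x⟩

/-- If `u` is bounded by `C` and close to `v` on a ball, then the sup-convolutions are close on a
smaller ball: displacements with `l ‖d‖ ^ p > 2 C` are irrelevant. -/
theorem supConv_le_of_le_on_ball (hp : 0 < p) {l₀ C a R₀ R : ℝ} (hl₀ : 0 < l₀) (hl : l₀ ≤ l)
    (hR₀ : 0 ≤ R₀) (hC : 2 * C ≤ l₀ * R₀ ^ p) (ha : -C ≤ a) (hu : ∀ x, u x ≤ C)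
    (huR : ∀ x, ‖x‖ ≤ R + R₀ → u x ≤ a) {x : X} (hx : ‖x‖ ≤ R) : supConv p l u x ≤ a := by
  refine supConv_le fun d => ?_
  have hl0 : 0 < l := hl₀.trans_le hl
  rcases le_total ‖d‖ R₀ with hd | hd
  · have : 0 ≤ l * ‖d‖ ^ p := by positivity
    linarith [huR (x + d) ((norm_add_le _ _).trans (add_le_add hx hd))]
  · have : l₀ * R₀ ^ p ≤ l * ‖d‖ ^ p := by gcongr
    linarith [hu (x + d)]

theorem exists_radius (hp : 0 < p) {l₀ : ℝ} (hl₀ : 0 < l₀) (C : ℝ) :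
    ∃ R₀ : ℝ, 0 ≤ R₀ ∧ C ≤ l₀ * R₀ ^ p := by
  have := ((tendsto_rpow_atTop hp).const_mul_atTop hl₀).eventually_ge_atTop C
  exact ((eventually_ge_atTop 0).and this).exists

variable [NormedSpace ℝ X] {K : X →L[ℝ] X}

theorem lipWith_supConv (hl : 0 ≤ l) {L C : ℝ} (hu : ∀ x, u x ≤ C) (hL : LipWith K L u) :
    LipWith K L (supConv p l u) := by
  refine LipWith.of_sub_le hL.1 fun x y => ?_
  rw [sub_le_iff_le_add]
  refine supConv_le fun d => ?_
  have h1 := (abs_le.1 (hL.2 (x + d) (y + d))).2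
  rw [add_sub_add_right_eq_sub] at h1
  linarith [le_supConv (p := p) hl hu y d]

theorem supConv_mem_lipb (hp : 0 < p) (hl : 0 ≤ l) (hu : u ∈ Lipb K) :
    supConv p l u ∈ Lipb K := by
  obtain ⟨C, -, hC⟩ := Lipb.bounded hu
  obtain ⟨L, hL⟩ := hu.1
  exact ⟨⟨L, lipWith_supConv hl (fun x => (abs_le.1 (hC x)).2) hL⟩, C, abs_supConv_le hp hl hC⟩

theorem supConv_mem_cb (hp : 0 < p) (hl : 0 < l) (hu : u ∈ Cb K) : supConv p l u ∈ Cb K := by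
  obtain ⟨C, hC0, hC⟩ := Cb.bounded hu
  refine Cb.of_approx (abs_supConv_le hp hl.le hC) fun r ε hε => ?_
  obtain ⟨R₀, hR₀, hR₀C⟩ := exists_radius hp hl (2 * C)
  obtain ⟨v, hv, hvC, huv⟩ := Cb.exists_approx hu hC (r + R₀) hε
  refine ⟨supConv p l v, lipb_subset_cb (supConv_mem_lipb hp hl.le hv), fun x hx => ?_⟩
  have key : ∀ f g : X → ℝ, (∀ x, |f x| ≤ C) → (∀ x, |g x| ≤ C) →
      (∀ x, ‖x‖ ≤ r + R₀ → f x - g x ≤ ε) → supConv p l f x ≤ supConv p l g x + ε := by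
    intro f g hf hg hfg
    refine supConv_le fun d => ?_
    rcases le_total ‖d‖ R₀ with hd | hd
    · linarith [hfg (x + d) ((norm_add_le _ _).trans (add_le_add hx hd)),
        le_supConv (p := p) hl.le (fun y => (abs_le.1 (hg y)).2) x d]
    · have : l * R₀ ^ p ≤ l * ‖d‖ ^ p := by gcongr
      linarith [(abs_le.1 (hf (x + d))).2, (abs_le.1 (abs_supConv_le hp hl.le hg x)).1]
  have h1 := key u v hC hvC fun y hy => (abs_le.1 (huv y hy)).2
  have h2 := key v u hvC hC fun y hy => by linarith [(abs_le.1 (huv y hy)).1]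
  rw [abs_le]
  constructor <;> linarith

end SupConv


/-! ### Couplings and the Wasserstein distance -/

section Wasserstein

variable {X : Type*} [NormedAddCommGroup X] [MeasurableSpace X] [BorelSpace X]
  [SecondCountableTopology X]

omit [SecondCountableTopology X] in
theorem lintegral_enorm_add_rpow_lt_top {Ω : Type*} [MeasurableSpace Ω] {ν : Measure Ω}
    {f g : Ω → X}
    (hf : Measurable f) {p : ℝ} (hp : 1 ≤ p) (hfp : ∫⁻ y, ‖f y‖ₑ ^ p ∂ν < ∞)
    (hgp : ∫⁻ y, ‖g y‖ₑ ^ p ∂ν < ∞) : ∫⁻ y, ‖f y + g y‖ₑ ^ p ∂ν < ∞ := by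
  have hpt : ∀ y, ‖f y + g y‖ₑ ^ p ≤ 2 ^ (p - 1) * (‖f y‖ₑ ^ p + ‖g y‖ₑ ^ p) := fun y =>
    (ENNReal.rpow_le_rpow (enorm_add_le _ _) (by linarith)).trans
      (ENNReal.rpow_add_le_mul_rpow_add_rpow _ _ hp)
  refine (lintegral_mono hpt).trans_lt ?_
  have h2 : (2 : ℝ≥0∞) ^ (p - 1) ≠ ∞ := ENNReal.rpow_ne_top_of_nonneg (by linarith) (by simp)
  rw [lintegral_const_mul' _ _ h2, lintegral_add_left (hf.enorm.pow_const p)]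
  exact ENNReal.mul_lt_top h2.lt_top (ENNReal.add_lt_top.2 ⟨hfp, hgp⟩)

/-- Second countability is needed here: it makes the product `σ`-algebra the Borel `σ`-algebra. -/
theorem measurable_fst_sub_snd : Measurable fun yz : X × X => yz.1 - yz.2 :=
  measurable_fst.sub measurable_snd

variable {p : ℝ} {μ ν : Measure X}

theorem iInf_cpl_ne_top (hp : 1 ≤ p) (hμ : μ ∈ Pp p) (hν : ν ∈ Pp p) :
    ⨅ π ∈ Cpl μ ν, ∫⁻ yz, ‖yz.1 - yz.2‖ₑ ^ p ∂π ≠ ∞ := by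
  have := hμ.1
  have := hν.1
  have hmem : μ.prod ν ∈ Cpl μ ν := ⟨inferInstance, by simp, by simp⟩
  refine ((iInf₂_le _ hmem).trans_lt ?_).ne
  simp_rw [sub_eq_add_neg]
  refine lintegral_enorm_add_rpow_lt_top measurable_fst hp ?_ ?_
  · have h1 : ∫⁻ y, ‖y‖ₑ ^ p ∂((μ.prod ν).map Prod.fst) < ∞ := by simpa using hμ.2
    rwa [lintegral_map (measurable_enorm.pow_const p) measurable_fst] at h1
  · have h1 : ∫⁻ y, ‖y‖ₑ ^ p ∂((μ.prod ν).map Prod.snd) < ∞ := by simpa using hν.2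
    rw [lintegral_map (measurable_enorm.pow_const p) measurable_snd] at h1
    simpa using h1

omit [BorelSpace X] [SecondCountableTopology X] in
theorem wasserstein_rpow (hp : 0 < p) :
    (wasserstein p μ ν : ℝ) ^ p =
      (⨅ π ∈ Cpl μ ν, ∫⁻ yz, ‖yz.1 - yz.2‖ₑ ^ p ∂π).toReal := by
  unfold wasserstein
  rw [ENNReal.coe_toNNReal_eq_toReal, ENNReal.toReal_rpow, ← ENNReal.rpow_mul,
    one_div_mul_cancel hp.ne', ENNReal.rpow_one]

theorem wasserstein_rpow_le (hp : 0 < p) {π : Measure (X × X)} (hπ : π ∈ Cpl μ ν)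
    (hfin : ∫⁻ yz, ‖yz.1 - yz.2‖ₑ ^ p ∂π ≠ ∞) :
    (wasserstein p μ ν : ℝ) ^ p ≤ ∫ yz, ‖yz.1 - yz.2‖ ^ p ∂π := by
  rw [wasserstein_rpow hp, integral_norm_rpow_comp π measurable_fst_sub_snd hp.le]
  exact ENNReal.toReal_mono hfin (iInf₂_le π hπ)

theorem exists_coupling (hp : 1 ≤ p) (hμ : μ ∈ Pp p) (hν : ν ∈ Pp p) {η : ℝ} (hη : 0 < η) :
    ∃ π ∈ Cpl μ ν, ∫⁻ yz, ‖yz.1 - yz.2‖ₑ ^ p ∂π ≠ ∞ ∧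
      ∫ yz, ‖yz.1 - yz.2‖ ^ p ∂π ≤ (wasserstein p μ ν : ℝ) ^ p + η := by
  have hfin := iInf_cpl_ne_top hp hμ hν
  have hlt := ENNReal.lt_add_right hfin (ENNReal.ofReal_pos.2 hη).ne'
  obtain ⟨π, hlt⟩ := iInf_lt_iff.1 hlt
  obtain ⟨hπ, hlt⟩ := iInf_lt_iff.1 hlt
  refine ⟨π, hπ, hlt.ne_top, ?_⟩
  rw [wasserstein_rpow (by linarith),
    integral_norm_rpow_comp π measurable_fst_sub_snd (by linarith),
    ← ENNReal.toReal_ofReal hη.le, ← ENNReal.toReal_add hfin ENNReal.ofReal_ne_top]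
  exact ENNReal.toReal_mono (ENNReal.add_ne_top.2 ⟨hfin, ENNReal.ofReal_ne_top⟩) hlt.le

theorem wasserstein_self (hp : 0 < p) [IsProbabilityMeasure μ] : wasserstein p μ μ = 0 := by
  have hm : Measurable fun y : X => (y, y) := measurable_id.prodMk measurable_id
  have hmem : μ.map (fun y => (y, y)) ∈ Cpl μ μ := by
    refine ⟨Measure.isProbabilityMeasure_map hm.aemeasurable, ?_, ?_⟩
    · rw [Measure.map_map measurable_fst hm]; exact Measure.map_id
    · rw [Measure.map_map measurable_snd hm]; exact Measure.map_id
  have hzero : ∫⁻ yz, ‖yz.1 - yz.2‖ₑ ^ p ∂(μ.map fun y => (y, y)) = 0 := by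
    rw [lintegral_map (measurable_fst_sub_snd.enorm.pow_const p) hm]
    simp [ENNReal.zero_rpow_of_pos hp]
  have h1 : ⨅ π ∈ Cpl μ μ, ∫⁻ yz, ‖yz.1 - yz.2‖ₑ ^ p ∂π = 0 :=
    nonpos_iff_eq_zero.1 ((iInf₂_le _ hmem).trans hzero.le)
  unfold wasserstein
  rw [h1, ENNReal.zero_rpow_of_pos (by positivity), ENNReal.toNNReal_zero]

/-- Weak duality: moving mass from `μ` to `ν` gains at most the sup-convolution of `u`, up to the
transport cost. -/
theorem integral_le_integral_supConv_add [NormedSpace ℝ X] {K : X →L[ℝ] X} (hp : 1 ≤ p)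
    (hμ : μ ∈ Pp p) (hν : ν ∈ Pp p) {l : ℝ} (hl : 0 ≤ l) {u : X → ℝ} (hu : u ∈ Cb K)
    (hsc : supConv p l u ∈ Cb K) (q : X) :
    ∫ z, u (q + z) ∂ν ≤ ∫ y, supConv p l u (q + y) ∂μ + l * (wasserstein p μ ν : ℝ) ^ p := by
  refine le_of_forall_pos_le_add fun ε hε => ?_
  obtain ⟨π, hπ, hfin, hcost⟩ := exists_coupling hp hμ hν (η := ε / (l + 1)) (by positivity)
  have := hπ.1
  obtain ⟨C, -, hC⟩ := Cb.bounded hu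
  have e1 : ∫ z, u (q + z) ∂ν = ∫ yz, u (q + yz.2) ∂π := by
    rw [← hπ.2.2, integral_map measurable_snd.aemeasurable
      (Cb.measurable_comp_const_add hu q).aestronglyMeasurable]
  have e2 : ∫ y, supConv p l u (q + y) ∂μ = ∫ yz, supConv p l u (q + yz.1) ∂π := by
    rw [← hπ.2.1, integral_map measurable_fst.aemeasurable
      (Cb.measurable_comp_const_add hsc q).aestronglyMeasurable]
  have i1 : Integrable (fun yz : X × X => u (q + yz.2)) π :=
    integrable_of_mem_cb hu (measurable_snd.const_add q)
  have i2 : Integrable (fun yz : X × X => supConv p l u (q + yz.1)) π :=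
    integrable_of_mem_cb hsc (measurable_fst.const_add q)
  have i3 : Integrable (fun yz : X × X => l * ‖yz.1 - yz.2‖ ^ p) π :=
    (integrable_norm_rpow_comp measurable_fst_sub_snd (by linarith) hfin).const_mul l
  have h1 : ∫ yz, u (q + yz.2) ∂π ≤
      ∫ yz, (supConv p l u (q + yz.1) + l * ‖yz.1 - yz.2‖ ^ p) ∂π := by
    refine integral_mono i1 (i2.add i3) fun yz => ?_
    have := le_supConv (p := p) hl (fun x => (abs_le.1 (hC x)).2) (q + yz.1) (yz.2 - yz.1)
    rw [add_assoc, add_sub_cancel, norm_sub_rev] at this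
    simp only
    linarith
  rw [integral_add i2 i3, integral_const_mul] at h1
  have h2 : l * ∫ yz, ‖yz.1 - yz.2‖ ^ p ∂π ≤ l * (wasserstein p μ ν : ℝ) ^ p + ε := by
    calc _ ≤ l * ((wasserstein p μ ν : ℝ) ^ p + ε / (l + 1)) := by gcongr
      _ = l * (wasserstein p μ ν : ℝ) ^ p + l * (ε / (l + 1)) := by ring
      _ ≤ l * (wasserstein p μ ν : ℝ) ^ p + (l + 1) * (ε / (l + 1)) := by gcongr; linarith
      _ = _ := by field_simp
  rw [e1, e2]
  linarith

end Wasserstein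

/-! ### The worst-case operator -/

theorem scaledPenalty_of_pos (c : ℝ≥0) (φ : ℝ≥0 → ℝ≥0∞) {t : ℝ≥0} (ht : 0 < t) (v : ℝ≥0) :
    scaledPenalty c φ t v = t * φ ((Real.exp (-(c * t : ℝ))).toNNReal * (v / t)) := by
  rw [scaledPenalty, if_neg ht.ne']

theorem scaledPenalty_zero_right {p : ℝ} {φ : ℝ≥0 → ℝ≥0∞} (hφ : IsPenalty p φ) (c t : ℝ≥0) :
    scaledPenalty c φ t 0 = 0 := by
  unfold scaledPenalty
  rw [if_pos rfl, zero_div, mul_zero, hφ.zero, mul_zero, ite_self]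

section WorstCase

variable {X : Type*} [NormedAddCommGroup X] [NormedSpace ℝ X] [MeasurableSpace X] [BorelSpace X]
  [SecondCountableTopology X]
  {K : X →L[ℝ] X} {p : ℝ} {c : ℝ≥0} {μ : ℝ≥0 → Measure X} {ψ : ℝ≥0 → X → X} {φ : ℝ≥0 → ℝ≥0∞}

namespace IsReferenceProcess

variable (h : IsReferenceProcess K p c μ ψ)
include h

omit [SecondCountableTopology X] h in
theorem bddAbove_worstCase (t : ℝ≥0) {u : X → ℝ} (hu : u ∈ Cb K) (x : X) :
    BddAbove {r : ℝ | ∃ ν ∈ Pp p, scaledPenalty c φ t (wasserstein p (μ t) ν) ≠ ∞ ∧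
      r = (∫ z, u (ψ t x + z) ∂ν) - (scaledPenalty c φ t (wasserstein p (μ t) ν)).toReal} := by
  obtain ⟨C, -, hC⟩ := Cb.bounded hu
  refine ⟨C, ?_⟩
  rintro _ ⟨ν, hν, -, rfl⟩
  have := hν.1
  have h1 : ∫ z, u (ψ t x + z) ∂ν ≤ ∫ _, C ∂ν :=
    integral_mono (integrable_of_mem_cb hu (measurable_const_add _)) (integrable_const C)
      fun z => (abs_le.1 (hC _)).2
  simp only [integral_const, probReal_univ, one_smul] at h1
  linarith [ENNReal.toReal_nonneg (a := scaledPenalty c φ t (wasserstein p (μ t) ν))]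

omit [SecondCountableTopology X] h in
theorem le_worstCase (ψ : ℝ≥0 → X → X) (t : ℝ≥0) {u : X → ℝ} (hu : u ∈ Cb K) (x : X)
    {ν : Measure X} (hν : ν ∈ Pp p)
    (hfin : scaledPenalty c φ t (wasserstein p (μ t) ν) ≠ ∞) :
    (∫ z, u (ψ t x + z) ∂ν) - (scaledPenalty c φ t (wasserstein p (μ t) ν)).toReal ≤
      worstCase p c φ ψ μ t u x :=
  le_csSup (bddAbove_worstCase t hu x) ⟨ν, hν, hfin, rfl⟩

variable (hφ : IsPenalty p φ)
include hφ

theorem worstCase_le (t : ℝ≥0) {u : X → ℝ} {x : X} {a : ℝ}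
    (H : ∀ ν ∈ Pp p, scaledPenalty c φ t (wasserstein p (μ t) ν) ≠ ∞ →
      ∫ z, u (ψ t x + z) ∂ν ≤ a + (scaledPenalty c φ t (wasserstein p (μ t) ν)).toReal) :
    worstCase p c φ ψ μ t u x ≤ a := by
  have := h.isProbabilityMeasure t
  refine csSup_le ⟨_, μ t, h.mem_Pp t, ?_, rfl⟩ ?_
  · rw [wasserstein_self h.pos, scaledPenalty_zero_right hφ]
    exact ENNReal.zero_ne_top
  · rintro _ ⟨ν, hν, hfin, rfl⟩
    linarith [H ν hν hfin]

theorem refOp_le_worstCase (t : ℝ≥0) {u : X → ℝ} (hu : u ∈ Cb K) (x : X) :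
    refOp ψ μ t u x ≤ worstCase p c φ ψ μ t u x := by
  have := h.isProbabilityMeasure t
  have h1 := le_worstCase (c := c) (φ := φ) (μ := μ) ψ t hu x (h.mem_Pp t)
    (by rw [wasserstein_self h.pos, scaledPenalty_zero_right hφ]; exact ENNReal.zero_ne_top)
  rw [wasserstein_self h.pos, scaledPenalty_zero_right hφ] at h1
  simpa [refOp] using h1

theorem worstCase_mono (t : ℝ≥0) {u v : X → ℝ} (hu : u ∈ Cb K) (hv : v ∈ Cb K)
    (huv : ∀ x, u x ≤ v x) (x : X) : worstCase p c φ ψ μ t u x ≤ worstCase p c φ ψ μ t v x := by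
  refine h.worstCase_le hφ t fun ν hν hfin => ?_
  have := hν.1
  have h1 : ∫ z, u (ψ t x + z) ∂ν ≤ ∫ z, v (ψ t x + z) ∂ν :=
    integral_mono (integrable_of_mem_cb hu (measurable_const_add _))
      (integrable_of_mem_cb hv (measurable_const_add _)) fun z => huv _
  linarith [le_worstCase ψ t hv x hν hfin]

theorem worstCase_le_of_lipWith (t : ℝ≥0) {u : X → ℝ} (hu : u ∈ Lipb K) {L : ℝ}
    (hL : LipWith K L u) :
    LipWith K (Real.exp (c * t) * L) (worstCase p c φ ψ μ t u) := by
  refine LipWith.of_sub_le (mul_nonneg (Real.exp_pos _).le hL.1) fun x y => ?_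
  rw [sub_le_iff_le_add']
  refine h.worstCase_le hφ t fun ν hν hfin => ?_
  have := hν.1
  have hu' := lipb_subset_cb hu
  have h1 := integral_le_integral_add_const (ν := ν) (a := Real.exp (c * t) * L * ‖K (x - y)‖)
    (integrable_of_mem_cb hu' (measurable_const_add (ψ t x)))
    (integrable_of_mem_cb hu' (measurable_const_add (ψ t y))) fun z => by
      have h1 := (abs_le.1 (hL.2 (ψ t x + z) (ψ t y + z))).2
      rw [add_sub_add_right_eq_sub] at h1
      have h2 := mul_le_mul_of_nonneg_left (h.norm_map_flow_sub_le t x y) hL.1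
      linarith
  linarith [le_worstCase ψ t hu' y hν hfin]

theorem worstCase_convex (t : ℝ≥0) {u v : X → ℝ} (hu : u ∈ Cb K) (hv : v ∈ Cb K) {θ : ℝ}
    (h0 : 0 ≤ θ) (h1 : θ ≤ 1) (x : X) :
    worstCase p c φ ψ μ t (fun y => (1 - θ) * u y + θ * v y) x ≤
      (1 - θ) * worstCase p c φ ψ μ t u x + θ * worstCase p c φ ψ μ t v x := by
  refine h.worstCase_le hφ t fun ν hν hfin => ?_
  have := hν.1
  have iu : Integrable (fun z => (1 - θ) * u (ψ t x + z)) ν :=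
    (integrable_of_mem_cb hu (measurable_const_add _)).const_mul _
  have iv : Integrable (fun z => θ * v (ψ t x + z)) ν :=
    (integrable_of_mem_cb hv (measurable_const_add _)).const_mul _
  rw [integral_add iu iv, integral_const_mul, integral_const_mul]
  have hθ : 0 ≤ 1 - θ := by linarith
  have k1 := mul_le_mul_of_nonneg_left (le_worstCase ψ t hu x hν hfin) hθ
  have k2 := mul_le_mul_of_nonneg_left (le_worstCase ψ t hv x hν hfin) h0
  linarith

theorem worstCase_const (t : ℝ≥0) (a : ℝ) :
    worstCase p c φ ψ μ t (fun _ => a) = fun _ => a := by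
  have := h.isProbabilityMeasure t
  funext x
  refine le_antisymm (h.worstCase_le hφ t fun ν hν _ => ?_) ?_
  · have := hν.1
    simp
  · have := h.refOp_le_worstCase hφ t (Cb.const (K := K) a) x
    rwa [h.refOp_const] at this

theorem worstCase_add_const_le (t : ℝ≥0) {u : X → ℝ} (hu : u ∈ Cb K) (a : ℝ) (x : X) :
    worstCase p c φ ψ μ t (fun y => u y + a) x ≤ worstCase p c φ ψ μ t u x + a := by
  refine h.worstCase_le hφ t fun ν hν hfin => ?_
  have := hν.1
  rw [integral_add (integrable_of_mem_cb hu (measurable_const_add _)) (integrable_const a)]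
  simp only [integral_const, probReal_univ, one_smul]
  linarith [le_worstCase ψ t hu x hν hfin]

theorem worstCase_lipb (t : ℝ≥0) {u : X → ℝ} (hu : u ∈ Lipb K) :
    worstCase p c φ ψ μ t u ∈ Lipb K := by
  obtain ⟨C, -, hC⟩ := Lipb.bounded hu
  obtain ⟨L, hL⟩ := hu.1
  exact ⟨⟨_, h.worstCase_le_of_lipWith hφ t hu hL⟩, C, abs_le_of_mono_of_const
    (fun v hv w hw hvw => h.worstCase_mono hφ t hv hw hvw) (h.worstCase_const hφ t)
    (lipb_subset_cb hu) hC⟩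

/-- At time zero only the measures `ν` at Wasserstein distance zero from `μ 0` contribute, and these
integrate functions in `Cb K` in the same way as `μ 0`. -/
theorem worstCase_zero {u : X → ℝ} (hu : u ∈ Cb K) : worstCase p c φ ψ μ 0 u = u := by
  have hlow : ∀ x, u x ≤ worstCase p c φ ψ μ 0 u x := fun x => by
    have := h.refOp_le_worstCase hφ 0 hu x
    rwa [h.refOp_zero hu] at this
  funext x
  refine le_antisymm (h.worstCase_le hφ 0 fun ν hν hfin => ?_) (hlow x)
  have hW : wasserstein p (μ 0) ν = 0 := by
    by_contra hne
    exact hfin (by rw [scaledPenalty, if_pos rfl, if_neg hne])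
  refine le_trans ?_ (le_add_of_nonneg_right ENNReal.toReal_nonneg)
  have := hν.1
  -- first for Lipschitz functions, by weak duality with large coefficients
  have hlip : ∀ v ∈ Lipb K, ∫ z, v (ψ 0 x + z) ∂ν ≤ v x := by
    intro v hv
    obtain ⟨C, -, hC⟩ := Lipb.bounded hv
    obtain ⟨L, hL⟩ := hv.1
    have hv' := lipb_subset_cb hv
    refine le_of_forall_pos_le_add fun ε hε => ?_
    obtain ⟨A, hA, hAs⟩ := exists_mul_le_add_mul_rpow h.one_lt hL.1 hε
    have hsc := lipb_subset_cb (supConv_mem_lipb (l := A) h.pos hA.le hv)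
    have h1 := integral_le_integral_supConv_add h.one_lt.le (h.mem_Pp 0) hν hA.le hv' hsc (ψ 0 x)
    rw [hW, NNReal.coe_zero, Real.zero_rpow h.pos.ne', mul_zero, add_zero] at h1
    have := h.isProbabilityMeasure 0
    have h2 := integral_le_integral_add_const (a := ε) (h.integrable 0 hsc (ψ 0 x))
      (h.integrable 0 hv' (ψ 0 x)) fun y => supConv_le fun d => by
        have e1 := (abs_le.1 (hL.lipschitz h.norm_le (ψ 0 x + y + d) (ψ 0 x + y))).2
        rw [add_sub_cancel_left] at e1
        linarith [hAs ‖d‖ (norm_nonneg d)]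
    have h3 := congrFun (h.refOp_zero hv') x
    rw [refOp] at h3
    linarith
  obtain ⟨v, hv, hconv⟩ := hu
  rw [locConv_iff] at hconv
  obtain ⟨⟨C, hC⟩, hconv⟩ := hconv
  have hpt : ∀ y, Tendsto (fun n => v n y) atTop (𝓝 (u y)) := fun y => by
    rw [Metric.tendsto_nhds]
    intro ε hε
    filter_upwards [hconv ‖y‖ (ε / 2) (half_pos hε)] with n hn
    exact (hn y le_rfl).trans_lt (half_lt_self hε)
  refine le_of_tendsto_of_tendsto' (tendsto_integral_filter_of_dominated_convergence (fun _ => C)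
    (Eventually.of_forall fun n => ?_) (hC.mono fun n hn => Eventually.of_forall fun y => hn _)
    (integrable_const C) (Eventually.of_forall fun y => hpt _)) (hpt x) fun n => hlip _ (hv n)
  exact (integrable_of_mem_cb (lipb_subset_cb (hv n))
    (measurable_const_add (ψ 0 x))).aestronglyMeasurable

/-- Weak duality for the worst-case operator. -/
theorem worstCase_le_refOp_supConv {t : ℝ≥0} (ht : 0 < t) {m a : ℝ} (hm : 0 ≤ m)
    (hma : IsConjBound p φ m a) {u : X → ℝ} (hu : u ∈ Cb K)
    (hsc : supConv p (rate p c t m) u ∈ Cb K) (x : X) :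
    worstCase p c φ ψ μ t u x ≤ refOp ψ μ t (supConv p (rate p c t m) u) x + t * a := by
  refine h.worstCase_le hφ t fun ν hν hfin => ?_
  have h1 := integral_le_integral_supConv_add h.one_lt.le (h.mem_Pp t) hν
    (rate_nonneg p c t hm) hu hsc (ψ t x)
  rw [scaledPenalty_of_pos c φ ht] at hfin ⊢
  have ht' : (t : ℝ≥0∞) ≠ 0 := by simpa using ht.ne'
  have h2 := hma _ fun htop => hfin (by rw [htop, ENNReal.mul_top ht'])
  rw [NNReal.coe_mul, Real.coe_toNNReal _ (Real.exp_pos _).le, NNReal.coe_div] at h2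
  have h3 := mul_le_mul_of_nonneg_left h2 t.coe_nonneg
  rw [← rate_mul_rpow _ _ _ _ (NNReal.coe_nonneg _)] at h3
  rw [ENNReal.toReal_mul, ENNReal.coe_toReal]
  rw [refOp]
  linarith

/-- For a Lipschitz function the worst-case operator exceeds the reference semigroup by at most a
multiple of the time. -/
theorem exists_worstCase_le_refOp_add (L : ℝ) :
    ∃ a : ℝ, 0 ≤ a ∧ ∀ t ≤ 1, ∀ u ∈ Lipb K, LipWith K L u →
      ∀ x, worstCase p c φ ψ μ t u x ≤ refOp ψ μ t u x + t * a := by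
  rcases lt_or_ge L 0 with hL | hL
  · exact ⟨0, le_rfl, fun t _ u _ hu => absurd hu.1 (not_le.2 hL)⟩
  obtain ⟨m, a, hm, ha, hma⟩ := hφ.exists_conjBound h.pos
  obtain ⟨b, hb, hbs⟩ := exists_mul_le_const_add h.one_lt
    (mul_nonneg hL (Real.exp_pos c).le) hm
  refine ⟨a + b, add_nonneg ha hb, fun t ht1 u hu huL x => ?_⟩
  have hu' := lipb_subset_cb hu
  rcases eq_zero_or_pos t with rfl | ht
  · simp [h.worstCase_zero hφ hu', h.refOp_zero hu']
  have ht' : (0 : ℝ) < t := ht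
  have hsc := lipb_subset_cb (supConv_mem_lipb h.pos (rate_nonneg p c t hm.le) hu)
  have h1 := h.worstCase_le_refOp_supConv hφ ht hm.le hma hu' hsc x
  have := h.isProbabilityMeasure t
  have h2 := integral_le_integral_add_const (a := t * b) (h.integrable t hsc (ψ t x))
    (h.integrable t hu' (ψ t x)) fun y => supConv_le fun d => by
      have e1 := (abs_le.1 (huL.lipschitz h.norm_le (ψ t x + y + d) (ψ t x + y))).2
      rw [add_sub_cancel_left] at e1
      rw [rate_mul_rpow _ _ _ _ (norm_nonneg d)]
      have e2 := mul_le_mul_of_nonneg_left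
        (hbs (Real.exp (-(c * t)) * (‖d‖ / t)) (by positivity)) ht'.le
      have e3 : L * ‖d‖ ≤ t * (L * Real.exp c * (Real.exp (-(c * t)) * (‖d‖ / t))) := by
        have k1 : t * (L * Real.exp c * (Real.exp (-(c * t)) * (‖d‖ / t))) =
            L * ‖d‖ * Real.exp (c - c * t) := by
          rw [sub_eq_add_neg, Real.exp_add]
          field_simp
        have k2 : 1 ≤ Real.exp (c - c * t) := by
          rw [Real.one_le_exp_iff]
          have : (c : ℝ) * t ≤ c * 1 := by gcongr; exact_mod_cast ht1
          linarith
        rw [k1]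
        have : 0 ≤ L * ‖d‖ := by positivity
        nlinarith
      rw [mul_add] at e2
      linarith
  rw [refOp] at h1 ⊢
  linarith

end IsReferenceProcess

end WorstCase


/-! ### Strong duality -/

section Selection

variable {X : Type*} [NormedAddCommGroup X] [MeasurableSpace X] [BorelSpace X]
  [SecondCountableTopology X]

/-- Near-optimal displacements in the sup-convolution can be chosen as simple functions: take the
best of finitely many points of a dense sequence. -/
theorem integral_supConv_le_of_forall_simpleFunc {ν : Measure X} [IsProbabilityMeasure ν]
    {p l : ℝ} (hp : 0 < p) (hl : 0 ≤ l) {u : X → ℝ} (hu : Continuous u) {C : ℝ}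
    (hC : ∀ x, |u x| ≤ C) (q : X) {B : ℝ}
    (H : ∀ D : SimpleFunc X X, ∫ y, (u (q + y + D y) - l * ‖D y‖ ^ p) ∂ν ≤ B) :
    ∫ y, supConv p l u (q + y) ∂ν ≤ B := by
  set f : X → X → ℝ := fun y d => u (q + y + d) - l * ‖d‖ ^ p with hf
  have hfm : ∀ {g : X → X}, Measurable g → Measurable fun y => f y (g y) := fun hg =>
    (hu.measurable.comp ((measurable_const_add q).add hg)).sub
      ((hg.norm.pow_const p).const_mul l)
  have hfc : ∀ y, Continuous (f y) := fun y =>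
    (hu.comp (continuous_const.add continuous_id)).sub
      (continuous_const.mul (continuous_norm.rpow_const fun _ => Or.inr hp.le))
  have hstep : ∀ (D : SimpleFunc X X) (d : X), ∃ D' : SimpleFunc X X,
      ∀ y, f y (D' y) = max (f y (D y)) (f y d) := by
    intro D d
    have hs : MeasurableSet {y | f y (D y) < f y d} :=
      measurableSet_lt (hfm D.measurable) (hfm measurable_const)
    refine ⟨SimpleFunc.piecewise _ hs (SimpleFunc.const X d) D, fun y => ?_⟩
    rw [SimpleFunc.piecewise_apply]
    split_ifs with h
    · rw [SimpleFunc.const_apply, max_eq_right (le_of_lt h)]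
    · rw [max_eq_left (not_lt.1 h)]
  choose step hstep using hstep
  let e := TopologicalSpace.denseSeq X
  let D : ℕ → SimpleFunc X X := fun n =>
    Nat.rec (SimpleFunc.const X 0) (fun k Dk => step Dk (e k)) n
  have hD0 : ∀ y, f y (D 0 y) = u (q + y) := fun y => by
    simp [hf, D, Real.zero_rpow hp.ne']
  have hDs : ∀ n y, f y (D (n + 1) y) = max (f y (D n y)) (f y (e n)) := fun n y => hstep _ _ y
  have hmono : ∀ y, Monotone fun n => f y (D n y) := fun y =>
    monotone_nat_of_le_succ fun n => by rw [hDs]; exact le_max_left _ _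
  have hle : ∀ n y, f y (D n y) ≤ supConv p l u (q + y) := fun n y =>
    le_supConv hl (fun x => (abs_le.1 (hC x)).2) (q + y) (D n y)
  have hlim : ∀ y, Tendsto (fun n => f y (D n y)) atTop (𝓝 (supConv p l u (q + y))) := fun y => by
    refine tendsto_order.2 ⟨fun a ha => ?_, fun a ha => Eventually.of_forall fun n =>
      (hle n y).trans_lt ha⟩
    obtain ⟨d, hd⟩ := exists_lt_of_lt_ciSup ha
    obtain ⟨k, hk⟩ := (TopologicalSpace.denseRange_denseSeq X).exists_mem_open
      (isOpen_lt continuous_const (hfc y)) ⟨d, hd⟩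
    filter_upwards [eventually_ge_atTop (k + 1)] with n hn
    have h1 : f y (e k) ≤ f y (D (k + 1) y) := by rw [hDs]; exact le_max_right _ _
    exact lt_of_lt_of_le hk (h1.trans (hmono y hn))
  refine le_of_tendsto' (tendsto_integral_of_dominated_convergence (fun _ => C) (fun n => ?_)
    (integrable_const C) (fun n => Eventually.of_forall fun y => ?_)
    (Eventually.of_forall hlim)) fun n => H (D n)
  · exact (hfm (D n).measurable).aestronglyMeasurable
  · rw [Real.norm_eq_abs, abs_le]
    have h1 := hmono y (Nat.zero_le n)
    simp only [hD0] at h1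
    exact ⟨(abs_le.1 (hC _)).1.trans h1,
      (hle n y).trans (supConv_le_bound hl (fun x => (abs_le.1 (hC x)).2) _)⟩

end Selection

section StrongDuality

variable {X : Type*} [NormedAddCommGroup X] [NormedSpace ℝ X] [MeasurableSpace X] [BorelSpace X]
  [SecondCountableTopology X]
  {K : X →L[ℝ] X} {p : ℝ} {c : ℝ≥0} {μ : ℝ≥0 → Measure X} {ψ : ℝ≥0 → X → X} {φ : ℝ≥0 → ℝ≥0∞}

/-- The pairs `(b, e)` for which some joint law `π` of `(Y, D)` with `Y ∼ μ` satisfies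
`s E‖D‖ ^ p ≤ b` and `t e ≤ E u(q + Y + D)`. -/
def gainSet (p s t : ℝ) (μ : Measure X) (u : X → ℝ) (q : X) : Set (ℝ × ℝ) :=
  {x | ∃ π : Measure (X × X), IsProbabilityMeasure π ∧ π.map Prod.fst = μ ∧
    ∫⁻ yd, ‖yd.2‖ₑ ^ p ∂π ≠ ∞ ∧ s * ∫ yd, ‖yd.2‖ ^ p ∂π ≤ x.1 ∧
    t * x.2 ≤ ∫ yd, u (q + yd.1 + yd.2) ∂π}

theorem integrable_add_of_mem_cb {π : Measure (X × X)} [IsFiniteMeasure π] {u : X → ℝ}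
    (hu : u ∈ Cb K) (q : X) : Integrable (fun yd : X × X => u (q + yd.1 + yd.2)) π :=
  integrable_of_mem_cb hu ((measurable_fst.const_add q).add measurable_snd)

theorem convex_gainSet {s t : ℝ} (hp : 0 ≤ p) {ν : Measure X}
    {u : X → ℝ} (hu : u ∈ Cb K) (q : X) : Convex ℝ (gainSet p s t ν u q) := by
  rintro ⟨b₁, e₁⟩ ⟨π₁, hπ₁, hm₁, hf₁, hb₁, he₁⟩ ⟨b₂, e₂⟩ ⟨π₂, hπ₂, hm₂, hf₂, hb₂, he₂⟩ α β hα hβ hαβ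
  have hsum : ENNReal.ofReal α + ENNReal.ofReal β = 1 := by
    rw [← ENNReal.ofReal_add hα hβ, hαβ, ENNReal.ofReal_one]
  have i₁ := integrable_norm_rpow_comp measurable_snd hp hf₁
  have i₂ := integrable_norm_rpow_comp measurable_snd hp hf₂
  have j₁ := integrable_add_of_mem_cb (π := π₁) hu q
  have j₂ := integrable_add_of_mem_cb (π := π₂) hu q
  simp only at hb₁ he₁ hb₂ he₂
  refine ⟨ENNReal.ofReal α • π₁ + ENNReal.ofReal β • π₂, ⟨?_⟩, ?_, ?_, ?_, ?_⟩
  · simp [hsum]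
  · rw [Measure.map_add _ _ measurable_fst, Measure.map_smul, Measure.map_smul, hm₁, hm₂,
      ← add_smul, hsum, one_smul]
  · rw [lintegral_add_measure, lintegral_smul_measure, lintegral_smul_measure]
    exact ENNReal.add_ne_top.2 ⟨ENNReal.mul_ne_top ENNReal.ofReal_ne_top hf₁,
      ENNReal.mul_ne_top ENNReal.ofReal_ne_top hf₂⟩
  · rw [integral_add_measure (i₁.smul_measure ENNReal.ofReal_ne_top)
      (i₂.smul_measure ENNReal.ofReal_ne_top), integral_smul_measure, integral_smul_measure,
      ENNReal.toReal_ofReal hα, ENNReal.toReal_ofReal hβ]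
    simp only [Prod.smul_mk, Prod.mk_add_mk, smul_eq_mul]
    have k1 := mul_le_mul_of_nonneg_left hb₁ hα
    have k2 := mul_le_mul_of_nonneg_left hb₂ hβ
    linarith
  · rw [integral_add_measure (j₁.smul_measure ENNReal.ofReal_ne_top)
      (j₂.smul_measure ENNReal.ofReal_ne_top), integral_smul_measure, integral_smul_measure,
      ENNReal.toReal_ofReal hα, ENNReal.toReal_ofReal hβ]
    simp only [Prod.smul_mk, Prod.mk_add_mk, smul_eq_mul]
    have k1 := mul_le_mul_of_nonneg_left he₁ hα
    have k2 := mul_le_mul_of_nonneg_left he₂ hβ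
    linarith

theorem mem_gainSet_of_simpleFunc {s t : ℝ} (hp : 0 ≤ p) (ht : t ≠ 0) {ν : Measure X}
    [IsProbabilityMeasure ν] {u : X → ℝ} (hu : u ∈ Cb K) (q : X) (D : SimpleFunc X X) :
    Integrable (fun y => ‖D y‖ ^ p) ν ∧
    (s * ∫ y, ‖D y‖ ^ p ∂ν, t⁻¹ * ∫ y, u (q + y + D y) ∂ν) ∈ gainSet p s t ν u q := by
  have hm : Measurable fun y => (y, D y) := measurable_id.prodMk D.measurable
  obtain ⟨C, hC⟩ := D.exists_forall_norm_le
  have hfin : ∫⁻ y, ‖D y‖ₑ ^ p ∂ν ≠ ∞ := by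
    have hb : ∀ y, ‖D y‖ₑ ^ p ≤ ENNReal.ofReal C ^ p := fun y =>
      ENNReal.rpow_le_rpow (by rw [← ofReal_norm]; exact ENNReal.ofReal_le_ofReal (hC y)) hp
    refine ((lintegral_mono hb).trans_lt ?_).ne
    rw [lintegral_const, measure_univ, mul_one]
    exact ENNReal.rpow_lt_top_of_nonneg hp ENNReal.ofReal_ne_top
  refine ⟨integrable_norm_rpow_comp D.measurable hp hfin, ν.map fun y => (y, D y),
    Measure.isProbabilityMeasure_map hm.aemeasurable, ?_, ?_, ?_, ?_⟩
  · rw [Measure.map_map measurable_fst hm]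
    exact Measure.map_id
  · rwa [lintegral_map (measurable_snd.enorm.pow_const p) hm]
  · rw [integral_map hm.aemeasurable (measurable_snd.norm.pow_const p).aestronglyMeasurable]
  · have := Measure.isProbabilityMeasure_map (μ := ν) hm.aemeasurable
    rw [integral_map hm.aemeasurable (integrable_add_of_mem_cb hu q).aestronglyMeasurable]
    simp only
    rw [mul_inv_cancel_left₀ ht]

namespace IsReferenceProcess

variable (h : IsReferenceProcess K p c μ ψ) (hφ : IsPenalty p φ)
include h hφ

/-- The law `ν` of `Y + D` is a competitor in the worst-case operator: the joint law of `Y` and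
`Y + D` is a coupling, so that the cost of `D` bounds the Wasserstein distance. -/
theorem le_of_mem_gainSet {t : ℝ≥0} (ht : 0 < t) {u : X → ℝ} (hu : u ∈ Cb K) (x : X) {v : ℝ≥0}
    {e : ℝ} (hmem : ((v : ℝ) ^ p, e) ∈
      gainSet p ((Real.exp (-(c * t)) / t) ^ p) t (μ t) u (ψ t x))
    (hv : φ v ≠ ∞) : e ≤ worstCase p c φ ψ μ t u x / t + (φ v).toReal := by
  obtain ⟨π, hπ, hm, hfin, hb, he⟩ := hmem
  simp only at hb he
  have hp := h.pos
  have ht' : (0 : ℝ) < t := ht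
  have hadd : Measurable fun yd : X × X => yd.1 + yd.2 := measurable_fst.add measurable_snd
  have hpair : Measurable fun yd : X × X => (yd.1, yd.1 + yd.2) := measurable_fst.prodMk hadd
  set ν := π.map (fun yd => yd.1 + yd.2) with hν
  have hνP : ν ∈ Pp p := by
    refine ⟨Measure.isProbabilityMeasure_map hadd.aemeasurable, ?_⟩
    rw [hν, lintegral_map (measurable_enorm.pow_const p) hadd]
    refine lintegral_enorm_add_rpow_lt_top measurable_fst h.one_lt.le ?_ hfin.lt_top
    have := (h.mem_Pp t).2
    rwa [← hm, lintegral_map (measurable_enorm.pow_const p) measurable_fst] at this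
  have hcpl : π.map (fun yd => (yd.1, yd.1 + yd.2)) ∈ Cpl (μ t) ν := by
    refine ⟨Measure.isProbabilityMeasure_map hpair.aemeasurable, ?_, ?_⟩
    · rw [Measure.map_map measurable_fst hpair, ← hm]
      rfl
    · rw [Measure.map_map measurable_snd hpair]
      rfl
  have hW : (wasserstein p (μ t) ν : ℝ) ^ p ≤ ∫ yd, ‖yd.2‖ ^ p ∂π := by
    refine (wasserstein_rpow_le hp hcpl ?_).trans_eq ?_
    · rw [lintegral_map (measurable_fst_sub_snd.enorm.pow_const p) hpair]
      simpa using hfin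
    · rw [integral_map hpair.aemeasurable
        (measurable_fst_sub_snd.norm.pow_const p).aestronglyMeasurable]
      simp
  have harg : (Real.exp (-(c * t : ℝ))).toNNReal * (wasserstein p (μ t) ν / t) ≤ v := by
    rw [← NNReal.coe_le_coe, ← Real.rpow_le_rpow_iff (NNReal.coe_nonneg _) (NNReal.coe_nonneg _) hp,
      NNReal.coe_mul, Real.coe_toNNReal _ (Real.exp_pos _).le, NNReal.coe_div, mul_div_left_comm,
      mul_comm, Real.mul_rpow (by positivity) (NNReal.coe_nonneg _)]
    exact (mul_le_mul_of_nonneg_left hW (by positivity)).trans hb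
  have hφle := hφ.mono hp harg
  have hφfin := ne_top_of_le_ne_top hv hφle
  have hval := le_worstCase (c := c) (φ := φ) (μ := μ) ψ t hu x hνP (by
    rw [scaledPenalty_of_pos c φ ht]
    exact ENNReal.mul_ne_top ENNReal.coe_ne_top hφfin)
  rw [scaledPenalty_of_pos c φ ht, ENNReal.toReal_mul, ENNReal.coe_toReal, hν,
    integral_map hadd.aemeasurable (Cb.measurable_comp_const_add hu _).aestronglyMeasurable,
    ← hν] at hval
  simp only [← add_assoc] at hval
  have h1 : (t : ℝ) * (φ ((Real.exp (-(c * t : ℝ))).toNNReal *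
      (wasserstein p (μ t) ν / t))).toReal ≤ t * (φ v).toReal := by
    gcongr
  have h2 : (t : ℝ) * e ≤ t * (worstCase p c φ ψ μ t u x / t + (φ v).toReal) := by
    rw [mul_add, mul_div_cancel₀ _ ht'.ne']
    linarith
  exact le_of_mul_le_mul_left h2 ht'

/-- Strong duality for the worst-case operator on Lipschitz functions. The gain set is separated
from `φ` by a line, and membership of the simple displacements in the gain set turns the line into a
bound for the sup-convolution. -/
theorem exists_refOp_supConv_le {t : ℝ≥0} (ht : 0 < t) {u : X → ℝ} (hu : u ∈ Lipb K) (x : X)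
    {ε : ℝ} (hε : 0 < ε) :
    ∃ m a : ℝ, 0 ≤ m ∧ IsConjBound p φ m a ∧
      refOp ψ μ t (supConv p (rate p c t m) u) x + t * a ≤ worstCase p c φ ψ μ t u x + ε := by
  have hp := h.pos
  have ht' : (0 : ℝ) < t := ht
  have := h.isProbabilityMeasure t
  have hu' := lipb_subset_cb hu
  obtain ⟨C, -, hC⟩ := Lipb.bounded hu
  obtain ⟨L, hL⟩ := hu.1
  set s : ℝ := (Real.exp (-(c * t)) / t) ^ p with hs
  have hs0 : 0 < s := by positivity
  set I := worstCase p c φ ψ μ t u x with hI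
  set q := ψ t x with hq
  have hTI : refOp ψ μ t u x ≤ I := h.refOp_le_worstCase hφ t hu' x
  obtain ⟨A, hA, hAs⟩ := exists_mul_le_add_mul_rpow h.one_lt hL.1 hε
  obtain ⟨m, a, hm, hma, hG⟩ := hφ.exists_conjBound_of_hypograph hp
    (convex_gainSet (t := t) (ν := μ t) hp.le hu' q) (M := I / t) (ε := ε / t)
    (fun b e ⟨π, h1, h2, h3, h4, h5⟩ b' hbb => ⟨π, h1, h2, h3, h4.trans hbb, h5⟩)
    (by
      have := (mem_gainSet_of_simpleFunc (s := s) hp.le ht'.ne' (ν := μ t) hu' q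
        (SimpleFunc.const X 0)).2
      simp only [SimpleFunc.coe_const, Function.const_apply, norm_zero, Real.zero_rpow hp.ne',
        integral_zero, mul_zero] at this
      exact ⟨_, this⟩)
    (fun v e hmem hv => h.le_of_mem_gainSet hφ ht hu' x hmem hv) (by positivity)
    ⟨A / s / t, by positivity, by
      rintro b e ⟨π, hπ, hm, hfin, hb, he⟩
      simp only at hb he
      have i1 : Integrable (fun yd : X × X => u (q + yd.1)) π :=
        integrable_of_mem_cb hu' (measurable_fst.const_add q)
      have i2 := (integrable_norm_rpow_comp measurable_snd hp.le hfin).const_mul A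
      have h1 := integral_le_integral_add_const (a := ε) (integrable_add_of_mem_cb (π := π) hu' q)
        (i1.add i2) fun yd => by
          have e1 := (abs_le.1 (hL.lipschitz h.norm_le (q + yd.1 + yd.2) (q + yd.1))).2
          rw [add_sub_cancel_left] at e1
          simp only [Pi.add_apply]
          linarith [hAs ‖yd.2‖ (norm_nonneg _)]
      have h2 : ∫ yd, u (q + yd.1) ∂π = refOp ψ μ t u x := by
        rw [refOp, ← hm, integral_map measurable_fst.aemeasurable
          (Cb.measurable_comp_const_add hu' _).aestronglyMeasurable]
      simp only [Pi.add_apply] at h1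
      rw [integral_add i1 i2, integral_const_mul, h2] at h1
      have h3 : A * ∫ yd, ‖yd.2‖ ^ p ∂π ≤ A / s * b := by
        rw [div_mul_eq_mul_div, le_div_iff₀ hs0, mul_assoc]
        gcongr
        linarith
      have h4 : (t : ℝ) * e ≤ t * (I / t + ε / t + A / s / t * b) := by
        have : (t : ℝ) * (I / t + ε / t + A / s / t * b) = I + ε + A / s * b := by field_simp
        rw [this]
        linarith
      exact le_of_mul_le_mul_left h4 ht'⟩
  refine ⟨m, a, hm, hma, ?_⟩
  have hB : refOp ψ μ t (supConv p (rate p c t m) u) x ≤ I + ε - t * a := by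
    refine integral_supConv_le_of_forall_simpleFunc hp (rate_nonneg p c t hm)
      (Cb.continuous hu') hC q fun D => ?_
    obtain ⟨hDi, hDm⟩ := mem_gainSet_of_simpleFunc (s := s) hp.le ht'.ne' (ν := μ t) hu' q D
    have h1 := hG _ _ hDm
    have h2 := mul_le_mul_of_nonneg_left h1 ht'.le
    rw [mul_inv_cancel_left₀ ht'.ne'] at h2
    have hint : Integrable (fun y => u (q + y + D y)) (μ t) :=
      integrable_of_mem_cb hu' ((measurable_const_add q).add D.measurable)
    rw [integral_sub hint (hDi.const_mul _), integral_const_mul]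
    have h3 : (t : ℝ) * (I / t + ε / t - a + m * (s * ∫ y, ‖D y‖ ^ p ∂(μ t))) =
        I + ε - t * a + rate p c t m * ∫ y, ‖D y‖ ^ p ∂(μ t) := by
      rw [rate, ← hs]
      field_simp
    linarith
  linarith

end IsReferenceProcess

end StrongDuality


/-! ### The worst-case operators form a generating family -/

section GeneratingFamily

variable {X : Type*} [NormedAddCommGroup X] [NormedSpace ℝ X] [MeasurableSpace X] [BorelSpace X]
  [SecondCountableTopology X]
  {K : X →L[ℝ] X} {p : ℝ} {c : ℝ≥0} {μ : ℝ≥0 → Measure X} {ψ : ℝ≥0 → X → X} {φ : ℝ≥0 → ℝ≥0∞}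

namespace IsReferenceProcess

variable (h : IsReferenceProcess K p c μ ψ) (hφ : IsPenalty p φ)
include h hφ

/-- By weak duality with a fixed line below `φ`, the tails of the worst-case operators are those of
the reference semigroup after a sup-convolution, up to the constant of the line. -/
theorem worstCase_tail (s : ℝ≥0) (r : ℝ) : ∃ B : ℝ, 0 ≤ B ∧ ∀ C : ℝ, ∃ R : ℝ, ∀ t ≤ s, ∀ w ∈ Cb K,
    ∀ a : ℝ, |a| ≤ C → (∀ x, w x ≤ C) → (∀ x, ‖x‖ ≤ R → w x ≤ a) →
      ∀ x, ‖x‖ ≤ r → worstCase p c φ ψ μ t w x ≤ a + B := by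
  obtain ⟨m, k, hm, hk, hmk⟩ := hφ.exists_conjBound h.pos
  refine ⟨1 + s * k, by positivity, fun C => ?_⟩
  -- the penalty for the time `s + 1` bounds the penalties for all `t ≤ s` from below
  have hl : 0 < rate p c (s + 1) m := rate_pos p c (by positivity) hm
  obtain ⟨R₀, hR₀, hR₀C⟩ := exists_radius h.pos hl (2 * C)
  obtain ⟨R₁, hR₁⟩ := h.tailBound s r (2 * C) 1 one_pos
  refine ⟨max r (R₁ + R₀), fun t ht w hw a ha hwC hwR x hx => ?_⟩
  rcases eq_zero_or_pos t with rfl | ht0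
  · rw [h.worstCase_zero hφ hw]
    have := hwR x (hx.trans (le_max_left _ _))
    have : 0 ≤ (s : ℝ) * k := by positivity
    linarith
  have hrate := rate_antitone h.one_lt.le c ht0
    (ht.trans (le_add_of_nonneg_right zero_le_one)) hm.le
  have hpos := hl.trans_le hrate
  have hsc := supConv_mem_cb h.pos hpos hw
  have h1 := h.worstCase_le_refOp_supConv hφ ht0 hm.le hmk hw hsc x
  rw [abs_le] at ha
  have h2 := hR₁ t ht _ (Cb.sub_const hsc a)
    (fun y => by linarith [supConv_le_bound (p := p) hpos.le hwC y])
    (fun y hy => by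
      have := supConv_le_of_le_on_ball h.pos hl hrate hR₀ hR₀C ha.1 hwC
        (fun z hz => hwR z (hz.trans (le_max_right _ _))) hy
      linarith) x hx
  rw [h.refOp_sub t hsc (Cb.const a), h.refOp_const] at h2
  have h3 : (t : ℝ) * k ≤ s * k := by gcongr
  linarith

theorem worstCase_modulus (t : ℝ≥0) (r C : ℝ) {ε : ℝ} (hε : 0 < ε) :
    ∃ R : ℝ, ∃ δ > 0, ∀ u ∈ Cb K, ∀ v ∈ Cb K,
      (∀ x, |u x| ≤ C) → (∀ x, |v x| ≤ C) → (∀ x, ‖x‖ ≤ R → |u x - v x| ≤ δ) →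
      ∀ x, ‖x‖ ≤ r → |worstCase p c φ ψ μ t u x - worstCase p c φ ψ μ t v x| ≤ ε := by
  obtain ⟨B, hB, htail⟩ := h.worstCase_tail hφ t r
  obtain ⟨R, δ, hδ, H⟩ := exists_modulus_of_tail (K := K) (𝓕 := {worstCase p c φ ψ μ t})
    (by rintro _ rfl u hu v hv huv; exact h.worstCase_mono hφ t hu hv huv)
    (by rintro _ rfl u hu v hv θ h0 h1; exact h.worstCase_convex hφ t hu hv h0 h1)
    (by rintro _ rfl; exact h.worstCase_const hφ t) hB
    (fun C' => by
      obtain ⟨R, hR⟩ := htail C'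
      exact ⟨R, by rintro _ rfl; exact hR t le_rfl⟩) C hε
  exact ⟨R, δ, hδ, H _ rfl⟩

theorem worstCase_abs_le (t : ℝ≥0) {u : X → ℝ} (hu : u ∈ Cb K) {C : ℝ} (hC : ∀ x, |u x| ≤ C)
    (x : X) : |worstCase p c φ ψ μ t u x| ≤ C :=
  abs_le_of_mono_of_const (fun _ hv _ hw hvw => h.worstCase_mono hφ t hv hw hvw)
    (h.worstCase_const hφ t) hu hC x

theorem worstCase_mapsTo (t : ℝ≥0) {u : X → ℝ} (hu : u ∈ Cb K) :
    worstCase p c φ ψ μ t u ∈ Cb K := by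
  obtain ⟨C, -, hC⟩ := Cb.bounded hu
  refine Cb.of_approx (h.worstCase_abs_le hφ t hu hC) fun r ε hε => ?_
  obtain ⟨R, δ, hδ, hmod⟩ := h.worstCase_modulus hφ t r C hε
  obtain ⟨v, hv, hvC, huv⟩ := Cb.exists_approx hu hC R hδ
  exact ⟨_, lipb_subset_cb (h.worstCase_lipb hφ t hv),
    hmod u hu v (lipb_subset_cb hv) hC hvC huv⟩

omit [SecondCountableTopology X] hφ in
/-- Sup-convolution after a step of the reference semigroup is dominated by a step of the
reference semigroup after the sup-convolution with the combined penalty. -/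
theorem supConv_refOp_supConv_le {t s : ℝ≥0} (ht : 0 < t) (hs : 0 < s) {m : ℝ} (hm : 0 ≤ m)
    {u : X → ℝ} (hu : u ∈ Lipb K) (x : X) :
    supConv p (rate p c t m) (refOp ψ μ s (supConv p (rate p c s m) u)) x ≤
      refOp ψ μ s (supConv p (rate p c (t + s) m) u) x := by
  have := h.isProbabilityMeasure s
  obtain ⟨C, -, hC⟩ := Lipb.bounded hu
  have hC' := fun y => (abs_le.1 (hC y)).2
  have hg := lipb_subset_cb (supConv_mem_lipb h.pos (rate_nonneg p c s hm) hu)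
  have hf := lipb_subset_cb (supConv_mem_lipb h.pos (rate_nonneg p c (t + s) hm) hu)
  refine supConv_le fun d => ?_
  refine integral_le_integral_add_const (h.integrable s hg _) (h.integrable s hf _) fun z => ?_
  refine supConv_le fun d' => ?_
  set D := ψ s (x + d) - ψ s x + d' with hD
  have h1 := le_supConv (p := p) (rate_nonneg p c (t + s) hm) hC' (ψ s x + z) D
  rw [show ψ s x + z + D = ψ s (x + d) + z + d' by rw [hD]; abel] at h1
  have h2 : ‖D‖ ≤ Real.exp (c * s) * ‖d‖ + ‖d'‖ := by
    have := h.lipschitz s (x + d) x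
    rw [add_sub_cancel_left] at this
    exact (norm_add_le _ _).trans (by gcongr)
  have h3 : rate p c (t + s) m * ‖D‖ ^ p ≤
      rate p c (t + s) m * (Real.exp (c * s) * ‖d‖ + ‖d'‖) ^ p := by
    have := rate_nonneg p c (t + s) hm
    have := h.pos
    gcongr
  have h4 := rate_add_le h.one_lt.le c ht hs hm (norm_nonneg d) (norm_nonneg d')
  linarith

/-- Choose a line below `φ` that is almost optimal for the time `t + s`, and use weak duality with
this line in both factors. -/
theorem worstCase_add_le_of_lipb (t s : ℝ≥0) {u : X → ℝ} (hu : u ∈ Lipb K) (x : X) :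
    worstCase p c φ ψ μ t (worstCase p c φ ψ μ s u) x ≤ worstCase p c φ ψ μ (t + s) u x := by
  have hu' := lipb_subset_cb hu
  have hI := h.worstCase_mapsTo hφ s hu'
  rcases eq_zero_or_pos t with rfl | ht
  · rw [h.worstCase_zero hφ hI, zero_add]
  rcases eq_zero_or_pos s with rfl | hs
  · rw [h.worstCase_zero hφ hu', add_zero]
  refine le_of_forall_pos_le_add fun ε hε => ?_
  obtain ⟨m, a, hm, hma, hdual⟩ := h.exists_refOp_supConv_le hφ (add_pos_of_pos_of_nonneg ht hs.le)
    hu x hε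
  have hg := supConv_mem_lipb (p := p) h.pos (rate_nonneg p c s hm) hu
  have hf := h.refOp_lipb s hg
  have hff := supConv_mem_lipb (p := p) h.pos (rate_nonneg p c t hm) hf
  have hts := lipb_subset_cb (supConv_mem_lipb (p := p) h.pos (rate_nonneg p c (t + s) hm) hu)
  have h1 := h.worstCase_mono hφ t hI (Cb.add_const (lipb_subset_cb hf) (s * a))
    (h.worstCase_le_refOp_supConv hφ hs hm hma hu' (lipb_subset_cb hg)) x
  have h2 := h.worstCase_add_const_le hφ t (lipb_subset_cb hf) (s * a) x
  have h3 := h.worstCase_le_refOp_supConv hφ ht hm hma (lipb_subset_cb hf) (lipb_subset_cb hff) x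
  have h4 := h.refOp_mono t (lipb_subset_cb hff) (h.refOp_mapsTo s hts)
    (h.supConv_refOp_supConv_le ht hs hm hu) x
  rw [h.refOp_refOp t s hts] at h4
  push_cast at hdual
  linarith

theorem worstCase_add_le (t s : ℝ≥0) {u : X → ℝ} (hu : u ∈ Cb K) (x : X) :
    worstCase p c φ ψ μ t (worstCase p c φ ψ μ s u) x ≤ worstCase p c φ ψ μ (t + s) u x := by
  refine le_of_forall_pos_le_add fun ε hε => ?_
  obtain ⟨C, -, hC⟩ := Cb.bounded hu
  obtain ⟨R₁, δ₁, hδ₁, hmod₁⟩ := h.worstCase_modulus hφ t ‖x‖ C (half_pos hε)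
  obtain ⟨R₂, δ₂, hδ₂, hmod₂⟩ := h.worstCase_modulus hφ s R₁ C hδ₁
  obtain ⟨R₃, δ₃, hδ₃, hmod₃⟩ := h.worstCase_modulus hφ (t + s) ‖x‖ C (half_pos hε)
  obtain ⟨v, hv, hvC, huv⟩ := Cb.exists_approx hu hC (max R₂ R₃) (lt_min hδ₂ hδ₃)
  have hv' := lipb_subset_cb hv
  have h1 := hmod₁ _ (h.worstCase_mapsTo hφ s hu) _ (h.worstCase_mapsTo hφ s hv')
    (h.worstCase_abs_le hφ s hu hC) (h.worstCase_abs_le hφ s hv' hvC)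
    (hmod₂ u hu v hv' hC hvC fun y hy =>
      (huv y (hy.trans (le_max_left _ _))).trans (min_le_left _ _)) x le_rfl
  have h2 := hmod₃ u hu v hv' hC hvC (fun y hy =>
      (huv y (hy.trans (le_max_right _ _))).trans (min_le_right _ _)) x le_rfl
  have h3 := h.worstCase_add_le_of_lipb hφ t s hv x
  rw [abs_le] at h1 h2
  linarith

theorem worstCase_start (L r : ℝ) {ε : ℝ} (hε : 0 < ε) :
    ∃ δ : ℝ≥0, 0 < δ ∧ ∀ t ≤ δ, ∀ u ∈ Lipb K, LipWith K L u →
      ∀ x, ‖x‖ ≤ r → worstCase p c φ ψ μ t u x ≤ u x + ε ∧ u x - ε ≤ refOp ψ μ t u x := by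
  obtain ⟨a, ha, Ha⟩ := h.exists_worstCase_le_refOp_add hφ L
  obtain ⟨δ, hδ, Hδ⟩ := h.exists_abs_refOp_sub_self_le L r (half_pos hε)
  set η : ℝ≥0 := (ε / (2 * (a + 1))).toNNReal with hη
  have hη0 : 0 < η := Real.toNNReal_pos.2 (by positivity)
  refine ⟨min δ (min η 1), by positivity, fun t ht u hu hL x hx => ?_⟩
  simp only [le_min_iff] at ht
  have h1 := Ha t ht.2.2 u hu hL x
  have h2 := abs_le.1 (Hδ t ht.1 u hu hL x hx)
  have h3 : (t : ℝ) * a ≤ ε / 2 := by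
    have hη' : (t : ℝ) ≤ ε / (2 * (a + 1)) := by
      have : (t : ℝ) ≤ η := ht.2.1
      rwa [hη, Real.coe_toNNReal _ (by positivity)] at this
    calc (t : ℝ) * a ≤ ε / (2 * (a + 1)) * (a + 1) := by gcongr; linarith
      _ = ε / 2 := by field_simp
  constructor <;> linarith

theorem isGeneratingFamily : IsGeneratingFamily K c (refOp ψ μ) (worstCase p c φ ψ μ) where
  T_mapsTo := fun t _ hu => h.refOp_mapsTo t hu
  T_mono := fun t _ hu _ hv huv => h.refOp_mono t hu hv huv
  T_add := fun t s _ hu => h.refOp_refOp t s hu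
  mapsTo := fun t _ hu => h.worstCase_mapsTo hφ t hu
  mono := fun t _ hu _ hv huv => h.worstCase_mono hφ t hu hv huv
  convex := fun t _ hu _ hv _ h0 h1 => h.worstCase_convex hφ t hu hv h0 h1
  const := h.worstCase_const hφ
  lip := fun t _ _ hu hL => h.worstCase_le_of_lipWith hφ t hu hL
  I_zero := fun _ hu => h.worstCase_zero hφ hu
  I_add_le := fun t s _ hu => h.worstCase_add_le hφ t s hu
  T_le := fun t _ hu => h.refOp_le_worstCase hφ t hu
  tail := h.worstCase_tail hφ
  start := fun L r _ hε => h.worstCase_start hφ L r hε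

end IsReferenceProcess

end GeneratingFamily


/-! ### The convex conjugate -/

namespace IsPenalty

variable {p : ℝ} {φ : ℝ≥0 → ℝ≥0∞} (hφ : IsPenalty p φ)
include hφ

/-- A convex function of `v ^ p` that does not vanish identically has superlinear growth. -/
theorem exists_mul_le_const_add_toReal (hp : 1 < p) {L : ℝ} (hL : 0 ≤ L) :
    ∃ a : ℝ, 0 ≤ a ∧ ∀ v : ℝ≥0, φ v ≠ ∞ → L * v ≤ a + (φ v).toReal := by
  obtain ⟨m, a, hm, ha, hma⟩ := hφ.exists_conjBound (zero_lt_one.trans hp)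
  obtain ⟨b, hb, hbs⟩ := exists_mul_le_const_add hp hL hm
  exact ⟨a + b, add_nonneg ha hb, fun v hv => by linarith [hma v hv, hbs v v.2]⟩

theorem mul_le_conjugate_add (hp : 1 < p) (w : ℝ) {v : ℝ≥0} (hv : φ v ≠ ∞) :
    v * w ≤ conjugate φ w + (φ v).toReal := by
  obtain ⟨a, -, ha⟩ := hφ.exists_mul_le_const_add_toReal hp (le_max_right w 0)
  have hbdd : BddAbove {r : ℝ | ∃ v : ℝ≥0, φ v ≠ ∞ ∧ r = v * w - (φ v).toReal} := by
    refine ⟨a, ?_⟩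
    rintro r ⟨v, hv, rfl⟩
    have h1 := ha v hv
    have h2 : (v : ℝ) * w ≤ v * max w 0 := mul_le_mul_of_nonneg_left (le_max_left _ _) v.2
    linarith [mul_comm (v : ℝ) (max w 0)]
  have := le_csSup hbdd ⟨v, hv, rfl⟩
  rw [conjugate]
  linarith

theorem conjugate_le {w a : ℝ} (h : ∀ v : ℝ≥0, φ v ≠ ∞ → v * w ≤ a + (φ v).toReal) :
    conjugate φ w ≤ a := by
  refine csSup_le ⟨_, 0, by simp [hφ.zero], rfl⟩ ?_
  rintro r ⟨v, hv, rfl⟩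
  linarith [h v hv]

theorem exists_conjugate_le_add (w : ℝ) {ε : ℝ} (hε : 0 < ε) :
    ∃ v : ℝ≥0, φ v ≠ ∞ ∧ conjugate φ w + (φ v).toReal ≤ v * w + ε := by
  obtain ⟨r, ⟨v, hv, rfl⟩, hr⟩ := exists_lt_of_lt_csSup
    (s := {r : ℝ | ∃ v : ℝ≥0, φ v ≠ ∞ ∧ r = v * w - (φ v).toReal})
    ⟨_, 0, by simp [hφ.zero], rfl⟩ (sub_lt_self (conjugate φ w) hε)
  exact ⟨v, hv, by linarith⟩

theorem conjugate_nonneg (hp : 1 < p) (w : ℝ) : 0 ≤ conjugate φ w := by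
  have := hφ.mul_le_conjugate_add hp w (v := 0) (by simp [hφ.zero])
  simpa [hφ.zero] using this

/-- By superlinear growth only the points `v ≤ A` matter for the conjugate on `(-∞, L]`, so that
`A` is a Lipschitz constant there. -/
theorem exists_conjugate_le_conjugate_add (hp : 1 < p) {L : ℝ} (hL : 0 ≤ L) :
    ∃ A : ℝ, 0 ≤ A ∧ ∀ w₁ w₂ : ℝ, w₂ ≤ L →
      conjugate φ w₂ ≤ conjugate φ w₁ + A * |w₂ - w₁| := by
  obtain ⟨A, hA, hAv⟩ := hφ.exists_mul_le_const_add_toReal hp (add_nonneg hL zero_le_one)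
  refine ⟨A, hA, fun w₁ w₂ hw₂ => hφ.conjugate_le fun v hv => ?_⟩
  rcases le_total (v : ℝ) A with hvA | hvA
  · have h1 := hφ.mul_le_conjugate_add hp w₁ hv
    have h2 : (v : ℝ) * (w₂ - w₁) ≤ A * |w₂ - w₁| :=
      (mul_le_mul_of_nonneg_left (le_abs_self _) v.2).trans
        (mul_le_mul_of_nonneg_right hvA (abs_nonneg _))
    linarith
  · have h1 := hAv v hv
    have h2 : (v : ℝ) * w₂ ≤ v * L := mul_le_mul_of_nonneg_left hw₂ v.2
    have h3 := hφ.conjugate_nonneg hp w₁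
    have h4 : 0 ≤ A * |w₂ - w₁| := mul_nonneg hA (abs_nonneg _)
    linarith

theorem conjugate_comp_mem_cb (hp : 1 < p) {X : Type*} [NormedAddCommGroup X] [NormedSpace ℝ X]
    {K : X →L[ℝ] X} {w : X → ℝ} (hw : w ∈ Cb K) : (fun x => conjugate φ (w x)) ∈ Cb K := by
  obtain ⟨L, hL, hwL⟩ := Cb.bounded hw
  obtain ⟨A, hA, hAw⟩ := hφ.exists_conjugate_le_conjugate_add hp hL
  have h1 : (fun x => conjugate φ (w x)) =
      fun x => (fun s => conjugate φ (max (-L) (min L s))) (w x) := by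
    funext x
    simp only [clip_eq_self (hwL x)]
  rw [h1]
  refine Cb.comp (f := fun s => conjugate φ (max (-L) (min L s))) hw hA fun a b => ?_
  have h2 := mul_le_mul_of_nonneg_left (abs_clip_sub_clip_le L a b) hA
  have ha := (abs_le.1 (abs_clip_le hL a)).2
  have hb := (abs_le.1 (abs_clip_le hL b)).2
  rw [abs_le]
  constructor
  · have := hAw (max (-L) (min L a)) _ hb
    rw [abs_sub_comm] at this
    linarith
  · linarith [hAw (max (-L) (min L b)) _ ha]

end IsPenalty

/-! ### Ascent along a differentiable function -/

section Ascent

variable {X : Type*} [NormedAddCommGroup X]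

/-- Ekeland's variational principle on a closed set. -/
theorem exists_maximal_of_bddAbove [CompleteSpace X] {s : Set X} (hs : IsClosed s) {f : X → ℝ}
    (hf : Continuous f) {C : ℝ} (hC : ∀ x, f x ≤ C) {σ : ℝ} (hσ : 0 < σ) {z : X} (hz : z ∈ s) :
    ∃ y ∈ s, f z + σ * ‖y - z‖ ≤ f y ∧ ∀ x ∈ s, f y + σ * ‖x - y‖ ≤ f x → x = y := by
  have hbdd : ∀ y : X, BddAbove {r | ∃ x ∈ s, f y + σ * ‖x - y‖ ≤ f x ∧ r = f x} := fun y =>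
    ⟨C, by rintro r ⟨x, -, -, rfl⟩; exact hC x⟩
  -- every step gains at least half of what can be gained
  have hstep : ∀ y : s, ∃ x : s, f y + σ * ‖(x : X) - y‖ ≤ f x ∧
      ∀ x' ∈ s, f y + σ * ‖x' - y‖ ≤ f x' → f x' - f x ≤ f x - f y := by
    intro y
    set S := sSup {r | ∃ x ∈ s, f y + σ * ‖x - (y : X)‖ ≤ f x ∧ r = f x} with hS
    have hyS : f y ≤ S := le_csSup (hbdd y) ⟨y, y.2, by simp, rfl⟩
    rcases hyS.eq_or_lt with heq | hlt
    · refine ⟨y, by simp, fun x' hx' hle => ?_⟩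
      have := le_csSup (hbdd y) ⟨x', hx', hle, rfl⟩
      rw [← hS] at this
      linarith
    · obtain ⟨r, ⟨x, hx, hle, rfl⟩, hr⟩ := exists_lt_of_lt_csSup
        (s := {r | ∃ x ∈ s, f y + σ * ‖x - (y : X)‖ ≤ f x ∧ r = f x})
        ⟨_, y, y.2, by simp, rfl⟩ (b := (f y + S) / 2) (by rw [← hS]; linarith)
      refine ⟨⟨x, hx⟩, hle, fun x' hx' hle' => ?_⟩
      have := le_csSup (hbdd y) ⟨x', hx', hle', rfl⟩
      rw [← hS] at this
      dsimp only
      linarith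
  choose g hg hgmax using hstep
  set a : ℕ → s := fun n => g^[n] ⟨z, hz⟩ with ha
  have ha1 : ∀ n, a (n + 1) = g (a n) := fun n => Function.iterate_succ_apply' _ _ _
  have hchain : ∀ n k, f (a n) + σ * ‖(a (n + k) : X) - a n‖ ≤ f (a (n + k)) := by
    intro n k
    induction k with
    | zero => simp
    | succ k ih =>
      have h1 := hg (a (n + k))
      rw [← ha1] at h1
      have h2 : σ * ‖(a (n + k + 1) : X) - a n‖ ≤
          σ * (‖(a (n + k + 1) : X) - a (n + k)‖ + ‖(a (n + k) : X) - a n‖) := by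
        gcongr
        exact norm_sub_le_norm_sub_add_norm_sub _ _ _
      rw [← add_assoc]
      linarith
  have hmono : Monotone fun n => f (a n) := monotone_nat_of_le_succ fun n => by
    have := hchain n 1
    have : 0 ≤ σ * ‖(a (n + 1) : X) - a n‖ := by positivity
    linarith
  have hlim := tendsto_atTop_ciSup hmono ⟨C, by rintro _ ⟨n, rfl⟩; exact hC _⟩
  set S := ⨆ n, f (a n) with hS
  have hfS : ∀ n, f (a n) ≤ S := fun n => hmono.ge_of_tendsto hlim n
  have hcauchy : CauchySeq fun n => (a n : X) := by
    refine cauchySeq_of_le_tendsto_0 (fun n => 2 * ((S - f (a n)) / σ)) (fun n m N hn hm => ?_) ?_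
    · have key : ∀ k ≥ N, ‖(a k : X) - a N‖ ≤ (S - f (a N)) / σ := fun k hk => by
        obtain ⟨j, rfl⟩ := Nat.exists_eq_add_of_le hk
        rw [le_div_iff₀ hσ]
        linarith [hchain N j, hfS (N + j)]
      rw [dist_eq_norm]
      have := norm_sub_le_norm_sub_add_norm_sub (a n : X) (a N) (a m)
      rw [norm_sub_rev (a N : X)] at this
      linarith [key n hn, key m hm]
    · have : Tendsto (fun n => 2 * ((S - f (a n)) / σ)) atTop (𝓝 (2 * ((S - S) / σ))) :=
        ((tendsto_const_nhds.sub hlim).div_const σ).const_mul 2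
      simpa using this
  obtain ⟨y, hy⟩ := cauchySeq_tendsto_of_complete hcauchy
  have hfy : f y = S := tendsto_nhds_unique ((hf.tendsto y).comp hy) hlim
  have hay : ∀ n, f (a n) + σ * ‖y - a n‖ ≤ f y := fun n => by
    have h1 : Tendsto (fun k => f (a n) + σ * ‖(a k : X) - a n‖) atTop
        (𝓝 (f (a n) + σ * ‖y - a n‖)) :=
      ((hy.sub_const _).norm.const_mul σ).const_add _
    refine le_of_tendsto_of_tendsto h1 ((hf.tendsto y).comp hy) ?_
    filter_upwards [eventually_ge_atTop n] with k hk
    obtain ⟨j, rfl⟩ := Nat.exists_eq_add_of_le hk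
    exact hchain n j
  refine ⟨y, hs.mem_of_tendsto hy (Eventually.of_forall fun n => (a n).2), hay 0,
    fun x hx hle => ?_⟩
  have hxS : f x ≤ S := by
    have h1 : ∀ n, f x - f (a (n + 1)) ≤ f (a (n + 1)) - f (a n) := fun n => by
      rw [ha1]
      refine hgmax (a n) x hx ?_
      have h2 : σ * ‖x - a n‖ ≤ σ * (‖x - y‖ + ‖y - a n‖) := by
        gcongr
        exact norm_sub_le_norm_sub_add_norm_sub _ _ _
      linarith [hay n]
    have hlim' := hlim.comp (tendsto_add_atTop_nat 1)
    have := le_of_tendsto_of_tendsto' (hlim'.const_sub (f x)) (hlim'.sub hlim) h1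
    linarith
  have h0 : ‖x - y‖ ≤ 0 := by
    by_contra hpos
    push Not at hpos
    have := mul_pos hσ hpos
    linarith
  exact sub_eq_zero.1 (norm_le_zero_iff.1 h0)

variable [NormedSpace ℝ X]

theorem norm_le_of_eventually_le_add {f : X → ℝ} {f' : X →L[ℝ] ℝ} {y : X}
    (hf : HasFDerivAt f f' y) {σ : ℝ} (hσ : 0 ≤ σ)
    (h : ∀ᶠ x in 𝓝 y, f x ≤ f y + σ * ‖x - y‖) : ‖f'‖ ≤ σ := by
  refine le_of_forall_pos_le_add fun ε hε => ?_
  refine f'.opNorm_le_of_nhds_zero (by positivity) ?_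
  have h1 : ∀ᶠ d in 𝓝 (0 : X), f' d ≤ (σ + ε) * ‖d‖ := by
    have hlo := (hasFDerivAt_iff_isLittleO_nhds_zero.1 hf).def hε
    have h2 : ∀ᶠ d in 𝓝 (0 : X), f (y + d) ≤ f y + σ * ‖d‖ := by
      have ht : Tendsto (fun d : X => y + d) (𝓝 0) (𝓝 y) := by
        simpa using (continuous_const_add y).tendsto 0
      filter_upwards [ht.eventually h] with d hd
      simpa using hd
    filter_upwards [hlo, h2] with d hd hd2
    rw [Real.norm_eq_abs, abs_le] at hd
    linarith [hd.1]
  have h3 : ∀ᶠ d in 𝓝 (0 : X), f' (-d) ≤ (σ + ε) * ‖-d‖ := by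
    have ht : Tendsto (fun d : X => -d) (𝓝 0) (𝓝 0) := by
      simpa using (continuous_neg (G := X)).tendsto 0
    exact ht.eventually h1
  filter_upwards [h1, h3] with d hd hd'
  rw [map_neg, norm_neg] at hd'
  rw [Real.norm_eq_abs, abs_le]
  constructor <;> linarith

/-- A function whose derivative has norm larger than `σ` on a ball increases by at least `σ` times
the radius inside the ball. No compactness is available, so that the point is obtained from
Ekeland's principle. -/
theorem exists_add_mul_le_of_lt_norm_fderiv [CompleteSpace X] {f : X → ℝ}
    (hf : Differentiable ℝ f) {C : ℝ} (hC : ∀ x, f x ≤ C) {σ ρ : ℝ} (hσ : 0 < σ) (hρ : 0 ≤ ρ)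
    {z : X} (hz : ∀ ξ, ‖ξ - z‖ < ρ → σ < ‖fderiv ℝ f ξ‖) :
    ∃ d : X, ‖d‖ ≤ ρ ∧ f z + σ * ρ ≤ f (z + d) := by
  obtain ⟨y, hys, hy, hmax⟩ := exists_maximal_of_bddAbove
    (Metric.isClosed_closedBall (x := z) (ε := ρ)) hf.continuous hC hσ
    (Metric.mem_closedBall_self hρ)
  rw [mem_closedBall_iff_norm] at hys
  refine ⟨y - z, hys, ?_⟩
  rw [add_sub_cancel]
  rcases hys.lt_or_eq with hlt | heq
  · refine absurd (hz y hlt) (not_lt.2 ?_)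
    refine norm_le_of_eventually_le_add (hf y).hasFDerivAt hσ.le ?_
    have hnhds : Metric.closedBall z ρ ∈ 𝓝 y :=
      Filter.mem_of_superset (Metric.isOpen_ball.mem_nhds (mem_ball_iff_norm.2 hlt))
        Metric.ball_subset_closedBall
    filter_upwards [hnhds] with x hx
    by_contra hgt
    push Not at hgt
    rw [hmax x hx hgt.le] at hgt
    simp at hgt
  · rw [← heq]
    exact hy

end Ascent


/-! ### The derivative of the worst-case operator at time zero -/

/-- Functions in `Cb K` are uniformly continuous on bounded sets. -/
theorem Cb.exists_abs_sub_le {X : Type*} [NormedAddCommGroup X] [NormedSpace ℝ X] {K : X →L[ℝ] X}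
    (hK : ∀ x : X, ‖K x‖ ≤ ‖x‖) {w : X → ℝ} (hw : w ∈ Cb K) (R : ℝ) {ε : ℝ} (hε : 0 < ε) :
    ∃ ρ : ℝ, 0 < ρ ∧ ∀ z, ‖z‖ ≤ R → ∀ ξ, ‖ξ - z‖ ≤ ρ → |w ξ - w z| ≤ ε := by
  obtain ⟨C, -, hC⟩ := Cb.bounded hw
  obtain ⟨v, ⟨⟨L, hL⟩, -⟩, -, hv⟩ := Cb.exists_approx hw hC (R + 1) (ε := ε / 3) (by positivity)
  have hL0 := hL.1
  refine ⟨min 1 (ε / 3 / (L + 1)), by positivity, fun z hz ξ hξ => ?_⟩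
  rw [le_min_iff, le_div_iff₀ (by positivity)] at hξ
  have hξR : ‖ξ‖ ≤ R + 1 := by
    have := norm_add_le (ξ - z) z
    rw [sub_add_cancel] at this
    linarith [hξ.1]
  have h1 := abs_le.1 (hv z (by linarith))
  have h2 := abs_le.1 (hv ξ hξR)
  have h3 := abs_le.1 (hL.lipschitz hK ξ z)
  have h4 : L * ‖ξ - z‖ ≤ ε / 3 := by linarith [norm_nonneg (ξ - z), hξ.2]
  rw [abs_le]
  constructor <;> linarith [h1.1, h1.2, h2.1, h2.2, h3.1, h3.2]

theorem LipWith.norm_fderiv_le {X : Type*} [NormedAddCommGroup X] [NormedSpace ℝ X]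
    {K : X →L[ℝ] X} (hK : ∀ x : X, ‖K x‖ ≤ ‖x‖) {u : X → ℝ} {L : ℝ} (hL : LipWith K L u) (x : X) :
    ‖fderiv ℝ u x‖ ≤ L := by
  have h1 : LipschitzWith ⟨L, hL.1⟩ u := LipschitzWith.of_dist_le_mul fun a b => by
    rw [Real.dist_eq, dist_eq_norm]
    exact hL.lipschitz hK a b
  exact norm_fderiv_le_of_lipschitz ℝ h1

section Generator

variable {X : Type*} [NormedAddCommGroup X] [NormedSpace ℝ X]

theorem sub_le_mul_norm_of_norm_fderiv_le {u : X → ℝ} (hu : Differentiable ℝ u) {z d : X}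
    {W : ℝ} (hW : ∀ ξ, ‖ξ - z‖ ≤ ‖d‖ → ‖fderiv ℝ u ξ‖ ≤ W) : u (z + d) - u z ≤ W * ‖d‖ := by
  have h1 := (convex_closedBall z ‖d‖).norm_image_sub_le_of_norm_fderiv_le (𝕜 := ℝ) (f := u)
    (C := W) (x := z) (y := z + d) (fun x _ => hu x)
    (fun x hx => hW x (by simpa [dist_eq_norm] using hx)) (by simp) (by simp)
  rw [add_sub_cancel_left] at h1
  exact (le_abs_self _).trans h1

variable {p : ℝ} {c : ℝ≥0} {u : X → ℝ} {L : ℝ}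

omit [NormedSpace ℝ X] in
/-- A crude bound for the sup-convolution of a Lipschitz function over a time `t`: the gain is at
most of order `t`, and displacements that are not of order `t` do not gain anything. -/
theorem exists_supConv_le_add (hp : 1 < p) (c : ℝ≥0) (hL : 0 ≤ L)
    (hu : ∀ x y, |u x - u y| ≤ L * ‖x - y‖) {m : ℝ} (hm : 0 < m) :
    ∃ b : ℝ, 0 ≤ b ∧ ∀ t : ℝ≥0, 0 < t → t ≤ 1 → ∀ z, supConv p (rate p c t m) u z ≤ u z + t * b ∧
      ∀ d, t * b ≤ ‖d‖ → u (z + d) - u z ≤ rate p c t m * ‖d‖ ^ p := by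
  obtain ⟨a, ha, has⟩ := exists_mul_le_const_add hp
    (mul_nonneg (add_nonneg hL zero_le_one) (Real.exp_pos c).le) hm
  -- the displacement `d` gains at most `L ‖d‖ ≤ t a + rate ‖d‖ ^ p - ‖d‖`
  have key : ∀ t : ℝ≥0, 0 < t → t ≤ 1 → ∀ z d,
      u (z + d) - u z + ‖d‖ ≤ t * a + rate p c t m * ‖d‖ ^ p := by
    intro t ht ht1 z d
    have ht' : (0 : ℝ) < t := ht
    have e1 := (abs_le.1 (hu (z + d) z)).2
    rw [add_sub_cancel_left] at e1
    rw [rate_mul_rpow _ _ _ _ (norm_nonneg d)]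
    have e2 := mul_le_mul_of_nonneg_left
      (has (Real.exp (-(c * t)) * (‖d‖ / t)) (by positivity)) ht'.le
    have k1 : t * ((L + 1) * Real.exp c * (Real.exp (-(c * t)) * (‖d‖ / t))) =
        (L + 1) * ‖d‖ * Real.exp (c - c * t) := by
      rw [sub_eq_add_neg, Real.exp_add]
      field_simp
    have k2 : 1 ≤ Real.exp (c - c * t) := by
      rw [Real.one_le_exp_iff]
      have : (c : ℝ) * t ≤ c * 1 := by gcongr; exact_mod_cast ht1
      linarith
    have k3 : (L + 1) * ‖d‖ * 1 ≤ (L + 1) * ‖d‖ * Real.exp (c - c * t) := by gcongr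
    rw [k1, mul_add] at e2
    linarith
  refine ⟨a, ha, fun t ht ht1 z => ⟨supConv_le fun d => ?_, fun d hd => ?_⟩⟩
  · linarith [key t ht ht1 z d, norm_nonneg d]
  · linarith [key t ht ht1 z d]

/-- Pointwise bound for the sup-convolution over a short time, where the norm of the derivative
is less than `w` and the line `b + m s ^ p` dominates `w s`. -/
theorem exists_supConv_le_of_norm_fderiv_le (hp : 1 < p) (c : ℝ≥0) (hL : 0 ≤ L)
    (hu : ∀ x y, |u x - u y| ≤ L * ‖x - y‖) (hud : Differentiable ℝ u) {m b W w ρ : ℝ}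
    (hm : 0 < m) (hb : ∀ s : ℝ, 0 ≤ s → w * s ≤ b + m * s ^ p) (hWw : W < w)
    (hρ : 0 < ρ) :
    ∃ δ : ℝ≥0, 0 < δ ∧ ∀ t : ℝ≥0, 0 < t → t ≤ δ → ∀ z,
      (∀ ξ, ‖ξ - z‖ ≤ ρ → ‖fderiv ℝ u ξ‖ ≤ W) →
        supConv p (rate p c t m) u z ≤ u z + t * b := by
  have hb0 : 0 ≤ b := by
    have := hb 0 le_rfl
    rwa [Real.zero_rpow (by linarith), mul_zero, mul_zero, add_zero] at this
  obtain ⟨b₁, hb₁, h₁⟩ := exists_supConv_le_add hp c hL hu hm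
  have hev : ∀ᶠ t : ℝ≥0 in 𝓝[>] 0, W < w * Real.exp (-(c * t)) ∧ t * b₁ < ρ ∧ t ≤ 1 := by
    refine nhdsWithin_le_nhds ?_
    have c1 : Tendsto (fun t : ℝ≥0 => w * Real.exp (-(c * t))) (𝓝 0)
        (𝓝 (w * Real.exp (-(c * (0 : ℝ≥0))))) := Continuous.tendsto (by fun_prop) 0
    have c2 : Tendsto (fun t : ℝ≥0 => (t : ℝ) * b₁) (𝓝 0) (𝓝 ((0 : ℝ≥0) * b₁)) :=
      Continuous.tendsto (by fun_prop) 0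
    filter_upwards [c1.eventually_const_lt (by simpa using hWw),
      c2.eventually_lt_const (by simpa using hρ), eventually_le_nhds zero_lt_one] with t e1 e2 e3
    exact ⟨e1, e2, e3⟩
  obtain ⟨δ, hδ, H⟩ := eventually_nhdsGT_zero.1 hev
  refine ⟨δ, hδ, fun t ht htδ z hz => supConv_le fun d => ?_⟩
  obtain ⟨e1, e2, e3⟩ := H t ht htδ
  have ht' : (0 : ℝ) < t := ht
  rcases le_total ‖d‖ ρ with hd | hd
  · have k1 := sub_le_mul_norm_of_norm_fderiv_le hud (z := z) (d := d)
      fun ξ hξ => hz ξ (hξ.trans hd)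
    rw [rate_mul_rpow _ _ _ _ (norm_nonneg d)]
    have k2 := mul_le_mul_of_nonneg_left
      (hb (Real.exp (-(c * t)) * (‖d‖ / t)) (by positivity)) ht'.le
    have k3 : t * (w * (Real.exp (-(c * t)) * (‖d‖ / t))) =
        w * Real.exp (-(c * t)) * ‖d‖ := by field_simp
    have k4 : W * ‖d‖ ≤ w * Real.exp (-(c * t)) * ‖d‖ := by gcongr
    rw [k3, mul_add] at k2
    linarith
  · have k1 := (h₁ t ht e3 z).2 d (e2.le.trans hd)
    have : 0 ≤ t * b := by positivity
    linarith

/-- Pointwise lower bound for the sup-convolution: the displacement by `v t` is a competitor. -/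
theorem add_le_supConv_of_le_norm_fderiv [CompleteSpace X] (hp : 1 < p) (c : ℝ≥0)
    (hud : Differentiable ℝ u) {C : ℝ} (hC : ∀ x, u x ≤ C) {m σ : ℝ} (hm : 0 ≤ m)
    {t v : ℝ≥0} (ht : 0 < t) {z : X} (hz : ∀ ξ, ‖ξ - z‖ ≤ v * t → σ < ‖fderiv ℝ u ξ‖) :
    u z + t * (v * σ - m * (v : ℝ) ^ p) ≤ supConv p (rate p c t m) u z := by
  have ht' : (0 : ℝ) < t := ht
  have hvp : 0 ≤ m * (v : ℝ) ^ p := by positivity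
  have hrate := rate_nonneg p c t hm
  rcases le_or_gt σ 0 with hσ | hσ
  · have h1 := le_supConv_self (zero_lt_one.trans hp) hrate hC z
    have h2 : (v : ℝ) * σ ≤ 0 := mul_nonpos_of_nonneg_of_nonpos v.2 hσ
    have h3 : t * (v * σ - m * (v : ℝ) ^ p) ≤ 0 :=
      mul_nonpos_of_nonneg_of_nonpos ht'.le (by linarith)
    linarith
  · obtain ⟨d, hd, hud'⟩ := exists_add_mul_le_of_lt_norm_fderiv hud hC hσ (ρ := v * t)
      (by positivity) fun ξ hξ => hz ξ hξ.le
    have h1 := le_supConv (p := p) hrate hC z d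
    have h2 : rate p c t m * ‖d‖ ^ p ≤ t * (m * (v : ℝ) ^ p) := by
      rw [rate_mul_rpow _ _ _ _ (norm_nonneg d)]
      gcongr
      have k1 : ‖d‖ / t ≤ v := by rwa [div_le_iff₀ ht']
      have k2 : Real.exp (-(c * t)) ≤ 1 := by
        rw [Real.exp_le_one_iff, neg_nonpos]
        positivity
      calc Real.exp (-(c * t)) * (‖d‖ / t) ≤ 1 * v := by gcongr
        _ = v := one_mul _
    linarith

end Generator


/-- Fenchel duality at a point `w > 0`: some line in the variable `s ^ p` lies above `w s` and
below `φ`, up to the constants that add up to the conjugate at `w`. -/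
theorem IsPenalty.exists_conjBound_of_pos {p : ℝ} {φ : ℝ≥0 → ℝ≥0∞} (hφ : IsPenalty p φ)
    (hp : 1 < p) {w ε : ℝ} (hw : 0 < w) (hε : 0 < ε) :
    ∃ m a : ℝ, 0 < m ∧ IsConjBound p φ m a ∧
      ∀ s : ℝ, 0 ≤ s → w * s ≤ conjugate φ w + ε - a + m * s ^ p := by
  have hp0 : 0 < p := zero_lt_one.trans hp
  have hM := hφ.conjugate_nonneg hp w
  have hroot : ∀ s : ℝ, 0 ≤ s → (s ^ p) ^ (1 / p) = s := fun s hs => by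
    rw [one_div, Real.rpow_rpow_inv hs hp0.ne']
  obtain ⟨m, a, hm, hma, hG⟩ := hφ.exists_conjBound_of_hypograph hp0
    (G := {x : ℝ × ℝ | 0 ≤ x.1 ∧ x.2 ≤ w * x.1 ^ (1 / p)}) (M := conjugate φ w)
    (by
      have hconc : ConcaveOn ℝ (Set.Ici 0) fun b : ℝ => w * b ^ (1 / p) :=
        (Real.concaveOn_rpow (by positivity) (by rw [div_le_one hp0]; exact hp.le)).smul hw.le
      exact hconc.convex_hypograph)
    (fun b e hbe b' hbb' => ⟨hbe.1.trans hbb', hbe.2.trans (by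
      have := hbe.1
      dsimp only at this ⊢
      gcongr)⟩)
    ⟨0, le_rfl, by positivity⟩
    (fun v e hve hv => by
      have h1 := hve.2
      dsimp only at h1
      rw [hroot v v.2] at h1
      linarith [hφ.mul_le_conjugate_add hp w hv, mul_comm w (v : ℝ)])
    hε
    (by
      obtain ⟨A, hA, hs⟩ := exists_mul_le_add_mul_rpow hp hw.le hε
      refine ⟨A, hA.le, fun b e hbe => ?_⟩
      have hb : 0 ≤ b := hbe.1
      have h1 := hs (b ^ (1 / p)) (by positivity)
      rw [one_div, Real.rpow_inv_rpow hb hp0.ne', ← one_div] at h1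
      have h2 : e ≤ w * b ^ (1 / p) := hbe.2
      linarith)
  have hlin : ∀ s : ℝ, 0 ≤ s → w * s ≤ conjugate φ w + ε - a + m * s ^ p := fun s hs =>
    hG _ _ ⟨by positivity, by dsimp only; rw [hroot s hs]⟩
  refine ⟨m, a, hm.lt_of_ne' fun hm0 => ?_, hma, hlin⟩
  -- a horizontal line does not stay above `w s`
  have h0 := hlin 0 le_rfl
  rw [hm0] at hlin h0
  have h1 := hlin ((conjugate φ w + ε - a + 1) / w) (div_nonneg (by linarith) hw.le)
  rw [mul_div_cancel₀ _ hw.ne'] at h1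
  linarith

section Generator

variable {X : Type*} [NormedAddCommGroup X] [NormedSpace ℝ X] [MeasurableSpace X] [BorelSpace X]
  {K : X →L[ℝ] X} {p : ℝ} {c : ℝ≥0} {μ : ℝ≥0 → Measure X} {ψ : ℝ≥0 → X → X} {φ : ℝ≥0 → ℝ≥0∞}

namespace IsReferenceProcess

variable (h : IsReferenceProcess K p c μ ψ)
include h

theorem refOp_add_mul (t : ℝ≥0) {u v : X → ℝ} (hu : u ∈ Cb K) (hv : v ∈ Cb K) (a : ℝ) (x : X) :
    refOp ψ μ t (fun z => u z + a * v z) x = refOp ψ μ t u x + a * refOp ψ μ t v x := by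
  rw [refOp, refOp, refOp, ← integral_const_mul, integral_add (h.integrable t hu _)
    ((h.integrable t hv _).const_mul a)]

theorem refOp_add_mul_const (t : ℝ≥0) {u : X → ℝ} (hu : u ∈ Cb K) (a : ℝ) (x : X) :
    refOp ψ μ t (fun z => u z + a) x = refOp ψ μ t u x + a := by
  have h1 := h.refOp_add_mul t hu (Cb.const 1) a x
  simpa [h.refOp_const] using h1

variable [SecondCountableTopology X] (hφ : IsPenalty p φ)
include hφ

/-- Upper bound for the derivative of the worst-case operator at time zero, at the points where
the norm of the derivative of `u` is at most `w₀`. -/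
theorem eventually_worstCase_le {u : X → ℝ} (hu : u ∈ C1b K) (r : ℝ) {w₀ η ε : ℝ} (hw₀ : 0 ≤ w₀)
    (hη : 0 < η) (hε : 0 < ε) :
    ∀ᶠ t : ℝ≥0 in 𝓝[>] 0, ∀ x, ‖x‖ ≤ r → ‖fderiv ℝ u x‖ ≤ w₀ →
      worstCase p c φ ψ μ t u x ≤ refOp ψ μ t u x + t * (conjugate φ (w₀ + η) + ε) := by
  obtain ⟨hub, hud, hw⟩ := hu
  have hu' := lipb_subset_cb hub
  obtain ⟨L, hL⟩ := hub.1
  have hlip := hL.lipschitz h.norm_le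
  obtain ⟨m, a, hm, hma, hlin⟩ := hφ.exists_conjBound_of_pos h.one_lt
    (add_pos_of_nonneg_of_pos hw₀ hη) (ε := ε / 3) (by positivity)
  set b := conjugate φ (w₀ + η) + ε / 3 - a with hb
  have hb0 : 0 ≤ b := by
    have := hlin 0 le_rfl
    rwa [Real.zero_rpow h.pos.ne', mul_zero, mul_zero, add_zero] at this
  obtain ⟨b₁, hb₁, hcrude⟩ := exists_supConv_le_add h.one_lt c hL.1 hlip hm
  obtain ⟨R, hR⟩ := h.tailBound 1 r b₁ (ε / 3) (by positivity)
  obtain ⟨ρ, hρ, hwρ⟩ := Cb.exists_abs_sub_le h.norm_le hw R (ε := η / 4) (by positivity)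
  obtain ⟨δ₁, hδ₁, hfine⟩ := exists_supConv_le_of_norm_fderiv_le h.one_lt c hL.1 hlip hud hm hlin
    (W := w₀ + η / 2) (by linarith) hρ
  -- the crude bound is used where the norm of the derivative exceeds `w₀ + η / 4`
  set N := 4 * b₁ / η with hN
  have hN0 : 0 ≤ N := by positivity
  set P : X → ℝ := fun z => max (‖fderiv ℝ u z‖ - w₀) 0 with hP
  have hPc : P ∈ Cb K := Cb.comp (f := fun s => max (s - w₀) 0) hw zero_le_one fun s s' => by
    simpa using abs_max_sub_max_le_abs (s - w₀) (s' - w₀) 0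
  obtain ⟨δ₂, hδ₂, hPδ⟩ := h.exists_abs_refOp_sub_self_le_of_cb hPc r (ε := ε / 3 / (N + 1))
    (by positivity)
  refine eventually_nhdsGT_zero.2 ⟨min 1 (min δ₁ δ₂), lt_min one_pos (lt_min hδ₁ hδ₂),
    fun t ht htδ x hx hwx => ?_⟩
  rw [le_min_iff, le_min_iff] at htδ
  obtain ⟨ht1, ht2, ht3⟩ := htδ
  have ht' : (0 : ℝ) < t := ht
  have hsc := lipb_subset_cb (supConv_mem_lipb h.pos (rate_nonneg p c t hm.le) hub)
  set v := supConv p (rate p c t m) u with hv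
  set F : X → ℝ := fun z => (t : ℝ)⁻¹ * (v z - u z) - N * P z - b with hF
  have hFc : F ∈ Cb K :=
    Cb.sub_const (Cb.sub (Cb.const_mul (Cb.sub hsc hu') _) (Cb.const_mul hPc N)) b
  have hP0 : ∀ z, 0 ≤ P z := fun z => le_max_right _ _
  have hcr : ∀ z, (t : ℝ)⁻¹ * (v z - u z) ≤ b₁ := fun z => by
    rw [inv_mul_le_iff₀ ht']
    linarith [(hcrude t ht ht1 z).1]
  have h1 := hR t ht1 F hFc
    (fun z => by
      have := mul_nonneg hN0 (hP0 z)
      simp only [hF]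
      linarith [hcr z])
    (fun z hz => by
      simp only [hF]
      rcases le_total ‖fderiv ℝ u z‖ (w₀ + η / 4) with hle | hle
      · have k1 := hfine t ht ht2 z fun ξ hξ => by
          linarith [(abs_le.1 (hwρ z hz ξ hξ)).2]
        have k2 : (t : ℝ)⁻¹ * (v z - u z) ≤ b := by
          rw [inv_mul_le_iff₀ ht']
          linarith
        linarith [mul_nonneg hN0 (hP0 z)]
      · have k1 : b₁ ≤ N * P z := by
          have k2 : η / 4 ≤ P z := le_max_of_le_left (by linarith)
          calc b₁ = N * (η / 4) := by rw [hN]; field_simp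
            _ ≤ N * P z := by gcongr
        linarith [hcr z])
    x hx
  have hdecomp : v = fun z => u z + t * ((F z + N * P z) + b) := by
    funext z
    simp only [hF]
    field_simp
    ring
  have h2 : refOp ψ μ t v x = refOp ψ μ t u x +
      t * (refOp ψ μ t F x + N * refOp ψ μ t P x + b) := by
    rw [hdecomp, h.refOp_add_mul t hu' (Cb.add_const (Cb.add hFc (Cb.const_mul hPc N)) b),
      h.refOp_add_mul_const t (Cb.add hFc (Cb.const_mul hPc N)), h.refOp_add_mul t hFc hPc]
  have h3 := h.worstCase_le_refOp_supConv hφ ht hm.le hma hu' hsc x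
  have h4 : N * refOp ψ μ t P x ≤ ε / 3 := by
    have hPx : P x = 0 := max_eq_right (by linarith)
    have k1 := (abs_le.1 (hPδ t ht3 x hx)).2
    rw [hPx, sub_zero] at k1
    calc N * refOp ψ μ t P x ≤ N * (ε / 3 / (N + 1)) := by gcongr
      _ ≤ (N + 1) * (ε / 3 / (N + 1)) := by gcongr; linarith
      _ = ε / 3 := by field_simp
  rw [← hv, h2] at h3
  have h5 : t * (refOp ψ μ t F x + N * refOp ψ μ t P x + b) ≤ t * (ε / 3 + ε / 3 + b) := by gcongr
  have h6 : t * (ε / 3 + ε / 3 + b) + t * a = t * (conjugate φ (w₀ + η) + ε) := by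
    rw [hb]
    ring
  linarith

/-- Lower bound for the derivative of the worst-case operator at time zero, at the points where
the norm of the derivative of `u` is at least `w₀`. -/
theorem eventually_le_worstCase [CompleteSpace X] {u : X → ℝ} (hu : u ∈ C1b K) (r : ℝ) {w₀ ε : ℝ}
    (hε : 0 < ε) :
    ∀ᶠ t : ℝ≥0 in 𝓝[>] 0, ∀ x, ‖x‖ ≤ r → w₀ ≤ ‖fderiv ℝ u x‖ →
      refOp ψ μ t u x + t * (conjugate φ w₀ - ε) ≤ worstCase p c φ ψ μ t u x := by
  obtain ⟨hub, hud, hw⟩ := hu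
  have hu' := lipb_subset_cb hub
  obtain ⟨L, hL⟩ := hub.1
  obtain ⟨C, -, hC⟩ := Lipb.bounded hub
  have hC' : ∀ x, u x ≤ C := fun x => (abs_le.1 (hC x)).2
  obtain ⟨q, hq, hqw⟩ := hφ.exists_conjugate_le_add w₀ (half_pos hε)
  set ε' := ε / 2 / (3 * q + 2) with hε'
  have hε'0 : 0 < ε' := by positivity
  have hε'q : (3 * q + 2) * ε' = ε / 2 := by
    rw [hε']
    field_simp
  set w : X → ℝ := fun z => ‖fderiv ℝ u z‖ with hwdef
  obtain ⟨R, hR⟩ := h.tailBound 1 r (q * L) ε' hε'0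
  obtain ⟨ρ, hρ, hwρ⟩ := Cb.exists_abs_sub_le h.norm_le hw R hε'0
  obtain ⟨δ, hδ, hwδ⟩ := h.exists_abs_refOp_sub_self_le_of_cb hw r hε'0
  have hqρ : 0 < ρ / (q + 1) := by positivity
  refine eventually_nhdsGT_zero.2 ⟨min 1 (min δ (ρ / (q + 1)).toNNReal),
    lt_min one_pos (lt_min hδ (Real.toNNReal_pos.2 hqρ)), fun t ht htδ x hx hwx => ?_⟩
  rw [le_min_iff, le_min_iff, Real.le_toNNReal_iff_coe_le hqρ.le, le_div_iff₀ (by positivity)]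
    at htδ
  obtain ⟨ht1, ht2, ht3⟩ := htδ
  have ht' : (0 : ℝ) < t := ht
  obtain ⟨m, a, hm, hma, hdual⟩ := h.exists_refOp_supConv_le hφ ht hub x (mul_pos ht' hε'0)
  have hrate := rate_nonneg p c t hm
  have hsc := lipb_subset_cb (supConv_mem_lipb h.pos hrate hub)
  set v := supConv p (rate p c t m) u with hv
  have hmq : 0 ≤ m * (q : ℝ) ^ p := by positivity
  set b := 2 * q * ε' + m * (q : ℝ) ^ p with hb
  set F : X → ℝ := fun z => q * w z - b - (t : ℝ)⁻¹ * (v z - u z) with hF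
  have hFc : F ∈ Cb K :=
    Cb.sub (Cb.sub_const (Cb.const_mul hw _) b) (Cb.const_mul (Cb.sub hsc hu') _)
  have h1 := hR t ht1 F hFc
    (fun z => by
      have k1 := le_supConv_self h.pos hrate hC' z
      have k2 : 0 ≤ (t : ℝ)⁻¹ * (v z - u z) := mul_nonneg (by positivity) (by linarith)
      have k3 : q * w z ≤ q * L :=
        mul_le_mul_of_nonneg_left (hL.norm_fderiv_le h.norm_le z) q.2
      have k4 : 0 ≤ 2 * q * ε' := by positivity
      simp only [hF]
      linarith)
    (fun z hz => by
      have k1 := add_le_supConv_of_le_norm_fderiv h.one_lt c hud hC' hm ht (v := q)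
        (σ := w z - 2 * ε') (z := z) fun ξ hξ => by
          have e1 := hwρ z hz ξ (hξ.trans (by linarith [mul_comm (q : ℝ) t]))
          simp only [hwdef] at e1 ⊢
          linarith [(abs_le.1 e1).1]
      have k2 : q * (w z - 2 * ε') - m * (q : ℝ) ^ p ≤ (t : ℝ)⁻¹ * (v z - u z) := by
        rw [le_inv_mul_iff₀ ht']
        linarith
      simp only [hF]
      linarith)
    x hx
  have hdecomp : v = fun z => u z + (-t) * ((F z + (-q) * w z) + b) := by
    funext z
    simp only [hF]
    field_simp
    ring
  have hFw : (fun z => F z + (-q) * w z) ∈ Cb K := Cb.add hFc (Cb.const_mul hw _)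
  have h2 : refOp ψ μ t v x = refOp ψ μ t u x +
      (-t) * (refOp ψ μ t F x + (-q) * refOp ψ μ t w x + b) := by
    rw [hdecomp, h.refOp_add_mul t hu' (Cb.add_const hFw b),
      h.refOp_add_mul_const t hFw, h.refOp_add_mul t hFc hw]
  have h3 := (abs_le.1 (hwδ t ht2 x hx)).1
  have h4 : q * (w x - ε') ≤ q * refOp ψ μ t w x :=
    mul_le_mul_of_nonneg_left (by linarith) q.2
  have h5 : q * w₀ ≤ q * w x := mul_le_mul_of_nonneg_left hwx q.2
  have h6 : t * (conjugate φ w₀ - ε) ≤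
      t * (a - (refOp ψ μ t F x + (-q) * refOp ψ μ t w x + b) - ε') := by
    refine mul_le_mul_of_nonneg_left ?_ ht'.le
    linarith [hma q hq]
  rw [h2] at hdual
  linarith

/-- The derivative of the worst-case operator at time zero is the generator of the reference
semigroup plus the conjugate of the norm of the gradient. The two one-sided bounds are used at
the finitely many points of a grid for the norm of the gradient. -/
theorem locConv_worstCase [CompleteSpace X] {u b : X → ℝ} (hu : u ∈ C1b K)
    (hb : LocConv (𝓝[>] (0 : ℝ≥0)) (fun (t : ℝ≥0) x => (refOp ψ μ t u x - u x) / (t : ℝ)) b) :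
    LocConv (𝓝[>] (0 : ℝ≥0)) (fun (t : ℝ≥0) x => (worstCase p c φ ψ μ t u x - u x) / (t : ℝ))
      fun x => b x + conjugate φ ‖fderiv ℝ u x‖ := by
  have hub := hu.1
  have hu' := lipb_subset_cb hub
  obtain ⟨L, hL⟩ := hub.1
  have hL0 := hL.1
  obtain ⟨⟨C, hC⟩, hconv⟩ := locConv_iff.1 hb
  refine locConv_iff.2 ⟨?_, fun r ε hε => ?_⟩
  · obtain ⟨a, ha, hle⟩ := h.exists_worstCase_le_refOp_add hφ L
    refine ⟨C + a, ?_⟩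
    have h1 : ∀ᶠ t : ℝ≥0 in 𝓝[>] 0, t ≤ 1 :=
      nhdsWithin_le_nhds (eventually_le_nhds zero_lt_one)
    filter_upwards [hC, h1, self_mem_nhdsWithin] with t hCt ht1 ht x
    have ht' : (0 : ℝ) < t := ht
    have k1 := abs_le.1 (hCt x)
    have k2 := hle t ht1 u hub hL x
    have k3 := h.refOp_le_worstCase hφ t hu' x
    rw [le_div_iff₀ ht', div_le_iff₀ ht'] at k1
    rw [abs_le, le_div_iff₀ ht', div_le_iff₀ ht']
    have k4 : 0 ≤ a * t := by positivity
    constructor <;> linarith [k1.1, k1.2]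
  · obtain ⟨A, hA, hconj⟩ := hφ.exists_conjugate_le_conjugate_add h.one_lt (L := L + 2)
      (by linarith)
    set η := min 1 (ε / 3 / (2 * (A + 1))) with hη
    have hη0 : 0 < η := by positivity
    have hη1 : η ≤ 1 := min_le_left _ _
    have hAη : A * (2 * η) ≤ ε / 3 := by
      have : η ≤ ε / 3 / (2 * (A + 1)) := min_le_right _ _
      rw [le_div_iff₀ (by positivity)] at this
      linarith
    have hε3 : 0 < ε / 3 := by positivity
    have hup : ∀ᶠ t : ℝ≥0 in 𝓝[>] 0, ∀ i ∈ Finset.range (⌈L / η⌉₊ + 1), ∀ x, ‖x‖ ≤ r →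
        ‖fderiv ℝ u x‖ ≤ i * η → worstCase p c φ ψ μ t u x ≤
          refOp ψ μ t u x + t * (conjugate φ (i * η + η) + ε / 3) :=
      (eventually_all_finset _).2 fun i _ =>
        h.eventually_worstCase_le hφ hu r (by positivity) hη0 hε3
    have hlow : ∀ᶠ t : ℝ≥0 in 𝓝[>] 0, ∀ i ∈ Finset.range (⌈L / η⌉₊ + 1), ∀ x, ‖x‖ ≤ r →
        i * η ≤ ‖fderiv ℝ u x‖ →
          refOp ψ μ t u x + t * (conjugate φ (i * η) - ε / 3) ≤ worstCase p c φ ψ μ t u x :=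
      (eventually_all_finset _).2 fun i _ => h.eventually_le_worstCase hφ hu r hε3
    filter_upwards [hup, hlow, hconv r (ε / 3) hε3, self_mem_nhdsWithin] with t h1 h2 h3 ht x hx
    have ht' : (0 : ℝ) < t := ht
    have hwL := hL.norm_fderiv_le h.norm_le x
    set w := ‖fderiv ℝ u x‖ with hw
    have hw0 : 0 ≤ w := norm_nonneg _
    have hceil : w ≤ ⌈w / η⌉₊ * η := (div_le_iff₀ hη0).1 (Nat.le_ceil _)
    have hceil' : ⌈w / η⌉₊ * η ≤ w + η := by
      have := (Nat.ceil_lt_add_one (show 0 ≤ w / η by positivity)).le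
      calc (⌈w / η⌉₊ : ℝ) * η ≤ (w / η + 1) * η := by gcongr
        _ = w + η := by field_simp
    have hfloor : ⌊w / η⌋₊ * η ≤ w := (le_div_iff₀ hη0).1 (Nat.floor_le (by positivity))
    have hfloor' : w ≤ ⌊w / η⌋₊ * η + η := by
      have := (Nat.lt_floor_add_one (w / η)).le
      rw [div_le_iff₀ hη0] at this
      linarith
    have hmono : ⌈w / η⌉₊ ≤ ⌈L / η⌉₊ := Nat.ceil_mono (by gcongr)
    have k1 := h1 ⌈w / η⌉₊ (Finset.mem_range.2 (by lia)) x hx hceil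
    have k2 := h2 ⌊w / η⌋₊
      (Finset.mem_range.2 (by have := Nat.floor_le_ceil (w / η); lia)) x hx hfloor
    have k3 := abs_le.1 (h3 x hx)
    rw [le_sub_iff_add_le, le_div_iff₀ ht', sub_le_iff_le_add, div_le_iff₀ ht'] at k3
    have k4 : conjugate φ (⌈w / η⌉₊ * η + η) ≤ conjugate φ w + ε / 3 := by
      have e1 := hconj w (⌈w / η⌉₊ * η + η) (by linarith)
      have e2 : |⌈w / η⌉₊ * η + η - w| ≤ 2 * η := by
        rw [abs_le]
        constructor <;> linarith
      have e3 := mul_le_mul_of_nonneg_left e2 hA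
      linarith
    have k5 : conjugate φ w ≤ conjugate φ (⌊w / η⌋₊ * η) + ε / 3 := by
      have e1 := hconj (⌊w / η⌋₊ * η) w (by linarith)
      have e2 : |w - ⌊w / η⌋₊ * η| ≤ 2 * η := by
        rw [abs_le]
        constructor <;> linarith
      have e3 := mul_le_mul_of_nonneg_left e2 hA
      linarith
    have k6 := mul_le_mul_of_nonneg_left k4 ht'.le
    have k7 := mul_le_mul_of_nonneg_left k5 ht'.le
    rw [abs_le, le_sub_iff_add_le, le_div_iff₀ ht', sub_le_iff_le_add, div_le_iff₀ ht']
    constructor <;> linarith [k3.1, k3.2]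

end IsReferenceProcess

end Generator

end WassersteinSemigroup

theorem mainTheorem1 {X : Type*} [NormedAddCommGroup X] [NormedSpace ℝ X] [CompleteSpace X]
    [TopologicalSpace.SeparableSpace X] [MeasurableSpace X] [BorelSpace X]
    (K : X →L[ℝ] X) (hK_compact : IsCompactOperator K) (hK_dense : DenseRange K)
    (hK_norm : ∀ x : X, ‖K x‖ ≤ ‖x‖)
    (p : ℝ) (hp : 1 < p)
    (μ : ℝ≥0 → Measure X) (hμ : ∀ t : ℝ≥0, μ t ∈ WassersteinSemigroup.Pp p)
    (ψ : ℝ≥0 → X → X)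
    (hCK : ∀ s t : ℝ≥0, ∀ u ∈ WassersteinSemigroup.Cb K, ∀ x : X,
      ∫ y, u (ψ (t + s) x + y) ∂(μ (t + s)) =
        ∫ y, ∫ z, u (ψ s (ψ t x + y) + z) ∂(μ s) ∂(μ t))
    (c : ℝ≥0)
    (hA1 : ∀ (t : ℝ≥0) (x₁ x₂ : X), ‖ψ t x₁ - ψ t x₂‖ ≤ Real.exp (c * t) * ‖x₁ - x₂‖)
    (hA2_comm : ∀ (t : ℝ≥0) (x : X), K (ψ t x) = ψ t (K x))
    (hA2_zero : ∀ x : X, ψ 0 x = x)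
    (hA2_lim : ∀ r : ℝ, TendstoUniformlyOn (fun (h : ℝ≥0) (x : X) => ψ h (K x))
      (fun x : X => K x) (𝓝[>] 0) (Metric.closedBall 0 r))
    (hA3 : Tendsto (fun h : ℝ≥0 => ∫⁻ y, ‖y‖ₑ ^ p ∂(μ h)) (𝓝[>] 0) (𝓝 0))
    (φ : ℝ≥0 → ℝ≥0∞) (hφ_convex : ConvexOn ℝ≥0 Set.univ φ) (hφ_lsc : LowerSemicontinuous φ)
    (hφ_zero : φ 0 = 0) (hφ_ne : ∃ v : ℝ≥0, 0 < v ∧ φ v ≠ 0)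
    (hφ_p : ConvexOn ℝ≥0 Set.univ (fun v : ℝ≥0 => φ (v ^ (1 / p)))) :
    -- the dyadic compositions decrease to `S(t)u`
    (∀ t : ℝ≥0, ∀ u ∈ WassersteinSemigroup.Cb K,
      Antitone (fun n : ℕ => WassersteinSemigroup.dyadicOp p c φ ψ μ n t u) ∧
      ∀ x : X, Tendsto (fun n : ℕ => WassersteinSemigroup.dyadicOp p c φ ψ μ n t u x) atTop
        (𝓝 (WassersteinSemigroup.robustOp p c φ ψ μ t u x))) ∧
    -- `S` is a strongly continuous convex transition semigroup
    WassersteinSemigroup.IsConvexTransitionSemigroup K c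
      (WassersteinSemigroup.robustOp p c φ ψ μ) ∧
    -- the generator of `S` on the domain of the reference generator intersected with `C1b`
    WassersteinSemigroup.genDomain K (WassersteinSemigroup.refOp ψ μ) ∩
        WassersteinSemigroup.C1b K ⊆
      WassersteinSemigroup.genDomain K (WassersteinSemigroup.robustOp p c φ ψ μ) ∧
    ∀ u ∈ WassersteinSemigroup.genDomain K (WassersteinSemigroup.refOp ψ μ) ∩
        WassersteinSemigroup.C1b K, ∀ x : X,
      WassersteinSemigroup.generator K (WassersteinSemigroup.robustOp p c φ ψ μ) u x =
        WassersteinSemigroup.generator K (WassersteinSemigroup.refOp ψ μ) u x +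
          WassersteinSemigroup.conjugate φ ‖fderiv ℝ u x‖ := by
  have : SecondCountableTopology X := UniformSpace.secondCountable_of_separable X
  have h : WassersteinSemigroup.IsReferenceProcess K p c μ ψ :=
    ⟨hK_norm, hp, hμ, hCK, hA1, hA2_comm, hA2_zero, hA2_lim, hA3⟩
  have hφ : WassersteinSemigroup.IsPenalty p φ := ⟨hφ_zero, hφ_ne, hφ_p⟩
  have hI := h.isGeneratingFamily hφ
  have hgen : ∀ u ∈ WassersteinSemigroup.C1b K, ∀ b,
      WassersteinSemigroup.HasGenerator K (WassersteinSemigroup.refOp ψ μ) u b →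
      WassersteinSemigroup.HasGenerator K (WassersteinSemigroup.robustOp p c φ ψ μ) u
        fun x => b x + WassersteinSemigroup.conjugate φ ‖fderiv ℝ u x‖ :=
    fun u hu b hb => hI.hasGenerator_dyadicInf hb.1
      (WassersteinSemigroup.Cb.add hb.2.1 (hφ.conjugate_comp_mem_cb hp hu.2.2))
      (h.locConv_worstCase hφ hu hb.2.2) hb.2.2
  refine ⟨fun t u hu => ⟨hI.antitone_dyadicComp t hu, hI.tendsto_dyadicComp t hu⟩,
    hI.isConvexTransitionSemigroup hK_compact, ?_, ?_⟩
  · rintro u ⟨⟨b, hb⟩, hu⟩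
    exact ⟨_, hgen u hu b hb⟩
  · rintro u ⟨⟨b, hb⟩, hu⟩ x
    rw [(hgen u hu b hb).generator_eq, hb.generator_eq]
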